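/- **Theorem 1.1.** Let $n\ge 3$, $p,q>1$, and $$\Gamma_{SS}(n,p,q)=\max\Big\{\frac{p+2+q^{-1}}{pq-1},\frac{q+2+p^{-1}}{pq-1}\Big\}-\frac{n-1}{2}\ \ge 0 .$$ For $i=1,2$ let $D_i,V_i\in C(\mathbb R^n)$ be radial functions that are of class $C^\delta(B_\delta)$ for some $\delta>0$ (where $B_\delta=\{|x|\le\delta\}$) and satisfy $$0\le D_i(x)\le \alpha_1(1+|x|)^{-\beta},\qquad 0\le V_i(x)\le \alpha_2(1+|x|)^{-\omega},\qquad \beta>1,\ \omega>2 .$$ Let $R>0$ and let $u_0,u_1,v_0,v_1\in C_c^\infty(\mathbb R^n)$ be nonnegative and supported in $B_R$, with $(u_0,u_1)\ne(0,0)$ and $(v_0,v_1)\neq(0,0)$. For $\varepsilon>0$ consider $$u_{tt}-\Delta u+D_1u_t+V_1u=|v|^p,\quad v_{tt}-\Delta v+D_2v_t+V_2v=|u|^q,\quad (u,u_t)|_{t=0}=\varepsilon(u_0,u_1),\quad (v,v_t)|_{t=0}=\varepsilon(v_0,v_1).$$ For $0<T\le\infty$, a weak solution on $[0,T)$ is a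 pair $u,v\in C([0,T),H^1(\mathbb R^n))\cap C^1([0,T),L^2(\mathbb R^n))$ attaining these data, with $u\in L^q_{loc}([0,T)\times\mathbb R^n)$, $v\in L^p_{loc}([0,T)\times\mathbb R^n)$, $\operatorname{supp}(u,v)\subset\{|x|\le t+R\}$, such that for every $\Psi\in C_0^\infty([0,T)\times\mathbb R^n)$ $$\varepsilon\!\int u_1\Psi(0,x)dx+\varepsilon\!\int u_0D_1\Psi(0,x)dx+\int_0^T\!\!\int|v|^p\Psi\,dxdt=\int_0^T\!\!\int\big(-u_t\Psi_t+\nabla u\cdot\nabla\Psi-uD_1\Psi_t+V_1u\Psi\big)dxdt,$$ and the same identity holds with $(u,v,u_0,u_1,D_1,V_1,p)$ replaced by $(v,u,v_0,v_1,D_2,V_2,q)$. The lifespan $T_\varepsilon\in[0,\infty]$ is the supremum of all $T>0$ for which a weak solution on $[0,T)$ exists ($0$ if there is none). Then, for every $\varepsilon>0$, every weak solution blows up in finite time: no weak solution exists on $[0,\infty)$, and $T_\varepsilon<\infty$. Moreover there are constants $\varepsilon_0>0$ and $C>0$, independent of $\varepsilon$, such that for all $\varepsilon\in(0,\varepsilon_0)$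 $$T_\varepsilon\le\begin{cases} C\,\varepsilon^{-\Gamma_{SS}(n,p,q)^{-1}}, & \Gamma_{SS}(n,p,q)>0,\\ \exp\big(C\varepsilon^{-\min\{p(pq-1),\,q(pq-1)\}}\big), & \Gamma_{SS}(n,p,q)=0,\ p\ne q,\\ \exp\big(C\varepsilon^{-p(p-1)}\big), & \Gamma_{SS}(n,p,q)=0,\ p=q=p_S(n),\end{cases}$$ where $p_S(n)$ is the positive root of $2+(n+1)p-(n-1)p^2=0$. -/

import Mathlib

open MeasureTheory Set
open scoped ENNReal NNReal

noncomputable section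

namespace WaveSystem

/-- Euclidean space `ℝⁿ`. -/
abbrev E (n : ℕ) : Type := EuclideanSpace ℝ (Fin n)

/-- The real Hilbert space `L²(ℝⁿ)`. -/
abbrev L2 (n : ℕ) : Type := Lp ℝ 2 (volume : Measure (E n))

/-- The Hilbert space `L²(ℝⁿ; ℝⁿ)` of square integrable vector fields. -/
abbrev L2Vec (n : ℕ) : Type := Lp (E n) 2 (volume : Measure (E n))

/-- The time interval `[0, T)`, where `T ∈ [0, ∞]`. -/
def timeInterval (T : ℝ≥0∞) : Set ℝ := {t : ℝ | 0 ≤ t ∧ ENNReal.ofReal t < T}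

/-- The hypotheses on one coefficient (a damping or a potential): it is continuous on `ℝⁿ`, of
class `C^δ` on the ball `B_δ` for some `δ > 0`, radial, nonnegative, and bounded by
`α (1 + |x|)^(-κ)`. -/
structure IsCoefficient {n : ℕ} (a : E n → ℝ) (α κ : ℝ) : Prop where
  continuous : Continuous a
  holder : ∃ δ : ℝ≥0, 0 < δ ∧ ∃ K : ℝ≥0, HolderOnWith K δ a (Metric.closedBall 0 δ)
  radial : ∀ x y : E n, ‖x‖ = ‖y‖ → a x = a y
  nonneg : ∀ x, 0 ≤ a x
  decay : ∀ x, a x ≤ α * (1 + ‖x‖) ^ (-κ)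

/-- The hypotheses on one pair of initial data: both functions are smooth, nonnegative and
supported in the closed ball of radius `R`, and the pair is nontrivial. -/
structure IsData {n : ℕ} (f g : E n → ℝ) (R : ℝ) : Prop where
  smooth_left : ContDiff ℝ (⊤ : ℕ∞) f
  smooth_right : ContDiff ℝ (⊤ : ℕ∞) g
  nonneg_left : ∀ x, 0 ≤ f x
  nonneg_right : ∀ x, 0 ≤ g x
  support_left : tsupport f ⊆ Metric.closedBall 0 R
  support_right : tsupport g ⊆ Metric.closedBall 0 R
  nontrivial : ¬ (f = 0 ∧ g = 0)

/-- `G` is the weak gradient of `f`: `∫ f ∇φ = - ∫ φ G` for every `φ ∈ C_c^∞(ℝⁿ)`. -/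
def IsWeakGradient {n : ℕ} (f : L2 n) (G : L2Vec n) : Prop :=
  ∀ φ : E n → ℝ, ContDiff ℝ (⊤ : ℕ∞) φ → HasCompactSupport φ →
    ∫ x, f x • gradient φ x = - ∫ x, φ x • G x

/-- `u ∈ C([0,T), H¹(ℝⁿ)) ∩ C¹([0,T), L²(ℝⁿ))`, with time derivative `ut` and weak spatial
gradient `gu`. -/
structure IsEnergyClass {n : ℕ} (T : ℝ≥0∞) (u ut : ℝ → L2 n) (gu : ℝ → L2Vec n) : Prop where
  continuousOn : ContinuousOn u (timeInterval T)
  weakGradient : ∀ t ∈ timeInterval T, IsWeakGradient (u t) (gu t)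
  continuousOn_grad : ContinuousOn gu (timeInterval T)
  hasDeriv : ∀ t ∈ timeInterval T, HasDerivWithinAt u (ut t) (timeInterval T) t
  continuousOn_deriv : ContinuousOn ut (timeInterval T)

/-- `u ∈ L^r_loc([0,T) × ℝⁿ)`. The compact subsets of `[0,T) × ℝⁿ` are those contained in some
`[0,S] × K` with `S < T` and `K` compact. -/
def IsLocLp {n : ℕ} (T : ℝ≥0∞) (r : ℝ) (u : ℝ → L2 n) : Prop :=
  ∀ S ∈ timeInterval T, ∀ K : Set (E n), IsCompact K →
    ∫⁻ t in Ioo 0 S, ∫⁻ x in K, ‖u t x‖ₑ ^ r < ∞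

/-- `Ψ ∈ C_0^∞([0,T) × ℝⁿ)`: (the restriction to `t ≥ 0` of) a smooth function on `ℝ × ℝⁿ` with
compact support contained in `{t < T}`. -/
structure IsTestFunction {n : ℕ} (T : ℝ≥0∞) (Ψ : ℝ → E n → ℝ) : Prop where
  smooth : ContDiff ℝ (⊤ : ℕ∞) (fun z : ℝ × E n => Ψ z.1 z.2)
  compact : HasCompactSupport (fun z : ℝ × E n => Ψ z.1 z.2)
  support : ∀ z ∈ tsupport (fun z : ℝ × E n => Ψ z.1 z.2), ENNReal.ofReal z.1 < T

/-- The weak form on `[0,T) × ℝⁿ` of `u_tt - Δu + D u_t + V u = |w|^p` with data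
`(u, u_t)(0) = (ε f, ε g)`; here `ut`, `gu` are the time derivative and the spatial gradient
of `u`. -/
def WeakEquation {n : ℕ} (T : ℝ≥0∞) (D V : E n → ℝ) (p ε : ℝ) (f g : E n → ℝ)
    (u ut : ℝ → L2 n) (gu : ℝ → L2Vec n) (w : ℝ → L2 n) : Prop :=
  ∀ Ψ : ℝ → E n → ℝ, IsTestFunction T Ψ →
    ε * (∫ x, g x * Ψ 0 x) + ε * (∫ x, f x * D x * Ψ 0 x)
        + (∫ t in timeInterval T, ∫ x, |w t x| ^ p * Ψ t x)
      = - (∫ t in timeInterval T, ∫ x, ut t x * deriv (fun s => Ψ s x) t)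
        + (∫ t in timeInterval T, ∫ x, inner ℝ (gu t x) (gradient (Ψ t) x))
        - (∫ t in timeInterval T, ∫ x, u t x * D x * deriv (fun s => Ψ s x) t)
        + (∫ t in timeInterval T, ∫ x, V x * u t x * Ψ t x)

/-- `u` attains the initial data `(ε f, ε g)`. -/
def AttainsData {n : ℕ} (ε : ℝ) (f g : E n → ℝ) (u ut : ℝ → L2 n) : Prop :=
  (u 0 : E n → ℝ) =ᵐ[volume] (fun x => ε * f x) ∧ (ut 0 : E n → ℝ) =ᵐ[volume] (fun x => ε * g x)

/-- `supp u ⊆ {(t,x) : |x| ≤ t + R}`. -/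
def FiniteSpeed {n : ℕ} (T : ℝ≥0∞) (R : ℝ) (u : ℝ → L2 n) : Prop :=
  ∀ t ∈ timeInterval T, ∀ᵐ x, t + R < ‖x‖ → u t x = 0

/-- `(u, v)` is a weak solution on `[0,T) × ℝⁿ`, with finite speed of propagation, of
`u_tt - Δu + D₁ u_t + V₁ u = |v|^p`, `v_tt - Δv + D₂ v_t + V₂ v = |u|^q`,
`(u, u_t)(0) = (ε u₀, ε u₁)`, `(v, v_t)(0) = (ε v₀, ε v₁)`. -/
def IsWeakSolution {n : ℕ} (p q : ℝ) (D₁ D₂ V₁ V₂ : E n → ℝ) (R : ℝ) (u₀ u₁ v₀ v₁ : E n → ℝ)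
    (ε : ℝ) (T : ℝ≥0∞) (u v : ℝ → L2 n) : Prop :=
  ∃ (ut vt : ℝ → L2 n) (gu gv : ℝ → L2Vec n),
    IsEnergyClass T u ut gu ∧ IsEnergyClass T v vt gv ∧
    IsLocLp T q u ∧ IsLocLp T p v ∧
    AttainsData ε u₀ u₁ u ut ∧ AttainsData ε v₀ v₁ v vt ∧
    FiniteSpeed T R u ∧ FiniteSpeed T R v ∧
    WeakEquation T D₁ V₁ p ε u₀ u₁ u ut gu v ∧
    WeakEquation T D₂ V₂ q ε v₀ v₁ v vt gv u

/-- The lifespan `T_ε ∈ [0, ∞]`: the supremum of the existence times of weak solutions. -/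
def lifespan {n : ℕ} (p q : ℝ) (D₁ D₂ V₁ V₂ : E n → ℝ) (R : ℝ) (u₀ u₁ v₀ v₁ : E n → ℝ)
    (ε : ℝ) : ℝ≥0∞ :=
  sSup {T : ℝ≥0∞ | 0 < T ∧
    ∃ u v : ℝ → L2 n, IsWeakSolution p q D₁ D₂ V₁ V₂ R u₀ u₁ v₀ v₁ ε T u v}

/-- The exponent `Γ_SS(n,p,q)`. -/
def gammaSS (n : ℕ) (p q : ℝ) : ℝ :=
  max ((p + 2 + q⁻¹) / (p * q - 1)) ((q + 2 + p⁻¹) / (p * q - 1)) - ((n : ℝ) - 1) / 2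

/-- `p` is the Strauss exponent `p_S(n)`, the positive root of `2 + (n+1) p - (n-1) p² = 0`. -/
def IsStraussExponent (n : ℕ) (p : ℝ) : Prop :=
  0 < p ∧ 2 + ((n : ℝ) + 1) * p - ((n : ℝ) - 1) * p ^ 2 = 0

end WaveSystem

end

/-!
The proof is a test function argument; no representation of the solution is used.

**Test functions.** The coefficients are radial, so for every `λ ∈ (0, 1]` there is a radial
solution `φ_λ ≥ 1` of `Δφ = (λ² + λD + V)φ`, obtained from a contraction
(`exists_radialSolution`). Since `D = O(r^(-β))` with `β > 1` and `V = O(r^(-ω))` with `ω > 2`, a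
Gronwall argument for the radial equation gives `φ_λ ≤ C (1 + λr)^(-(n-1)/2) e^(λr)`, uniformly in
`λ` (`IsProfilePair.exists_family`). The function `Φ = e^(-λt) φ_λ` solves the adjoint equation
`Φ_tt - ΔΦ - DΦ_t + VΦ = 0`. Multiplying it by a cutoff `Z(t/τ)` leaves the error terms `Z''/τ²` and `λZ'/τ`, and also
`D Z'/τ`, which is too large because `λ` may be much smaller than `D`. That term is removed by
adding the test function `(Z(t/τ))' e^(-λt) φ_λ ψ_λ`, where `φψ` solves
`Δ(φψ) = (λ² + λD + V) φψ - Dφ` (`exists_corrector`). Here `ψ ≤ 0` and `Z' ≤ 0`, so the extra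
nonlinear term has the favourable sign, and `|ψ| ≤ α r` keeps the new errors of size `λ/τ`.

The weak formulation is available for smooth compactly supported test functions only. It is
extended to products `θ(t) f(|x|)` with `f` of class `C²` by mollification, uniformly bounded
convergence and finite speed of propagation (`WeakEquation.separated`). The outcome is
`IsComponent.basic_inequality`: the data plus the mass of `|v|^p` against `e^(-λt) φ_λ` are at most
`C λ/τ` times the mass of `|u|` against the same weight over the dyadic window `(τ/2, τ]`.

**Dyadic windows.** Let `x_k`, `y_k` be the weighted `L^p` mass of `v` and `L^q` mass of `u` over
`(2^(k-1), 2^k]`. Inside the light cone `e^(-λt) φ_λ` is at most a constant times `(λτ)^(-(n-1)/2) e^(-λσ/2)`, with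
`σ` the distance to the boundary of the cone, and Hölder's inequality (`lintegral_window_le`) turns
the basic inequality into three estimates (`exists_window_estimates`). With `λ = 1` the data are
bounded by a power of `y_k`. With `λ = 2^(-k)` the mass `x_k` is bounded by a power of `y_k`.
Superposing all `λ = 2^(-j)`, `j ≤ k`, with suitable powers as weights makes the exponentials add up
to a power of `1 + σ` (`exists_sum_exp_le`) whose `L^(q')` norm is only logarithmic in `2^k`; so a
weighted sum of `x_j` over all `j ≤ k` is bounded by `k^(1-1/q) y_k^(1/q)`. The same holds with the
components exchanged (`exists_dyadicBounds`).

**Conclusion.** Eliminating `x_k` and `y_k` from the first two estimates gives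
`ε ≤ C (2^k)^(-Γ_SS)` (`DyadicBounds.data_le_rpow`), which bounds the existence time if `Γ_SS > 0`.
If `Γ_SS = 0` the powers of `2^k` cancel, and the second and third estimates combine into
`(∑_{j ≤ k} a_j)^m ≤ C k^ν a_k` for suitably normalised masses `a_k`, with `m = pq` and
`ν = p(q-1)` if `q ≤ p`, and `m = p`, `ν = p - 1` for equal powers (`exists_le_of_critical`,
`exists_le_of_critical_eq`). Such an inequality, started from the lower bound of `a_k` by the data,
allows only a bounded number of windows (`rpow_le_of_partial_sums`), and the number of windows is the
logarithm of the existence time.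
-/

open Filter Topology

namespace WaveSystem

/-! ### Radial solutions of elliptic equations -/

/-- The weighted mean `∫₀¹ σ^(n-1) h(rσ) dσ = r^(-n) ∫₀^r τ^(n-1) h(τ) dτ` of a radial profile `h`.
The first expression makes sense and is continuous for every real `r`, including `r = 0`. -/
noncomputable def radAvg (n : ℕ) (h : ℝ → ℝ) (r : ℝ) : ℝ :=
  ∫ σ in (0 : ℝ)..1, σ ^ (n - 1) * h (r * σ)

theorem continuous_radAvg (n : ℕ) {h : ℝ → ℝ} (hh : Continuous h) : Continuous (radAvg n h) := by
  unfold radAvg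
  apply intervalIntegral.continuous_parametric_intervalIntegral_of_continuous'
  unfold Function.uncurry
  fun_prop

theorem pow_mul_radAvg {n : ℕ} (hn : 1 ≤ n) (h : ℝ → ℝ) (r : ℝ) :
    r ^ n * radAvg n h r = ∫ τ in (0 : ℝ)..r, τ ^ (n - 1) * h τ := by
  have h1 := intervalIntegral.mul_integral_comp_mul_left (a := 0) (b := 1)
    (f := fun τ : ℝ => τ ^ (n - 1) * h τ) r
  simp only [mul_zero, mul_one] at h1
  rw [← h1, radAvg, ← intervalIntegral.integral_const_mul, ← intervalIntegral.integral_const_mul]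
  refine intervalIntegral.integral_congr fun σ _ => ?_
  obtain ⟨m, rfl⟩ : ∃ m, n = m + 1 := ⟨n - 1, by omega⟩
  simp only [Nat.add_sub_cancel, mul_pow, pow_succ]
  ring

theorem radAvg_zero {n : ℕ} (hn : 1 ≤ n) (h : ℝ → ℝ) : radAvg n h 0 = h 0 / n := by
  have : ((n - 1 : ℕ) : ℝ) + 1 = n := by
    exact_mod_cast Nat.sub_add_cancel hn
  simp [radAvg, this, div_eq_mul_inv, mul_comm]

theorem radAvg_mono (n : ℕ) {h₁ h₂ : ℝ → ℝ} (c₁ : Continuous h₁) (c₂ : ContinuousOn h₂ (Ici 0))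
    {r : ℝ} (hr : 0 ≤ r) (hle : ∀ s, 0 ≤ s → s ≤ r → h₁ s ≤ h₂ s) :
    radAvg n h₁ r ≤ radAvg n h₂ r := by
  refine intervalIntegral.integral_mono_on zero_le_one ?_ ?_ fun σ hσ => ?_
  · exact Continuous.intervalIntegrable (by fun_prop) _ _
  · refine ContinuousOn.intervalIntegrable ?_
    rw [uIcc_of_le zero_le_one]
    refine (continuous_pow _).continuousOn.mul (c₂.comp (by fun_prop) fun σ hσ => ?_)
    exact mul_nonneg hr hσ.1
  · exact mul_le_mul_of_nonneg_left (hle _ (mul_nonneg hr hσ.1)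
      (mul_le_of_le_one_right hr hσ.2)) (pow_nonneg hσ.1 _)

theorem radAvg_nonneg (n : ℕ) {h : ℝ → ℝ} (hh : ∀ s, 0 ≤ h s) (r : ℝ) : 0 ≤ radAvg n h r :=
  intervalIntegral.integral_nonneg zero_le_one fun _ hσ =>
    mul_nonneg (pow_nonneg hσ.1 _) (hh _)

theorem radAvg_const_mul (n : ℕ) (c : ℝ) (h : ℝ → ℝ) (r : ℝ) :
    radAvg n (fun s => c * h s) r = c * radAvg n h r := by
  rw [radAvg, radAvg, ← intervalIntegral.integral_const_mul]
  exact intervalIntegral.integral_congr fun σ _ => by ring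

theorem radAvg_add (n : ℕ) {h₁ h₂ : ℝ → ℝ} (c₁ : ContinuousOn h₁ (Ici 0))
    (c₂ : ContinuousOn h₂ (Ici 0)) {r : ℝ} (hr : 0 ≤ r) :
    radAvg n (fun s => h₁ s + h₂ s) r = radAvg n h₁ r + radAvg n h₂ r := by
  have key : ∀ h : ℝ → ℝ, ContinuousOn h (Ici 0) →
      IntervalIntegrable (fun σ => σ ^ (n - 1) * h (r * σ)) volume 0 1 := by
    intro h c
    refine ContinuousOn.intervalIntegrable ?_
    rw [uIcc_of_le zero_le_one]
    exact (continuous_pow _).continuousOn.mul (c.comp (by fun_prop) fun σ hσ => mul_nonneg hr hσ.1)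
  rw [radAvg, radAvg, radAvg, ← intervalIntegral.integral_add (key _ c₁) (key _ c₂)]
  exact intervalIntegral.integral_congr fun σ _ => by ring

theorem abs_radAvg_le {n : ℕ} {h : ℝ → ℝ} {r M : ℝ}
    (hM : ∀ s, |s| ≤ |r| → |h s| ≤ M) : |radAvg n h r| ≤ M := by
  have := intervalIntegral.norm_integral_le_of_norm_le_const (a := 0) (b := 1) (C := M)
    (f := fun σ : ℝ => σ ^ (n - 1) * h (r * σ)) ?_
  · simpa [radAvg] using this
  · intro σ hσ
    rw [uIoc_of_le zero_le_one] at hσ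
    have h1 : |h (r * σ)| ≤ M := hM _ (by
      rw [abs_mul, abs_of_pos hσ.1]; exact mul_le_of_le_one_right (abs_nonneg _) hσ.2)
    rw [Real.norm_eq_abs, abs_mul, abs_of_nonneg (pow_nonneg hσ.1.le _)]
    calc σ ^ (n - 1) * |h (r * σ)| ≤ 1 * |h (r * σ)| :=
          mul_le_mul_of_nonneg_right (pow_le_one₀ hσ.1.le hσ.2) (abs_nonneg _)
      _ ≤ M := by rw [one_mul]; exact h1

theorem hasDerivAt_pow_mul_radAvg {n : ℕ} (hn : 1 ≤ n) {h : ℝ → ℝ} (hh : Continuous h) (r : ℝ) :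
    HasDerivAt (fun r => r ^ n * radAvg n h r) (r ^ (n - 1) * h r) r := by
  simp_rw [pow_mul_radAvg hn]
  have hc : Continuous fun τ : ℝ => τ ^ (n - 1) * h τ := by fun_prop
  exact intervalIntegral.integral_hasDerivAt_right (hc.intervalIntegrable _ _)
    hc.aestronglyMeasurable.stronglyMeasurableAtFilter hc.continuousAt

theorem hasDerivAt_radAvg {n : ℕ} (hn : 1 ≤ n) {h : ℝ → ℝ} (hh : Continuous h) {r : ℝ}
    (hr : r ≠ 0) : HasDerivAt (radAvg n h) ((h r - n * radAvg n h r) / r) r := by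
  have h1 := (hasDerivAt_pow_mul_radAvg hn hh r).div (hasDerivAt_pow n r) (pow_ne_zero n hr)
  have h2 : (fun r => r ^ n * radAvg n h r) / (fun r : ℝ => r ^ n) =ᶠ[𝓝 r] radAvg n h := by
    filter_upwards [isOpen_ne.mem_nhds hr] with s hs
    simp only [Pi.div_apply]
    field_simp
  refine (h1.congr_of_eventuallyEq h2.symm).congr_deriv ?_
  obtain ⟨m, rfl⟩ : ∃ m, n = m + 1 := ⟨n - 1, by omega⟩
  simp only [Nat.add_sub_cancel, pow_succ]
  field_simp

/-- The profile `f` solves the radial Poisson equation `Δ f(|x|) = h(|x|)` on `ℝⁿ`: in integrated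
form, `r^(n-1) f'(r) = ∫₀^r τ^(n-1) h(τ) dτ`. -/
structure IsRadialSolution (n : ℕ) (f h : ℝ → ℝ) : Prop where
  continuous_rhs : Continuous h
  hasDerivAt : ∀ r, HasDerivAt f (r * radAvg n h r) r

theorem IsRadialSolution.continuous {n : ℕ} {f h : ℝ → ℝ} (H : IsRadialSolution n f h) :
    Continuous f :=
  continuous_iff_continuousAt.2 fun r => (H.hasDerivAt r).continuousAt

/-- The integral operator that inverts the radial Laplacian, normalised to vanish at the origin. -/
noncomputable def radInv (n : ℕ) (h : ℝ → ℝ) (r : ℝ) : ℝ :=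
  ∫ s in (0 : ℝ)..r, s * radAvg n h s

theorem hasDerivAt_radInv (n : ℕ) {h : ℝ → ℝ} (hh : Continuous h) (r : ℝ) :
    HasDerivAt (radInv n h) (r * radAvg n h r) r := by
  have hc : Continuous fun s : ℝ => s * radAvg n h s := continuous_id.mul (continuous_radAvg n hh)
  exact intervalIntegral.integral_hasDerivAt_right (hc.intervalIntegrable _ _)
    hc.aestronglyMeasurable.stronglyMeasurableAtFilter hc.continuousAt

theorem continuous_radInv (n : ℕ) {h : ℝ → ℝ} (hh : Continuous h) : Continuous (radInv n h) :=
  continuous_iff_continuousAt.2 fun r => (hasDerivAt_radInv n hh r).continuousAt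

theorem radInv_nonneg (n : ℕ) {h : ℝ → ℝ} (hh : ∀ s, 0 ≤ h s) (r : ℝ) : 0 ≤ radInv n h r := by
  rcases le_total 0 r with hr | hr
  · exact intervalIntegral.integral_nonneg hr fun s hs => mul_nonneg hs.1 (radAvg_nonneg n hh s)
  · rw [radInv, intervalIntegral.integral_symm, ← intervalIntegral.integral_neg]
    exact intervalIntegral.integral_nonneg hr fun s hs => by
      have := mul_nonneg (neg_nonneg.2 hs.2) (radAvg_nonneg n hh s)
      linarith

theorem radInv_sub (n : ℕ) {h₁ h₂ : ℝ → ℝ} (c₁ : Continuous h₁) (c₂ : Continuous h₂) (r : ℝ) :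
    radInv n (fun s => h₁ s - h₂ s) r = radInv n h₁ r - radInv n h₂ r := by
  have e : ∀ s, radAvg n (fun s => h₁ s - h₂ s) s = radAvg n h₁ s - radAvg n h₂ s := by
    intro s
    rw [radAvg, radAvg, radAvg, ← intervalIntegral.integral_sub
      (Continuous.intervalIntegrable (by fun_prop) _ _)
      (Continuous.intervalIntegrable (by fun_prop) _ _)]
    exact intervalIntegral.integral_congr fun σ _ => by ring
  have d₁ := continuous_radAvg n c₁
  have d₂ := continuous_radAvg n c₂
  rw [radInv, radInv, radInv, ← intervalIntegral.integral_sub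
    (Continuous.intervalIntegrable (by fun_prop) _ _)
    (Continuous.intervalIntegrable (by fun_prop) _ _)]
  exact intervalIntegral.integral_congr fun s _ => by simp only [e]; ring

/-- The inverse radial Laplacian gains a factor `1 / (2 A)` in the norm with weight
`exp (-A r²)`. -/
theorem abs_radInv_le {n : ℕ} {h : ℝ → ℝ} {A M : ℝ} (hA : 0 < A)
    (hM : ∀ s, |h s| ≤ M * Real.exp (A * s ^ 2)) (r : ℝ) :
    |radInv n h r| ≤ M / (2 * A) * Real.exp (A * r ^ 2) := by
  have hM0 : 0 ≤ M := by simpa using (abs_nonneg _).trans (hM 0)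
  have hk : ∀ s, |radAvg n h s| ≤ M * Real.exp (A * s ^ 2) := fun s =>
    abs_radAvg_le fun t ht => (hM t).trans (by
      have : t ^ 2 ≤ s ^ 2 := sq_le_sq.2 ht
      gcongr)
  have hprim : ∀ r : ℝ, ∫ s in (0 : ℝ)..r, M * (s * Real.exp (A * s ^ 2))
      = M / (2 * A) * (Real.exp (A * r ^ 2) - 1) := by
    intro r
    have : ∀ s ∈ uIcc 0 r, HasDerivAt (fun s => M / (2 * A) * Real.exp (A * s ^ 2))
        (M * (s * Real.exp (A * s ^ 2))) s := by
      intro s _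
      have := (((hasDerivAt_pow 2 s).const_mul A).exp).const_mul (M / (2 * A))
      refine this.congr_deriv ?_
      field_simp
      ring
    rw [intervalIntegral.integral_eq_sub_of_hasDerivAt this
      (Continuous.intervalIntegrable (by fun_prop) _ _)]
    simp
    ring
  have hint : ∀ a b : ℝ,
      IntervalIntegrable (fun s => M * (s * Real.exp (A * s ^ 2))) volume a b :=
    fun a b => Continuous.intervalIntegrable (by fun_prop) _ _
  have hfin : ∀ r : ℝ, M / (2 * A) * (Real.exp (A * r ^ 2) - 1)
      ≤ M / (2 * A) * Real.exp (A * r ^ 2) := fun r => by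
    gcongr; linarith
  rcases le_total 0 r with hr | hr
  · refine le_trans ?_ (hfin r)
    rw [← hprim r, radInv]
    refine intervalIntegral.norm_integral_le_of_norm_le (f := fun s => s * radAvg n h s) hr
      (ae_of_all _ fun s hs => ?_) (hint _ _)
    rw [Real.norm_eq_abs, abs_mul, abs_of_pos hs.1]
    have := mul_le_mul_of_nonneg_left (hk s) hs.1.le
    linarith
  · refine le_trans ?_ (hfin r)
    rw [← hprim r, radInv, intervalIntegral.integral_symm, abs_neg,
      intervalIntegral.integral_symm r 0, ← intervalIntegral.integral_neg]
    refine intervalIntegral.norm_integral_le_of_norm_le (f := fun s => s * radAvg n h s)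
      (g := fun s => -(M * (s * Real.exp (A * s ^ 2)))) hr
      (ae_of_all _ fun s hs => ?_) (hint _ _).neg
    rw [Real.norm_eq_abs, abs_mul, abs_of_nonpos hs.2]
    have := mul_le_mul_of_nonneg_left (hk s) (neg_nonneg.2 hs.2)
    linarith

/-- A bounded nonnegative potential `g` admits a global radial solution of `Δφ = gφ` with
`φ(0) = 1`. It is the fixed point of `φ ↦ 1 + Δ⁻¹(gφ)`, a contraction in the norm
`sup |φ(r)| exp (-A r²)`; the iterates started at `0` are nonnegative, hence `1 ≤ φ`. -/
theorem exists_radialSolution (n : ℕ) {g : ℝ → ℝ} (hg : Continuous g)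
    (hg0 : ∀ r, 0 ≤ g r) {G : ℝ} (hG : ∀ r, g r ≤ G) :
    ∃ φ : ℝ → ℝ, φ 0 = 1 ∧ (∀ r, 1 ≤ φ r) ∧ IsRadialSolution n φ (fun r => g r * φ r) := by
  set A : ℝ := G + 1 with hA
  have hG0 : 0 ≤ G := (hg0 0).trans (hG 0)
  have hApos : 0 < A := by linarith
  have hEE : ∀ r : ℝ, Real.exp (-(A * r ^ 2)) * Real.exp (A * r ^ 2) = 1 := fun r => by
    rw [← Real.exp_add]; simp
  let H : BoundedContinuousFunction ℝ ℝ → ℝ → ℝ := fun y s => g s * (Real.exp (A * s ^ 2) * y s)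
  have hHc : ∀ y, Continuous (H y) := fun y => by
    have := y.continuous
    fun_prop
  have hHb : ∀ (y : BoundedContinuousFunction ℝ ℝ) (M : ℝ), (∀ s, |y s| ≤ M) → ∀ s,
      |H y s| ≤ (G * M) * Real.exp (A * s ^ 2) := by
    intro y M hM s
    simp only [H]
    rw [abs_mul, abs_mul, abs_of_nonneg (hg0 s), Real.abs_exp]
    calc g s * (Real.exp (A * s ^ 2) * |y s|) ≤ G * (Real.exp (A * s ^ 2) * M) := by
          gcongr
          · exact hG s
          · exact hM s
      _ = _ := by ring
  have hGA : ∀ M : ℝ, G * M / (2 * A) = (G / (2 * A)) * M := fun M => by ring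
  have hGAle : G / (2 * A) ≤ 1 / 2 := by
    rw [div_le_div_iff₀ (by positivity) (by norm_num)]; linarith
  have hRb : ∀ (y : BoundedContinuousFunction ℝ ℝ) (M : ℝ), (∀ s, |y s| ≤ M) → ∀ s,
      |Real.exp (-(A * s ^ 2)) * radInv n (H y) s| ≤ 1 / 2 * M := by
    intro y M hM s
    have h0 : 0 ≤ M := (abs_nonneg _).trans (hM 0)
    rw [abs_mul, Real.abs_exp]
    calc _ ≤ Real.exp (-(A * s ^ 2)) * (G * M / (2 * A) * Real.exp (A * s ^ 2)) := by
          gcongr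
          exact abs_radInv_le hApos (hHb y M hM) s
      _ = (G / (2 * A)) * M * (Real.exp (-(A * s ^ 2)) * Real.exp (A * s ^ 2)) := by ring
      _ ≤ 1 / 2 * M := by rw [hEE, mul_one]; gcongr
  let Kf : BoundedContinuousFunction ℝ ℝ → ℝ → ℝ := fun y r =>
    Real.exp (-(A * r ^ 2)) * (1 + radInv n (H y) r)
  let K : BoundedContinuousFunction ℝ ℝ → BoundedContinuousFunction ℝ ℝ := fun y =>
    BoundedContinuousFunction.ofNormedAddCommGroup (Kf y) (by
      have := continuous_radInv n (hHc y)
      simp only [Kf]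
      fun_prop) (1 + 1 / 2 * ‖y‖) (by
      intro r
      simp only [Kf, mul_add, mul_one]
      refine (norm_add_le _ _).trans (add_le_add ?_ ?_)
      · rw [Real.norm_eq_abs, Real.abs_exp, Real.exp_le_one_iff]
        have := sq_nonneg r
        nlinarith
      · exact hRb y ‖y‖ (fun s => y.norm_coe_le_norm s) r)
  have hK : ContractingWith (1 / 2) K := by
    refine ⟨by norm_num, LipschitzWith.of_dist_le_mul fun y z => ?_⟩
    rw [BoundedContinuousFunction.dist_le (by positivity)]
    intro r
    have e : K y r - K z r = Real.exp (-(A * r ^ 2)) * radInv n (H (y - z)) r := by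
      have : H (y - z) = fun s => H y s - H z s := by
        funext s; simp only [H, BoundedContinuousFunction.coe_sub, Pi.sub_apply]; ring
      rw [this, radInv_sub n (hHc y) (hHc z)]
      simp only [K, Kf, BoundedContinuousFunction.coe_ofNormedAddCommGroup]
      ring
    rw [Real.dist_eq, e, dist_eq_norm]
    refine (hRb (y - z) ‖y - z‖ (fun s => (y - z).norm_coe_le_norm s) r).trans (le_of_eq ?_)
    norm_num
  obtain ⟨y, hy⟩ : ∃ y, y = ContractingWith.fixedPoint K hK := ⟨_, rfl⟩
  have hfix : K y = y := by rw [hy]; exact hK.fixedPoint_isFixedPt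
  have hnonneg : ∀ s, 0 ≤ y s := by
    intro s
    have hlim := hK.tendsto_iterate_fixedPoint 0
    rw [← hy] at hlim
    have hlim' : Tendsto (fun j => (K^[j] 0) s) atTop (𝓝 (y s)) :=
      ((BoundedContinuousFunction.lipschitz_eval_const s).continuous.tendsto y).comp hlim
    refine ge_of_tendsto' hlim' fun j => ?_
    have : ∀ j, ∀ s, 0 ≤ (K^[j] 0) s := by
      intro j
      induction j with
      | zero => intro s; simp
      | succ j ih =>
        intro s
        rw [Function.iterate_succ_apply']
        refine mul_nonneg (Real.exp_nonneg _) (add_nonneg zero_le_one (radInv_nonneg n ?_ s))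
        exact fun t => mul_nonneg (hg0 t) (mul_nonneg (Real.exp_nonneg _) (ih t))
    exact this j s
  have hφ : ∀ r, Real.exp (A * r ^ 2) * y r = 1 + radInv n (H y) r := by
    intro r
    have : y r = Kf y r := congrArg (fun z : BoundedContinuousFunction ℝ ℝ => z r) hfix.symm
    rw [this]
    simp only [Kf]
    rw [← mul_assoc, mul_comm (Real.exp (A * r ^ 2)), hEE, one_mul]
  have hHn : ∀ t, 0 ≤ H y t := fun t =>
    mul_nonneg (hg0 t) (mul_nonneg (Real.exp_nonneg _) (hnonneg t))
  obtain ⟨φ, hφe⟩ : ∃ φ : ℝ → ℝ, φ = fun r => 1 + radInv n (H y) r := ⟨_, rfl⟩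
  have hHφ : H y = fun r => g r * φ r := by
    funext s
    simp only [hφe]
    rw [← hφ]
  refine ⟨φ, ?_, fun r => ?_, ⟨hHφ ▸ hHc y, fun r => ?_⟩⟩
  · simp [hφe, radInv]
  · rw [hφe]; linarith [radInv_nonneg n hHn r]
  · rw [← hHφ, hφe]
    exact (hasDerivAt_radInv n (hHc y) r).const_add 1

section

/-! ### Growth of the radial solutions -/

theorem IsRadialSolution.monotoneOn {n : ℕ} {f h : ℝ → ℝ} (H : IsRadialSolution n f h)
    (hh : ∀ r, 0 ≤ h r) : MonotoneOn f (Ici 0) := by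
  refine monotoneOn_of_deriv_nonneg (convex_Ici 0) H.continuous.continuousOn
    (fun r _ => (H.hasDerivAt r).differentiableAt.differentiableWithinAt) fun r hr => ?_
  rw [interior_Ici] at hr
  rw [(H.hasDerivAt r).deriv]
  exact mul_nonneg (le_of_lt hr) (radAvg_nonneg n hh r)

/-- Gronwall's inequality in differential form. -/
theorem le_mul_exp_of_deriv_le {f f' P P' : ℝ → ℝ} {a r : ℝ} (har : a ≤ r)
    (hf : ∀ s, a ≤ s → HasDerivAt f (f' s) s) (hP : ∀ s, a ≤ s → HasDerivAt P (P' s) s)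
    (hle : ∀ s, a ≤ s → f' s ≤ P' s * f s) : f r ≤ f a * Real.exp (P r - P a) := by
  have hd : ∀ s, a ≤ s → HasDerivAt (fun s => f s * Real.exp (-P s))
      (f' s * Real.exp (-P s) + f s * (Real.exp (-P s) * -P' s)) s := fun s hs =>
    (hf s hs).mul (hP s hs).neg.exp
  have hanti : AntitoneOn (fun s => f s * Real.exp (-P s)) (Ici a) := by
    refine antitoneOn_of_deriv_nonpos (convex_Ici a)
      (fun s hs => (hd s hs).continuousAt.continuousWithinAt)
      (fun s hs => (hd s (interior_subset hs)).differentiableAt.differentiableWithinAt)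
      fun s hs => ?_
    have hs' := interior_subset hs
    rw [(hd s hs').deriv]
    have := mul_le_mul_of_nonneg_right (hle s hs') (Real.exp_nonneg (-P s))
    linarith
  have h1 : f r * Real.exp (-P r) ≤ f a * Real.exp (-P a) := hanti self_mem_Ici har har
  have h2 := mul_le_mul_of_nonneg_right h1 (Real.exp_nonneg (P r))
  rw [mul_assoc, ← Real.exp_add, neg_add_cancel, Real.exp_zero, mul_one, mul_assoc,
    ← Real.exp_add] at h2
  rwa [sub_eq_neg_add]

theorem continuousOn_one_add_rpow (κ : ℝ) :
    ContinuousOn (fun s : ℝ => (1 + s) ^ κ) (Ici 0) := by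
  refine ContinuousOn.rpow_const (by fun_prop) fun s hs => Or.inl ?_
  have : (0 : ℝ) ≤ s := hs
  positivity

theorem radAvg_one_add_rpow_le {n : ℕ} (hn : 1 ≤ n) {κ : ℝ} (hκ : 0 ≤ κ) (hκn : κ < n) {r : ℝ}
    (hr : 0 ≤ r) : radAvg n (fun s => (1 + s) ^ (-κ)) r ≤ (1 + r) ^ (-κ) / (n - κ) := by
  have hn1 : ((n - 1 : ℕ) : ℝ) = n - 1 := by rw [Nat.cast_sub hn, Nat.cast_one]
  have h1 : ∫ σ in (0 : ℝ)..1, (1 + r) ^ (-κ) * σ ^ ((n : ℝ) - 1 - κ)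
      = (1 + r) ^ (-κ) / (n - κ) := by
    rw [intervalIntegral.integral_const_mul, integral_rpow (Or.inl (by linarith))]
    rw [Real.one_rpow, Real.zero_rpow (by linarith), sub_zero, mul_one_div]
    ring_nf
  rw [← h1, radAvg]
  refine intervalIntegral.integral_mono_on_of_le_Ioo zero_le_one ?_ ?_ fun σ hσ => ?_
  · refine ContinuousOn.intervalIntegrable ?_
    rw [uIcc_of_le zero_le_one]
    exact (continuous_pow _).continuousOn.mul ((continuousOn_one_add_rpow _).comp (by fun_prop)
      fun σ hσ => mul_nonneg hr hσ.1)
  · exact (intervalIntegral.intervalIntegrable_rpow' (by linarith)).const_mul _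
  · -- `1 + r σ ≥ σ (1 + r)` for `σ ≤ 1`
    have hσ0 : 0 < σ := hσ.1
    have h2 : σ * (1 + r) ≤ 1 + r * σ := by nlinarith [hσ.2]
    have h3 : (1 + r * σ) ^ (-κ) ≤ (σ * (1 + r)) ^ (-κ) :=
      Real.rpow_le_rpow_of_nonpos (by positivity) h2 (by linarith)
    calc σ ^ (n - 1) * (1 + r * σ) ^ (-κ) ≤ σ ^ (n - 1) * (σ * (1 + r)) ^ (-κ) := by gcongr
      _ = (1 + r) ^ (-κ) * (σ ^ ((n : ℝ) - 1) * σ ^ (-κ)) := by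
          rw [Real.mul_rpow hσ0.le (by positivity), ← hn1, Real.rpow_natCast]; ring
      _ = (1 + r) ^ (-κ) * σ ^ ((n : ℝ) - 1 - κ) := by
          rw [← Real.rpow_add hσ0]; ring_nf

/-- For `n ≥ 3` the solution of `Δf = (1 + r)⁻¹` has a bounded radial derivative. -/
theorem mul_radAvg_inv_le {n : ℕ} (hn : 3 ≤ n) {r : ℝ} (hr : 0 ≤ r) :
    r * radAvg n (fun s => (1 + s) ^ (-1 : ℝ)) r ≤ 1 := by
  have hn' : (3 : ℝ) ≤ n := by exact_mod_cast hn
  have h := mul_le_mul_of_nonneg_left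
    (radAvg_one_add_rpow_le (n := n) (by omega) zero_le_one (by linarith) hr) hr
  refine h.trans ?_
  rw [Real.rpow_neg_one, ← mul_div_assoc, div_le_one (by linarith), ← div_eq_mul_inv,
    div_le_iff₀ (by linarith)]
  nlinarith

/-- Bounds on the radial profiles of a damping and a potential; the decay exponent of
the potential is normalised to lie in `(2, 5/2]`, so that for `n ≥ 3` the mean of
`(1 + |x|)^(-ω)` over a ball of `ℝⁿ` is controlled by the value at its boundary. -/
structure IsProfilePair (D V : ℝ → ℝ) (α β ω : ℝ) : Prop where
  continuous_D : Continuous D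
  continuous_V : Continuous V
  D_nonneg : ∀ r, 0 ≤ D r
  V_nonneg : ∀ r, 0 ≤ V r
  D_le : ∀ r, D r ≤ α * (1 + |r|) ^ (-β)
  V_le : ∀ r, V r ≤ α * (1 + |r|) ^ (-ω)
  one_lt : 1 < β
  two_lt : 2 < ω
  le_five_halves : ω ≤ 5 / 2

namespace IsProfilePair

variable {D V : ℝ → ℝ} {α β ω : ℝ}

theorem alpha_nonneg (h : IsProfilePair D V α β ω) : 0 ≤ α := by
  simpa using (h.D_nonneg 0).trans (h.D_le 0)

theorem D_le_inv (h : IsProfilePair D V α β ω) {r : ℝ} (hr : 0 ≤ r) :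
    D r ≤ α * (1 + r) ^ (-1 : ℝ) := by
  have h1 := h.D_le r
  rw [abs_of_nonneg hr] at h1
  refine h1.trans (mul_le_mul_of_nonneg_left ?_ h.alpha_nonneg)
  exact Real.rpow_le_rpow_of_exponent_le (by linarith) (by linarith [h.one_lt])

theorem D_le_const (h : IsProfilePair D V α β ω) (r : ℝ) : D r ≤ α := by
  refine (h.D_le r).trans (mul_le_of_le_one_right h.alpha_nonneg ?_)
  exact Real.rpow_le_one_of_one_le_of_nonpos (by linarith [abs_nonneg r]) (by linarith [h.one_lt])

theorem V_le_const (h : IsProfilePair D V α β ω) (r : ℝ) : V r ≤ α := by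
  refine (h.V_le r).trans (mul_le_of_le_one_right h.alpha_nonneg ?_)
  exact Real.rpow_le_one_of_one_le_of_nonpos (by linarith [abs_nonneg r]) (by linarith [h.two_lt])

theorem continuous_coeff (h : IsProfilePair D V α β ω) (lam : ℝ) :
    Continuous fun r => lam ^ 2 + lam * D r + V r := by
  have := h.continuous_D
  have := h.continuous_V
  fun_prop

theorem coeff_nonneg (h : IsProfilePair D V α β ω) {lam : ℝ} (hl : 0 ≤ lam) (r : ℝ) :
    0 ≤ lam ^ 2 + lam * D r + V r := by
  have := mul_nonneg hl (h.D_nonneg r)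
  have := h.V_nonneg r
  positivity

/-- The logarithmic derivative of a radial solution is controlled by the mean of the potential. -/
theorem deriv_le (h : IsProfilePair D V α β ω) {n : ℕ} (hn : 3 ≤ n) {lam : ℝ} (hl : 0 ≤ lam)
    {φ : ℝ → ℝ} (hφ1 : ∀ r, 1 ≤ φ r)
    (hφ : IsRadialSolution n φ fun r => (lam ^ 2 + lam * D r + V r) * φ r) {r : ℝ} (hr : 0 ≤ r) :
    r * radAvg n (fun r => (lam ^ 2 + lam * D r + V r) * φ r) r
      ≤ (lam ^ 2 * r + lam * α + 2 * α * (1 + r) ^ (1 - ω)) * φ r := by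
  have hn' : (3 : ℝ) ≤ n := by exact_mod_cast hn
  have hα := h.alpha_nonneg
  have hmono := hφ.monotoneOn fun r =>
    mul_nonneg (h.coeff_nonneg hl r) (zero_le_one.trans (hφ1 r))
  have hφ0 : 0 ≤ φ r := zero_le_one.trans (hφ1 r)
  have c1 : ContinuousOn (fun s : ℝ => (1 + s) ^ (-1 : ℝ)) (Ici 0) := continuousOn_one_add_rpow _
  have c2 : ContinuousOn (fun s : ℝ => (1 + s) ^ (-ω)) (Ici 0) := continuousOn_one_add_rpow _
  have c0 : ContinuousOn (fun s : ℝ => (1 + s) ^ (-(0 : ℝ))) (Ici 0) := continuousOn_one_add_rpow _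
  have step : radAvg n (fun r => (lam ^ 2 + lam * D r + V r) * φ r) r
      ≤ radAvg n (fun s => (φ r * lam ^ 2) * (1 + s) ^ (-(0 : ℝ))
        + (φ r * lam * α) * (1 + s) ^ (-1 : ℝ) + (φ r * α) * (1 + s) ^ (-ω)) r := by
    refine radAvg_mono n hφ.continuous_rhs (by fun_prop) hr fun s hs hsr => ?_
    have h1 : φ s ≤ φ r := hmono hs hr hsr
    have h2 := h.D_le_inv hs
    have h3 := h.V_le s
    rw [abs_of_nonneg hs] at h3
    have h4 : lam ^ 2 + lam * D s + V s
        ≤ lam ^ 2 + lam * (α * (1 + s) ^ (-1 : ℝ)) + α * (1 + s) ^ (-ω) := by gcongr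
    calc (lam ^ 2 + lam * D s + V s) * φ s
        ≤ (lam ^ 2 + lam * (α * (1 + s) ^ (-1 : ℝ)) + α * (1 + s) ^ (-ω)) * φ r :=
          mul_le_mul h4 h1 (zero_le_one.trans (hφ1 s)) ((h.coeff_nonneg hl s).trans h4)
      _ = _ := by rw [neg_zero, Real.rpow_zero]; ring
  have hω := h.two_lt
  have hω' := h.le_five_halves
  have e0 : r * radAvg n (fun s => (1 + s) ^ (-(0 : ℝ))) r ≤ r := by
    have := radAvg_one_add_rpow_le (n := n) (by omega) le_rfl (by linarith) hr
    refine (mul_le_of_le_one_right hr (this.trans ?_))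
    rw [neg_zero, Real.rpow_zero, sub_zero, div_le_one (by linarith)]
    linarith
  have e1 := mul_radAvg_inv_le hn hr
  have e2 : r * radAvg n (fun s => (1 + s) ^ (-ω)) r ≤ 2 * (1 + r) ^ (1 - ω) := by
    have h1 := radAvg_one_add_rpow_le (n := n) (by omega) (κ := ω) (by linarith) (by linarith) hr
    have h2 : (1 + r) ^ (1 - ω) = (1 + r) * (1 + r) ^ (-ω) := by
      rw [sub_eq_add_neg, Real.rpow_add (by positivity), Real.rpow_one]
    have h3 : 0 ≤ (1 + r) ^ (-ω) := by positivity
    have h4 : (1 + r) ^ (-ω) / (n - ω) ≤ 2 * (1 + r) ^ (-ω) := by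
      rw [div_le_iff₀ (by linarith)]; nlinarith
    have h5 := mul_le_mul_of_nonneg_left (h1.trans h4) hr
    rw [h2]
    nlinarith
  rw [radAvg_add n (by fun_prop) (by fun_prop) hr, radAvg_add n (by fun_prop) (by fun_prop) hr,
    radAvg_const_mul, radAvg_const_mul, radAvg_const_mul] at step
  have a0 := mul_le_mul_of_nonneg_left e0 (mul_nonneg hφ0 (sq_nonneg lam))
  have a1 := mul_le_mul_of_nonneg_left e1 (mul_nonneg (mul_nonneg hφ0 hl) hα)
  have a2 := mul_le_mul_of_nonneg_left e2 (mul_nonneg hφ0 hα)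
  have a3 := mul_le_mul_of_nonneg_left step hr
  nlinarith

theorem le_exp (h : IsProfilePair D V α β ω) {n : ℕ} (hn : 3 ≤ n) {lam : ℝ} (hl : 0 ≤ lam)
    {φ : ℝ → ℝ} (hφ0 : φ 0 = 1) (hφ1 : ∀ r, 1 ≤ φ r)
    (hφ : IsRadialSolution n φ fun r => (lam ^ 2 + lam * D r + V r) * φ r) {r : ℝ} (hr : 0 ≤ r) :
    φ r ≤ Real.exp ((lam * r) ^ 2 / 2 + α * (lam * r) + 2 * α / (ω - 2)) := by
  have hω : 0 < ω - 2 := by linarith [h.two_lt]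
  have hα := h.alpha_nonneg
  have key := le_mul_exp_of_deriv_le hr (fun s _ => hφ.hasDerivAt s)
    (P := fun s => (lam * s) ^ 2 / 2 + α * (lam * s) - 2 * α / (ω - 2) * (1 + s) ^ (2 - ω))
    (P' := fun s => lam ^ 2 * s + lam * α + 2 * α * (1 + s) ^ (1 - ω)) (fun s hs => ?_)
    (fun s hs => h.deriv_le hn hl hφ1 hφ hs)
  · refine key.trans ?_
    rw [hφ0, one_mul]
    refine Real.exp_le_exp.2 ?_
    have h1 : 0 ≤ 2 * α / (ω - 2) * (1 + r) ^ (2 - ω) := by positivity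
    simp only [mul_zero, add_zero, Real.one_rpow]
    linarith
  · have h1 : HasDerivAt (fun s : ℝ => (1 + s) ^ (2 - ω)) ((2 - ω) * (1 + s) ^ (1 - ω)) s := by
      have := ((hasDerivAt_id s).const_add 1).rpow_const (p := 2 - ω)
        (Or.inl (by simp only [id]; positivity))
      refine this.congr_deriv ?_
      simp only [id]
      ring_nf
    have h2 := ((((hasDerivAt_id s).const_mul lam).pow 2).div_const 2).add
      (((hasDerivAt_id s).const_mul lam).const_mul α)
    have h3 := h2.sub (h1.const_mul (2 * α / (ω - 2)))
    refine h3.congr_deriv ?_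
    simp only [id]
    field_simp
    ring

/-- For `λ r ≥ 1` the quantity `Q = φ' + (λ + μ/r) φ`, `μ = (n-1)/2`, controls `φ` and satisfies
`Q' ≤ (λ - μ/r + O(1/(λ r²) + (1+r)^(-β))) Q`; this produces the factor `(λr)^(-μ) e^(λr)`. -/
theorem le_rpow_mul_exp (h : IsProfilePair D V α β ω) {n : ℕ} (hn : 3 ≤ n) {lam : ℝ} (hl : 0 < lam)
    (hl1 : lam ≤ 1) {φ : ℝ → ℝ} (hφ0 : φ 0 = 1) (hφ1 : ∀ r, 1 ≤ φ r)
    (hφ : IsRadialSolution n φ fun r => (lam ^ 2 + lam * D r + V r) * φ r) {r : ℝ}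
    (hr : 1 ≤ lam * r) {μ : ℝ} (hμ : μ = ((n : ℝ) - 1) / 2) :
    φ r ≤ (2 + μ + 3 * α) * Real.exp (1 / 2 + α + 2 * α / (ω - 2)) *
      Real.exp (μ ^ 2 + α + α / (β - 1)) * ((lam * r) ^ (-μ) * Real.exp (lam * r)) := by
  have hn' : (3 : ℝ) ≤ n := by exact_mod_cast hn
  have hα := h.alpha_nonneg
  have hω := h.two_lt
  have hβ : 0 < β - 1 := by linarith [h.one_lt]
  have hμ1 : 1 ≤ μ := by rw [hμ]; linarith
  set g : ℝ → ℝ := fun r => (lam ^ 2 + lam * D r + V r) * φ r with hg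
  have hg0 : ∀ r, 0 ≤ g r := fun r =>
    mul_nonneg (h.coeff_nonneg hl.le r) (zero_le_one.trans (hφ1 r))
  set k := radAvg n g with hk
  have hk0 : ∀ r, 0 ≤ k r := radAvg_nonneg n hg0
  set a := 1 / lam with ha
  have ha0 : 0 < a := by positivity
  have hla : lam * a = 1 := by rw [ha]; field_simp
  have har : a ≤ r := by rw [ha, div_le_iff₀ hl]; linarith
  have ha1 : 1 ≤ a := by rw [ha, le_div_iff₀ hl]; linarith
  let Q : ℝ → ℝ := fun s => s * k s + (lam + μ / s) * φ s
  let Q' : ℝ → ℝ := fun s => (1 * k s + s * ((g s - n * k s) / s)) +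
    ((-μ / s ^ 2) * φ s + (lam + μ / s) * (s * k s))
  let P : ℝ → ℝ := fun s => lam * s - (μ ^ 2 + α) / (lam * s) -
    α / (β - 1) * (1 + s) ^ (1 - β) - μ * Real.log s
  let P' : ℝ → ℝ := fun s => lam + (μ ^ 2 + α) / (lam * s ^ 2) + α * (1 + s) ^ (-β) - μ / s
  have hQd : ∀ s, a ≤ s → HasDerivAt Q (Q' s) s := by
    intro s hs
    have hs0 : s ≠ 0 := (ha0.trans_le hs).ne'
    have h1 := (hasDerivAt_id s).mul (hasDerivAt_radAvg (n := n) (by omega) hφ.continuous_rhs hs0)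
    have h2 : HasDerivAt (fun s => lam + μ / s) (-μ / s ^ 2) s := by
      have := ((hasDerivAt_inv hs0).const_mul μ).const_add lam
      refine (this.congr_of_eventuallyEq (Eventually.of_forall fun t => ?_)).congr_deriv ?_
      · simp only [div_eq_mul_inv]
      · field_simp
    exact h1.add (h2.mul (hφ.hasDerivAt s))
  have hPd : ∀ s, a ≤ s → HasDerivAt P (P' s) s := by
    intro s hs
    have hs0 : 0 < s := ha0.trans_le hs
    have h1 : HasDerivAt (fun s => (μ ^ 2 + α) / (lam * s)) (-((μ ^ 2 + α) / (lam * s ^ 2))) s := by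
      have := ((hasDerivAt_inv hs0.ne').const_mul ((μ ^ 2 + α) / lam))
      refine (this.congr_of_eventuallyEq (Eventually.of_forall fun t => ?_)).congr_deriv ?_
      · simp only [div_eq_mul_inv, mul_inv]; ring
      · field_simp
    have h2 : HasDerivAt (fun s : ℝ => (1 + s) ^ (1 - β)) ((1 - β) * (1 + s) ^ (-β)) s := by
      have := ((hasDerivAt_id s).const_add 1).rpow_const (p := 1 - β)
        (Or.inl (by simp only [id]; positivity))
      refine this.congr_deriv ?_
      simp only [id]
      ring_nf
    have h3 := ((((hasDerivAt_id s).const_mul lam).sub h1).sub (h2.const_mul (α / (β - 1)))).sub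
      ((Real.hasDerivAt_log hs0.ne').const_mul μ)
    refine h3.congr_deriv ?_
    simp only [P']
    field_simp
    ring
  have hφQ : ∀ s, a ≤ s → lam * φ s ≤ Q s := by
    intro s hs
    have hs0 : 0 < s := ha0.trans_le hs
    have h1 : 0 ≤ s * k s := mul_nonneg hs0.le (hk0 s)
    have h2 : 0 ≤ μ / s * φ s := mul_nonneg (by positivity) (zero_le_one.trans (hφ1 s))
    simp only [Q]
    linarith
  have hle : ∀ s, a ≤ s → Q' s ≤ P' s * Q s := by
    intro s hs
    have hs0 : 0 < s := ha0.trans_le hs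
    have hφs : 0 ≤ φ s := zero_le_one.trans (hφ1 s)
    have hn2 : (n : ℝ) = 2 * μ + 1 := by rw [hμ]; ring
    have e1 : Q' s - (lam - μ / s) * Q s
        = (lam * D s + V s + (μ ^ 2 - μ) / s ^ 2) * φ s := by
      simp only [Q', Q, g, hn2]
      field_simp
      ring
    have hV : V s ≤ α / s ^ 2 := by
      refine (h.V_le s).trans ?_
      rw [abs_of_pos hs0, div_eq_mul_inv]
      refine mul_le_mul_of_nonneg_left ?_ hα
      rw [Real.rpow_neg (by positivity), ← Real.rpow_two]
      refine inv_anti₀ (by positivity) ?_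
      calc s ^ (2 : ℝ) ≤ (1 + s) ^ (2 : ℝ) := by gcongr; linarith
        _ ≤ (1 + s) ^ ω := Real.rpow_le_rpow_of_exponent_le (by linarith) hω.le
    have hD : D s ≤ α * (1 + s) ^ (-β) := by
      have := h.D_le s
      rwa [abs_of_pos hs0] at this
    have e2 : lam * D s + V s + (μ ^ 2 - μ) / s ^ 2
        ≤ lam * ((μ ^ 2 + α) / (lam * s ^ 2) + α * (1 + s) ^ (-β)) := by
      have h1 : lam * D s ≤ lam * (α * (1 + s) ^ (-β)) := mul_le_mul_of_nonneg_left hD hl.le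
      have h2 : (μ ^ 2 - μ) / s ^ 2 ≤ μ ^ 2 / s ^ 2 := by gcongr; linarith
      have h3 : lam * ((μ ^ 2 + α) / (lam * s ^ 2)) = μ ^ 2 / s ^ 2 + α / s ^ 2 := by field_simp
      rw [mul_add, h3]
      linarith
    have e3 : 0 ≤ (μ ^ 2 + α) / (lam * s ^ 2) + α * (1 + s) ^ (-β) := by positivity
    have e4 := mul_le_mul_of_nonneg_right e2 hφs
    have e5 := mul_le_mul_of_nonneg_left (hφQ s hs) e3
    have e6 : P' s * Q s = (lam - μ / s) * Q s +
        ((μ ^ 2 + α) / (lam * s ^ 2) + α * (1 + s) ^ (-β)) * Q s := by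
      simp only [P']; ring
    rw [e6]
    linarith
  have hmain := le_mul_exp_of_deriv_le har hQd hPd hle
  have hφa : φ a ≤ Real.exp (1 / 2 + α + 2 * α / (ω - 2)) := by
    have := h.le_exp hn hl.le hφ0 hφ1 hφ ha0.le
    rw [hla] at this
    simpa using this
  have hQa : Q a ≤ lam * (2 + μ + 3 * α) * φ a := by
    have h1 := h.deriv_le hn hl.le hφ1 hφ ha0.le
    have h2 : (1 + a) ^ (1 - ω) ≤ lam := by
      calc (1 + a) ^ (1 - ω) ≤ (1 + a) ^ (-1 : ℝ) :=
            Real.rpow_le_rpow_of_exponent_le (by linarith) (by linarith)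
        _ ≤ a ^ (-1 : ℝ) := Real.rpow_le_rpow_of_nonpos ha0 (by linarith) (by norm_num)
        _ = lam := by rw [Real.rpow_neg_one, ha]; field_simp
    have h3 : μ / a = μ * lam := by rw [ha]; field_simp
    have h4 : lam ^ 2 * a = lam := by rw [pow_two, mul_assoc, hla, mul_one]
    have hφa0 : 0 ≤ φ a := zero_le_one.trans (hφ1 a)
    have h5 : (lam ^ 2 * a + lam * α + 2 * α * (1 + a) ^ (1 - ω)) * φ a
        ≤ (lam + lam * α + 2 * α * lam) * φ a := by
      rw [h4]; gcongr
    simp only [Q, h3]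
    have h6 : a * k a ≤ (lam + lam * α + 2 * α * lam) * φ a := h1.trans h5
    linarith
  have hPP : P r - P a ≤ lam * r - μ * Real.log (lam * r) + (μ ^ 2 + α + α / (β - 1)) := by
    have hr0 : 0 < r := ha0.trans_le har
    have h1 : Real.log a = - Real.log lam := by rw [ha, one_div, Real.log_inv]
    have h2 : 0 ≤ (μ ^ 2 + α) / (lam * r) := by positivity
    have h3 : 0 ≤ α / (β - 1) * (1 + r) ^ (1 - β) := by positivity
    have h4 : α / (β - 1) * (1 + a) ^ (1 - β) ≤ α / (β - 1) :=
      mul_le_of_le_one_right (by positivity)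
        (Real.rpow_le_one_of_one_le_of_nonpos (by linarith) (by linarith))
    simp only [P, hla, h1, Real.log_mul hl.ne' hr0.ne', div_one]
    linarith
  have hlr : 0 < lam * r := by linarith
  have hexp : Real.exp (P r - P a) ≤ Real.exp (μ ^ 2 + α + α / (β - 1)) *
      ((lam * r) ^ (-μ) * Real.exp (lam * r)) := by
    refine (Real.exp_le_exp.2 hPP).trans (le_of_eq ?_)
    rw [Real.rpow_def_of_pos hlr, ← Real.exp_add, ← Real.exp_add]
    ring_nf
  have hfin : lam * φ r ≤ lam * ((2 + μ + 3 * α) * Real.exp (1 / 2 + α + 2 * α / (ω - 2)) *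
      Real.exp (μ ^ 2 + α + α / (β - 1)) * ((lam * r) ^ (-μ) * Real.exp (lam * r))) := by
    refine (hφQ r har).trans (hmain.trans ?_)
    have h1 : Q a ≤ lam * (2 + μ + 3 * α) * Real.exp (1 / 2 + α + 2 * α / (ω - 2)) :=
      hQa.trans (by gcongr)
    calc Q a * Real.exp (P r - P a)
        ≤ (lam * (2 + μ + 3 * α) * Real.exp (1 / 2 + α + 2 * α / (ω - 2))) *
          (Real.exp (μ ^ 2 + α + α / (β - 1)) * ((lam * r) ^ (-μ) * Real.exp (lam * r))) := by
          refine mul_le_mul h1 hexp (Real.exp_nonneg _) (by positivity)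
      _ = _ := by ring
  exact le_of_mul_le_mul_left hfin hl

end IsProfilePair

/-- The corrector. If `Δφ = gφ` then `χ = φ w` with `(r^(n-1) φ² w')' = -r^(n-1) d φ²`,
`w(0) = 0`, solves `Δχ = gχ - dφ`; moreover `w ≤ 0`, and `|w|` grows at most linearly as soon as
`d` decays like `1/r`. -/
theorem exists_corrector {n : ℕ} (hn : 3 ≤ n) {g d φ : ℝ → ℝ} {α : ℝ} (hα : 0 ≤ α)
    (hg : Continuous g) (hg0 : ∀ r, 0 ≤ g r) (hd : Continuous d) (hd0 : ∀ r, 0 ≤ d r)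
    (hdα : ∀ r, 0 ≤ r → d r ≤ α * (1 + r) ^ (-1 : ℝ)) (hφ1 : ∀ r, 1 ≤ φ r)
    (hφ : IsRadialSolution n φ (fun r => g r * φ r)) :
    ∃ w : ℝ → ℝ, (∀ r, 0 ≤ r → -(α * r) ≤ w r) ∧ (∀ r, 0 ≤ r → w r ≤ 0) ∧
      IsRadialSolution n (fun r => φ r * w r) (fun r => g r * (φ r * w r) - d r * φ r) := by
  have hn1 : 1 ≤ n := by omega
  have hφ0 : ∀ r, 0 < φ r := fun r => zero_lt_one.trans_le (hφ1 r)
  have hφc := hφ.continuous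
  have hmono := hφ.monotoneOn fun r => mul_nonneg (hg0 r) (hφ0 r).le
  have hdc : Continuous fun r => d r * φ r ^ 2 := by fun_prop
  let W : ℝ → ℝ := fun s => s * radAvg n (fun r => d r * φ r ^ 2) s / φ s ^ 2
  have hWc : Continuous W := by
    have := continuous_radAvg n hdc
    exact (continuous_id.mul this).div (by fun_prop) fun s => (pow_pos (hφ0 s) 2).ne'
  have hW0 : ∀ s, 0 ≤ s → 0 ≤ W s := fun s hs => by
    have := radAvg_nonneg n (fun r => mul_nonneg (hd0 r) (sq_nonneg (φ r))) s
    simp only [W]; positivity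
  have hWα : ∀ s, 0 ≤ s → W s ≤ α := by
    intro s hs
    have h1 : radAvg n (fun r => d r * φ r ^ 2) s
        ≤ radAvg n (fun r => (φ s ^ 2 * α) * (1 + r) ^ (-1 : ℝ)) s := by
      refine radAvg_mono n hdc ((continuousOn_one_add_rpow _).const_mul _) hs fun t ht hts => ?_
      have h2 : φ t ≤ φ s := hmono ht hs hts
      have h3 : φ t ^ 2 ≤ φ s ^ 2 := pow_le_pow_left₀ (hφ0 t).le h2 2
      calc d t * φ t ^ 2 ≤ (α * (1 + t) ^ (-1 : ℝ)) * φ s ^ 2 :=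
            mul_le_mul (hdα t ht) h3 (sq_nonneg _) ((hd0 t).trans (hdα t ht))
        _ = _ := by ring
    rw [radAvg_const_mul] at h1
    simp only [W]
    rw [div_le_iff₀ (pow_pos (hφ0 s) 2)]
    have h2 := mul_le_mul_of_nonneg_left h1 hs
    have h3 := mul_le_mul_of_nonneg_left (mul_radAvg_inv_le hn hs)
      (mul_nonneg (sq_nonneg (φ s)) hα)
    nlinarith
  let w : ℝ → ℝ := fun r => -∫ s in (0 : ℝ)..r, W s
  have hwd : ∀ r, HasDerivAt w (-W r) r := fun r =>
    (intervalIntegral.integral_hasDerivAt_right (hWc.intervalIntegrable _ _)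
      hWc.aestronglyMeasurable.stronglyMeasurableAtFilter hWc.continuousAt).neg
  have hwc : Continuous w := continuous_iff_continuousAt.2 fun r => (hwd r).continuousAt
  have hrc : Continuous fun r => g r * (φ r * w r) - d r * φ r := by fun_prop
  refine ⟨w, fun r hr => ?_, fun r hr => ?_, hrc, fun r => ?_⟩
  · have h1 : ∫ s in (0 : ℝ)..r, W s ≤ ∫ s in (0 : ℝ)..r, α :=
      intervalIntegral.integral_mono_on hr (hWc.intervalIntegrable _ _)
        (continuous_const.intervalIntegrable _ _) fun s hs => hWα s hs.1
    rw [intervalIntegral.integral_const, smul_eq_mul, sub_zero] at h1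
    simp only [w]
    linarith
  · exact neg_nonpos.2 (intervalIntegral.integral_nonneg hr fun s hs => hW0 s hs.1)
  · -- both sides of `r^(n-1) χ' = ∫₀^r τ^(n-1) (gχ - dφ)` have the same derivative
    have key : ∀ r, r ^ n * radAvg n (fun r => g r * (φ r * w r) - d r * φ r) r
        = (r ^ n * radAvg n (fun r => g r * φ r) r) * w r
          - (r ^ n * radAvg n (fun r => d r * φ r ^ 2) r) / φ r := by
      have hder : ∀ r, HasDerivAt (fun r =>
          r ^ n * radAvg n (fun r => g r * (φ r * w r) - d r * φ r) r
          - ((r ^ n * radAvg n (fun r => g r * φ r) r) * w r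
          - (r ^ n * radAvg n (fun r => d r * φ r ^ 2) r) / φ r)) 0 r := by
        intro r
        have h1 := hasDerivAt_pow_mul_radAvg hn1 hrc r
        have h2 := (hasDerivAt_pow_mul_radAvg hn1 hφ.continuous_rhs r).mul (hwd r)
        have h3 := (hasDerivAt_pow_mul_radAvg hn1 hdc r).div (hφ.hasDerivAt r) (hφ0 r).ne'
        refine (h1.sub (h2.sub h3)).congr_deriv ?_
        have := (hφ0 r).ne'
        simp only [W]
        field_simp
        ring
      intro r
      have := is_const_of_deriv_eq_zero (fun r => (hder r).differentiableAt)
        (fun r => (hder r).deriv) r 0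
      simp only [zero_pow (show n ≠ 0 by omega), zero_mul, zero_div, sub_zero] at this
      linarith
    refine ((hφ.hasDerivAt r).mul (hwd r)).congr_deriv ?_
    rcases eq_or_ne r 0 with rfl | hr
    · simp [W]
    · have h1 := key r
      have h2 : r ^ n ≠ 0 := pow_ne_zero n hr
      have h3 := (hφ0 r).ne'
      have h4 : radAvg n (fun r => g r * (φ r * w r) - d r * φ r) r
          = radAvg n (fun r => g r * φ r) r * w r - radAvg n (fun r => d r * φ r ^ 2) r / φ r := by
        apply mul_left_cancel₀ h2
        rw [h1]
        ring
      rw [h4]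
      simp only [W]
      field_simp
      ring

/-- The family `φ_λ` of positive radial solutions of `Δφ = (λ² + λD + V)φ`, with their correctors
and with growth bounds uniform in `λ ∈ (0, 1]`. -/
theorem IsProfilePair.exists_family {D V : ℝ → ℝ} {α β ω : ℝ} (h : IsProfilePair D V α β ω)
    {n : ℕ} (hn : 3 ≤ n) :
    ∃ C : ℝ, 1 ≤ C ∧ ∀ lam : ℝ, 0 < lam → lam ≤ 1 → ∃ φ w : ℝ → ℝ,
      (∀ r, 1 ≤ φ r) ∧
      (∀ r, 0 ≤ r → φ r ≤ C * ((1 + lam * r) ^ (-(((n : ℝ) - 1) / 2)) * Real.exp (lam * r))) ∧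
      (∀ r, 0 ≤ r → -(α * r) ≤ w r) ∧ (∀ r, 0 ≤ r → w r ≤ 0) ∧
      IsRadialSolution n φ (fun r => (lam ^ 2 + lam * D r + V r) * φ r) ∧
      IsRadialSolution n (fun r => φ r * w r)
        (fun r => (lam ^ 2 + lam * D r + V r) * (φ r * w r) - D r * φ r) := by
  have hn' : (3 : ℝ) ≤ n := by exact_mod_cast hn
  have hα := h.alpha_nonneg
  have hω : 0 < ω - 2 := by linarith [h.two_lt]
  have hβ : 0 < β - 1 := by linarith [h.one_lt]
  obtain ⟨μ, hμ⟩ : ∃ μ : ℝ, μ = ((n : ℝ) - 1) / 2 := ⟨_, rfl⟩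
  have hμ1 : 1 ≤ μ := by rw [hμ]; linarith
  set E₁ := Real.exp (1 / 2 + α + 2 * α / (ω - 2)) with hE₁
  set E₂ := Real.exp (μ ^ 2 + α + α / (β - 1)) with hE₂
  have hE₁1 : 1 ≤ E₁ := Real.one_le_exp (by positivity)
  have hE₂1 : 1 ≤ E₂ := Real.one_le_exp (by positivity)
  have h2μ : 1 ≤ (2 : ℝ) ^ μ := Real.one_le_rpow (by norm_num) (by linarith)
  refine ⟨(2 + μ + 3 * α) * E₁ * E₂ * 2 ^ μ, ?_, fun lam hl hl1 => ?_⟩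
  · have h1 : 1 ≤ 2 + μ + 3 * α := by linarith
    have := one_le_mul_of_one_le_of_one_le h1 hE₁1
    have := one_le_mul_of_one_le_of_one_le this hE₂1
    exact one_le_mul_of_one_le_of_one_le this h2μ
  · have hG : ∀ r, lam ^ 2 + lam * D r + V r ≤ 1 + 1 * α + α := fun r => by
      have h1 : lam ^ 2 ≤ 1 := pow_le_one₀ hl.le hl1
      have h2 : lam * D r ≤ 1 * α := mul_le_mul hl1 (h.D_le_const r) (h.D_nonneg r) zero_le_one
      have h3 := h.V_le_const r
      linarith
    obtain ⟨φ, hφ0, hφ1, hφ⟩ := exists_radialSolution n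
      (h.continuous_coeff lam) (h.coeff_nonneg hl.le) hG
    obtain ⟨w, hw1, hw2, hw3⟩ := exists_corrector hn hα (h.continuous_coeff lam)
      (h.coeff_nonneg hl.le) h.continuous_D h.D_nonneg (fun r hr => h.D_le_inv hr) hφ1 hφ
    refine ⟨φ, w, hφ1, fun r hr => ?_, hw1, hw2, hφ, hw3⟩
    rw [← hμ]
    rcases le_total 1 (lam * r) with hr1 | hr1
    · refine (h.le_rpow_mul_exp hn hl hl1 hφ0 hφ1 hφ hr1 hμ).trans ?_
      rw [← hE₁, ← hE₂, mul_assoc _ ((2 : ℝ) ^ μ), ← mul_assoc ((2 : ℝ) ^ μ)]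
      gcongr
      have h1 : (1 + lam * r) / 2 ≤ lam * r := by linarith
      calc (lam * r) ^ (-μ) ≤ ((1 + lam * r) / 2) ^ (-μ) :=
            Real.rpow_le_rpow_of_nonpos (by linarith) h1 (by linarith)
        _ = 2 ^ μ * (1 + lam * r) ^ (-μ) := by
            rw [Real.div_rpow (by linarith) (by norm_num), Real.rpow_neg (by norm_num : (0:ℝ) ≤ 2)]
            field_simp
    · have hlr : 0 ≤ lam * r := by positivity
      have h1 : φ r ≤ E₁ := by
        refine (h.le_exp hn hl.le hφ0 hφ1 hφ hr).trans (Real.exp_le_exp.2 ?_)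
        have : (lam * r) ^ 2 ≤ 1 := pow_le_one₀ hlr hr1
        have : α * (lam * r) ≤ α := mul_le_of_le_one_right hα hr1
        linarith
      have h2 : 1 ≤ 2 ^ μ * ((1 + lam * r) ^ (-μ) * Real.exp (lam * r)) := by
        have h3 : (2 : ℝ) ^ (-μ) ≤ (1 + lam * r) ^ (-μ) :=
          Real.rpow_le_rpow_of_nonpos (by linarith) (by linarith) (by linarith)
        have h4 : 1 ≤ Real.exp (lam * r) := Real.one_le_exp hlr
        have h5 : (2 : ℝ) ^ μ * 2 ^ (-μ) = 1 := by
          rw [← Real.rpow_add (by norm_num)]; simp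
        calc (1 : ℝ) = 2 ^ μ * (2 ^ (-μ) * 1) := by rw [mul_one, h5]
          _ ≤ _ := by gcongr
      have h6 : E₁ ≤ (2 + μ + 3 * α) * E₁ * E₂ := by
        have h7 : 1 ≤ (2 + μ + 3 * α) * E₂ :=
          one_le_mul_of_one_le_of_one_le (by linarith) hE₂1
        nlinarith
      have h8 : 0 ≤ (2 + μ + 3 * α) * E₁ * E₂ := by positivity
      calc φ r ≤ (2 + μ + 3 * α) * E₁ * E₂ * 1 := by rw [mul_one]; exact h1.trans h6
        _ ≤ (2 + μ + 3 * α) * E₁ * E₂ * (2 ^ μ * ((1 + lam * r) ^ (-μ) * Real.exp (lam * r))) :=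
          mul_le_mul_of_nonneg_left h2 h8
        _ = _ := by ring

end

section

/-! ### The Laplacian of radial functions -/

/-- The standard basis vectors of `ℝⁿ`. -/
noncomputable def basisVec {n : ℕ} (i : Fin n) : E n := EuclideanSpace.single i 1

/-- The Laplacian, as the sum of the second derivatives along the standard basis. -/
noncomputable def lap {n : ℕ} (f : E n → ℝ) (x : E n) : ℝ :=
  ∑ i, fderiv ℝ (fun y => fderiv ℝ f y (basisVec i)) x (basisVec i)

theorem contDiff_partial {n : ℕ} {f : E n → ℝ} {m k : WithTop ℕ∞} (hf : ContDiff ℝ m f)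
    (hk : k + 1 ≤ m) (v : E n) : ContDiff ℝ k (fun y => fderiv ℝ f y v) :=
  (hf.fderiv_right hk).clm_apply contDiff_const

theorem continuous_lap {n : ℕ} {f : E n → ℝ} (hf : ContDiff ℝ 2 f) : Continuous (lap f) := by
  unfold lap
  refine continuous_finsetSum _ fun i _ => ?_
  exact ((contDiff_partial hf (k := 1) (by norm_num) (basisVec i)).continuous_fderiv
    (by norm_num)).clm_apply continuous_const

theorem lap_congr {n : ℕ} {f g : E n → ℝ} {x : E n} (h : f =ᶠ[𝓝 x] g) : lap f x = lap g x := by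
  unfold lap
  refine Finset.sum_congr rfl fun i _ => ?_
  have : (fun y => fderiv ℝ f y (basisVec i)) =ᶠ[𝓝 x] fun y => fderiv ℝ g y (basisVec i) := by
    filter_upwards [h.eventuallyEq_nhds] with y hy
    rw [hy.fderiv_eq]
  rw [this.fderiv_eq]

theorem sum_sq_coord {n : ℕ} (x : E n) : ∑ i, x i * x i = ‖x‖ ^ 2 := by
  rw [EuclideanSpace.norm_eq, Real.sq_sqrt (Finset.sum_nonneg fun i _ => by positivity)]
  exact Finset.sum_congr rfl fun i _ => by rw [Real.norm_eq_abs, sq_abs, pow_two]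

theorem hasFDerivAt_norm_of_ne {n : ℕ} {x : E n} (hx : x ≠ 0) :
    HasFDerivAt (fun y : E n => ‖y‖) ((1 / ‖x‖) • innerSL ℝ x) x := by
  have h2 : HasFDerivAt (fun y : E n => ‖y‖ ^ 2) (2 • innerSL ℝ x) x :=
    (hasStrictFDerivAt_norm_sq x).hasFDerivAt
  have h3 := h2.sqrt (pow_ne_zero 2 (norm_ne_zero_iff.2 hx))
  simp only [Real.sqrt_sq (norm_nonneg _)] at h3
  refine h3.congr_fderiv ?_
  ext v
  simp
  ring

namespace IsRadialSolution

variable {n : ℕ} {f h : ℝ → ℝ}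

theorem hasFDerivAt_norm (H : IsRadialSolution n f h) (x : E n) :
    HasFDerivAt (fun y : E n => f ‖y‖) (radAvg n h ‖x‖ • innerSL ℝ x) x := by
  rcases eq_or_ne x 0 with rfl | hx
  · -- at the origin `f` has a critical point
    have h1 : HasDerivAt f 0 ‖(0 : E n)‖ := by simpa using H.hasDerivAt 0
    have h2 : (fun y : E n => f ‖y‖ - f ‖(0 : E n)‖) =o[𝓝 0] fun y : E n => y := by
      have := (hasDerivAt_iff_isLittleO.1 h1).comp_tendsto
        (continuous_norm.tendsto (0 : E n))
      simp only [Function.comp_def, norm_zero, sub_zero, smul_zero] at this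
      simpa using this.of_norm_right
    rw [hasFDerivAt_iff_isLittleO]
    simpa using h2
  · have hn0 : ‖x‖ ≠ 0 := norm_ne_zero_iff.2 hx
    refine ((H.hasDerivAt ‖x‖).comp_hasFDerivAt x (hasFDerivAt_norm_of_ne hx)).congr_fderiv ?_
    ext v
    simp
    field_simp

theorem hasFDerivAt_partial (hn : 1 ≤ n) (H : IsRadialSolution n f h) (x v : E n) :
    HasFDerivAt (fun y : E n => radAvg n h ‖y‖ * inner ℝ y v)
      (radAvg n h ‖x‖ • innerSL ℝ v +
        ((h ‖x‖ - n * radAvg n h ‖x‖) / ‖x‖ ^ 2 * inner ℝ x v) • innerSL ℝ x) x := by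
  have hlin : ∀ x : E n, HasFDerivAt (fun y : E n => inner ℝ y v) (innerSL ℝ v) x := fun x => by
    have := (innerSL ℝ v).hasFDerivAt (x := x)
    refine this.congr_of_eventuallyEq (Eventually.of_forall fun y => ?_)
    simp [real_inner_comm]
  rcases eq_or_ne x 0 with rfl | hx
  · have hc : Continuous fun y : E n => radAvg n h ‖y‖ :=
      (continuous_radAvg n H.continuous_rhs).comp continuous_norm
    have h1 : (fun y : E n => (radAvg n h ‖y‖ - radAvg n h ‖(0 : E n)‖) * inner ℝ y v)
        =o[𝓝 0] fun y : E n => y := by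
      have a1 : (fun y : E n => radAvg n h ‖y‖ - radAvg n h ‖(0 : E n)‖)
          =o[𝓝 0] fun _ => (1 : ℝ) := by
        rw [Asymptotics.isLittleO_one_iff]
        simpa using (hc.tendsto (0 : E n)).sub_const (radAvg n h ‖(0 : E n)‖)
      have a2 : (fun y : E n => (inner ℝ y v : ℝ)) =O[𝓝 0] fun y : E n => ‖y‖ := by
        refine Asymptotics.IsBigO.of_bound ‖v‖ (Eventually.of_forall fun y => ?_)
        rw [norm_norm, mul_comm]
        exact norm_inner_le_norm y v
      have := a1.mul_isBigO a2
      simp only [one_mul] at this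
      exact this.of_norm_right
    rw [hasFDerivAt_iff_isLittleO]
    refine h1.congr (fun y => ?_) fun y => by simp
    simp [real_inner_comm]
    ring
  · have hn0 : ‖x‖ ≠ 0 := norm_ne_zero_iff.2 hx
    have h2 := (hasDerivAt_radAvg hn H.continuous_rhs hn0).comp_hasFDerivAt x (hasFDerivAt_norm_of_ne hx)
    refine (h2.mul (hlin x)).congr_fderiv ?_
    ext w
    simp
    field_simp

theorem fderiv_norm_apply (H : IsRadialSolution n f h) (v : E n) :
    (fun y : E n => fderiv ℝ (fun y : E n => f ‖y‖) y v)
      = fun y : E n => radAvg n h ‖y‖ * inner ℝ y v := by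
  funext y
  rw [(H.hasFDerivAt_norm y).fderiv]
  simp

theorem lap_norm (hn : 1 ≤ n) (H : IsRadialSolution n f h) (x : E n) :
    lap (fun y : E n => f ‖y‖) x = h ‖x‖ := by
  unfold lap
  simp_rw [H.fderiv_norm_apply, (H.hasFDerivAt_partial hn x _).fderiv]
  have e1 : ∀ i : Fin n, (inner ℝ x (basisVec i) : ℝ) = x i := fun i => by
    simp [basisVec, EuclideanSpace.inner_single_right]
  have e2 : ∀ i : Fin n, (inner ℝ (basisVec i) (basisVec i) : ℝ) = 1 := fun i => by
    simp [basisVec]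
  simp only [add_apply, smul_apply, innerSL_apply_apply,
    e1, e2, smul_eq_mul, mul_one, Finset.sum_add_distrib, mul_assoc, ← Finset.mul_sum,
    sum_sq_coord, Finset.sum_const, Finset.card_univ, Fintype.card_fin, nsmul_eq_mul]
  rcases eq_or_ne x 0 with rfl | hx
  · have : (n : ℝ) ≠ 0 := by positivity
    simp [radAvg_zero hn]
    field_simp
  · have hn0 : ‖x‖ ≠ 0 := norm_ne_zero_iff.2 hx
    field_simp
    ring

theorem contDiff_norm (hn : 1 ≤ n) (H : IsRadialSolution n f h) :
    ContDiff ℝ 2 (fun y : E n => f ‖y‖) := by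
  have hk := continuous_radAvg n H.continuous_rhs
  have hh := H.continuous_rhs
  rw [show (2 : WithTop ℕ∞) = 1 + 1 by norm_num, contDiff_succ_iff_fderiv_apply]
  refine ⟨fun x => (H.hasFDerivAt_norm x).differentiableAt, by simp, fun v => ?_⟩
  rw [H.fderiv_norm_apply, contDiff_one_iff_fderiv]
  refine ⟨fun x => (H.hasFDerivAt_partial hn x v).differentiableAt, ?_⟩
  have e : fderiv ℝ (fun y : E n => radAvg n h ‖y‖ * inner ℝ y v) = fun x =>
      radAvg n h ‖x‖ • innerSL ℝ v +
        ((h ‖x‖ - n * radAvg n h ‖x‖) / ‖x‖ ^ 2 * inner ℝ x v) • innerSL ℝ x := by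
    funext x
    exact (H.hasFDerivAt_partial hn x v).fderiv
  rw [e]
  refine Continuous.add ((hk.comp continuous_norm).smul continuous_const) ?_
  rw [continuous_iff_continuousAt]
  intro x
  rcases eq_or_ne x 0 with rfl | hx
  · -- the coefficient `h - n k` vanishes at the origin
    have h0 : (h ‖(0 : E n)‖ - n * radAvg n h ‖(0 : E n)‖) = 0 := by
      have : (n : ℝ) ≠ 0 := by positivity
      simp [radAvg_zero hn]
      field_simp
      ring
    have hlim : Tendsto (fun x : E n => |h ‖x‖ - n * radAvg n h ‖x‖| * ‖v‖) (𝓝 0) (𝓝 0) := by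
      have : Continuous (fun x : E n => |h ‖x‖ - n * radAvg n h ‖x‖| * ‖v‖) := by fun_prop
      have := this.tendsto 0
      rwa [h0, abs_zero, zero_mul] at this
    unfold ContinuousAt
    beta_reduce
    rw [h0, zero_div, zero_mul, zero_smul, tendsto_zero_iff_norm_tendsto_zero]
    refine squeeze_zero (fun _ => norm_nonneg _) (fun y => ?_) hlim
    rw [norm_smul, innerSL_apply_norm, norm_mul, norm_div, norm_pow, norm_norm, Real.norm_eq_abs]
    rcases eq_or_ne y 0 with rfl | hy
    · simp only [norm_zero, mul_zero]
      positivity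
    · have hy0 : 0 < ‖y‖ := norm_pos_iff.2 hy
      have := norm_inner_le_norm (𝕜 := ℝ) y v
      calc |h ‖y‖ - n * radAvg n h ‖y‖| / ‖y‖ ^ 2 * ‖(inner ℝ y v : ℝ)‖ * ‖y‖
          ≤ |h ‖y‖ - n * radAvg n h ‖y‖| / ‖y‖ ^ 2 * (‖y‖ * ‖v‖) * ‖y‖ := by gcongr
        _ = _ := by field_simp
  · have hn0 : ‖x‖ ^ 2 ≠ 0 := pow_ne_zero 2 (norm_ne_zero_iff.2 hx)
    have c1 : ContinuousAt (fun x : E n => h ‖x‖ - n * radAvg n h ‖x‖) x :=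
      Continuous.continuousAt (by fun_prop)
    have c2 : ContinuousAt (fun x : E n => ‖x‖ ^ 2) x := by fun_prop
    have c3 : ContinuousAt (fun x : E n => (inner ℝ x v : ℝ)) x :=
      Continuous.continuousAt (by fun_prop)
    exact ((c1.div c2 hn0).mul c3).smul (innerSL ℝ).continuous.continuousAt

end IsRadialSolution

end

/-! ### Approximation of test functions and scalar pairings -/

open scoped Convolution in
theorem fderiv_convolution_apply {n : ℕ} (φ : ContDiffBump (0 : E n)) {f : E n → ℝ}
    (hf : ContDiff ℝ 1 f) (hfc : HasCompactSupport f) (v : E n) :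
    (fun x => fderiv ℝ (φ.normed volume ⋆[ContinuousLinearMap.lsmul ℝ ℝ, volume] f) x v)
      = φ.normed volume ⋆[ContinuousLinearMap.lsmul ℝ ℝ, volume] fun x => fderiv ℝ f x v := by
  have hli : LocallyIntegrable (φ.normed volume) volume :=
    (φ.integrable_normed (μ := volume)).locallyIntegrable
  funext x
  rw [(hfc.hasFDerivAt_convolution_right (ContinuousLinearMap.lsmul ℝ ℝ) hli hf x).fderiv]
  exact convolution_precompR_apply (ContinuousLinearMap.lsmul ℝ ℝ) hli (hfc.fderiv ℝ)
    (hf.continuous_fderiv (by norm_num)) x v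

theorem hasCompactSupport_partial {n : ℕ} {f : E n → ℝ} (hfc : HasCompactSupport f) (v : E n) :
    HasCompactSupport (fun x => fderiv ℝ f x v) :=
  (hfc.fderiv ℝ).comp_left (g := fun L : E n →L[ℝ] ℝ => L v) rfl

theorem tsupport_fderiv_apply_subset {n : ℕ} (f : E n → ℝ) (v : E n) :
    tsupport (fun x => fderiv ℝ f x v) ⊆ tsupport f :=
  closure_minimal (fun x hx => support_fderiv_subset ℝ (fun h => hx (by
    change fderiv ℝ f x = 0 at h
    simp [h]))) isClosed_closure

theorem hasCompactSupport_lap {n : ℕ} {f : E n → ℝ} (hfc : HasCompactSupport f) :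
    HasCompactSupport (lap f) := by
  refine HasCompactSupport.intro hfc fun x hx => ?_
  unfold lap
  refine Finset.sum_eq_zero fun i _ => ?_
  have h1 : x ∉ tsupport (fun x => fderiv ℝ f x (basisVec i)) := fun h =>
    hx (tsupport_fderiv_apply_subset f _ h)
  rw [fderiv_of_notMem_tsupport ℝ h1]
  rfl

open scoped Convolution in
/-- A compactly supported `C²` function is approximated, together with its Laplacian, uniformly by
smooth functions supported in a fixed ball. -/
theorem exists_smooth_approx {n : ℕ} {f : E n → ℝ} (hf : ContDiff ℝ 2 f) {ρ : ℝ}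
    (hρ : tsupport f ⊆ Metric.closedBall 0 ρ) {δ : ℝ} (hδ : 0 < δ) :
    ∃ g : E n → ℝ, ContDiff ℝ (⊤ : ℕ∞) g ∧ tsupport g ⊆ Metric.closedBall 0 (ρ + 1) ∧
      (∀ x, |g x - f x| ≤ δ) ∧ ∀ x, |lap g x - lap f x| ≤ δ := by
  have hfc : HasCompactSupport f :=
    (isCompact_closedBall (0 : E n) ρ).of_isClosed_subset (isClosed_tsupport f) hρ
  have uc1 := hfc.uniformContinuous_of_continuous hf.continuous
  have uc2 := (hasCompactSupport_lap hfc).uniformContinuous_of_continuous (continuous_lap hf)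
  obtain ⟨d1, hd1, h1⟩ := Metric.uniformContinuous_iff.1 uc1 δ hδ
  obtain ⟨d2, hd2, h2⟩ := Metric.uniformContinuous_iff.1 uc2 δ hδ
  obtain ⟨d, hd, hdd⟩ : ∃ d : ℝ, 0 < d ∧ d ≤ 1 ∧ d ≤ d1 ∧ d ≤ d2 :=
    ⟨min 1 (min d1 d2), by positivity, min_le_left _ _,
      (min_le_right _ _).trans (min_le_left _ _), (min_le_right _ _).trans (min_le_right _ _)⟩
  let φ : ContDiffBump (0 : E n) := ⟨d / 2, d, by positivity, by linarith⟩
  have hli : LocallyIntegrable (φ.normed volume) volume :=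
    (φ.integrable_normed (μ := volume)).locallyIntegrable
  have hf1 : ContDiff ℝ 1 f := hf.of_le (by norm_num)
  refine ⟨φ.normed volume ⋆[ContinuousLinearMap.lsmul ℝ ℝ, volume] f, ?_, ?_, fun x => ?_,
    fun x => ?_⟩
  · exact φ.hasCompactSupport_normed.contDiff_convolution_left _ φ.contDiff_normed
      hf.continuous.locallyIntegrable
  · refine closure_minimal ?_ Metric.isClosed_closedBall
    refine (support_convolution_subset _).trans ?_
    rintro x ⟨y, hy, z, hz, rfl⟩
    rw [φ.support_normed_eq] at hy
    have hy' : ‖y‖ < d := by simpa [φ] using hy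
    have hz' : ‖z‖ ≤ ρ := by simpa using hρ (subset_tsupport f hz)
    rw [mem_closedBall_zero_iff]
    exact (norm_add_le y z).trans (by linarith)
  · rw [← Real.dist_eq]
    refine φ.dist_normed_convolution_le hf.continuous.aestronglyMeasurable fun y hy => ?_
    exact (h1 (lt_of_lt_of_le hy hdd.2.1)).le
  · have e : lap (φ.normed volume ⋆[ContinuousLinearMap.lsmul ℝ ℝ, volume] f)
        = φ.normed volume ⋆[ContinuousLinearMap.lsmul ℝ ℝ, volume] lap f := by
      funext x
      unfold lap
      have e1 : ∀ i : Fin n, (fun y => fderiv ℝ (fun y => fderiv ℝ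
          (φ.normed volume ⋆[ContinuousLinearMap.lsmul ℝ ℝ, volume] f) y (basisVec i)) y
            (basisVec i))
          = φ.normed volume ⋆[ContinuousLinearMap.lsmul ℝ ℝ, volume]
            fun y => fderiv ℝ (fun y => fderiv ℝ f y (basisVec i)) y (basisVec i) := by
        intro i
        rw [fderiv_convolution_apply φ hf1 hfc,
          fderiv_convolution_apply φ (contDiff_partial hf (by norm_num) _)
            (hasCompactSupport_partial hfc _)]
      simp_rw [fun i : Fin n => congrFun (e1 i) x]
      simp only [convolution_def, ContinuousLinearMap.lsmul_apply, smul_eq_mul, Finset.mul_sum]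
      rw [integral_finsetSum]
      intro i _
      have c2 : Continuous fun y => fderiv ℝ (fun y => fderiv ℝ f y (basisVec i)) y (basisVec i) :=
        ((contDiff_partial hf (k := 1) (by norm_num) (basisVec i)).continuous_fderiv
          (by norm_num)).clm_apply continuous_const
      have c3 := hasCompactSupport_partial (hasCompactSupport_partial hfc (basisVec i)) (basisVec i)
      have := c3.convolutionExists_right (ContinuousLinearMap.lsmul ℝ ℝ) hli c2 x
      simpa [ConvolutionExistsAt] using this
    rw [e, ← Real.dist_eq]
    refine φ.dist_normed_convolution_le (continuous_lap hf).aestronglyMeasurable fun y hy => ?_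
    exact (h2 (lt_of_lt_of_le hy hdd.2.2)).le

/-- Pairing with a compactly supported continuous function is an inner product in `L²`. -/
theorem exists_pairing {n : ℕ} {f : E n → ℝ} (hf : Continuous f) (hfc : HasCompactSupport f) :
    ∃ F : L2 n, ∀ g : L2 n, ∫ x, g x * f x = inner ℝ F g := by
  have hm : MemLp f 2 (volume : Measure (E n)) := hf.memLp_of_hasCompactSupport hfc
  refine ⟨hm.toLp f, fun g => ?_⟩
  rw [L2.inner_def]
  refine integral_congr_ae ?_
  filter_upwards [hm.coeFn_toLp] with x hx
  rw [hx]
  simp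

theorem integrable_mul_of_L2 {n : ℕ} (g : L2 n) {f : E n → ℝ} (hf : Continuous f)
    (hfc : HasCompactSupport f) : Integrable (fun x => g x * f x) := by
  have h1 : LocallyIntegrable (g : E n → ℝ) volume :=
    (Lp.memLp g).locallyIntegrable (by norm_num)
  simpa using h1.integrable_smul_right_of_hasCompactSupport hf hfc

/-- The distributional gradient of `u` tested with a gradient: one more integration by parts moves
both derivatives to the test function. -/
theorem integral_inner_gradient {n : ℕ} {u : L2 n} {G : L2Vec n} (h : IsWeakGradient u G)
    {f : E n → ℝ} (hf : ContDiff ℝ (⊤ : ℕ∞) f) (hfc : HasCompactSupport f) :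
    ∫ x, inner ℝ (G x) (gradient f x) = - ∫ x, u x * lap f x := by
  have hle : ∀ k : ℕ, (k : WithTop ℕ∞) + 1 ≤ ((⊤ : ℕ∞) : WithTop ℕ∞) := fun k => by
    exact_mod_cast le_top
  have hp : ∀ i : Fin n, ContDiff ℝ (⊤ : ℕ∞) (fun x => fderiv ℝ f x (basisVec i)) := fun i =>
    contDiff_partial hf (by simp) _
  have hpc : ∀ i : Fin n, HasCompactSupport (fun x => fderiv ℝ f x (basisVec i)) := fun i =>
    hasCompactSupport_partial hfc _
  have hG : LocallyIntegrable (G : E n → E n) volume :=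
    (Lp.memLp G).locallyIntegrable (by norm_num)
  have hu : LocallyIntegrable (u : E n → ℝ) volume :=
    (Lp.memLp u).locallyIntegrable (by norm_num)
  have hgr : ∀ (φ : E n → ℝ) (x v : E n), inner ℝ (gradient φ x) v = fderiv ℝ φ x v := fun φ x v =>
    inner_gradient_left (𝕜 := ℝ)
  have hinner : ∀ (x : E n) (i : Fin n), (inner ℝ x (basisVec i) : ℝ) = x i := fun x i => by
    simp [basisVec, EuclideanSpace.inner_single_right]
  have hcoord : ∀ (φ : E n → ℝ) (x : E n) (i : Fin n),
      gradient φ x i = fderiv ℝ φ x (basisVec i) := fun φ x i => by rw [← hinner, hgr]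
  have hi1 : ∀ i : Fin n, Integrable fun x => fderiv ℝ f x (basisVec i) • G x := fun i =>
    hG.integrable_smul_left_of_hasCompactSupport (hp i).continuous (hpc i)
  have hi2 : ∀ i : Fin n, Integrable fun x => fderiv ℝ f x (basisVec i) * G x i := fun i => by
    have := (EuclideanSpace.proj (𝕜 := ℝ) i).integrable_comp (hi1 i)
    simpa using this
  have hcg : ∀ i : Fin n, Continuous (gradient fun x => fderiv ℝ f x (basisVec i)) := fun i =>
    (LinearIsometryEquiv.continuous _).comp ((hp i).continuous_fderiv (by simp))
  have hsg : ∀ i : Fin n, HasCompactSupport (gradient fun x => fderiv ℝ f x (basisVec i)) := fun i =>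
    ((hpc i).fderiv ℝ).comp_left (map_zero _)
  have hi3 : ∀ i : Fin n, Integrable fun x =>
      u x • gradient (fun x => fderiv ℝ f x (basisVec i)) x := fun i =>
    hu.integrable_smul_right_of_hasCompactSupport (hcg i) (hsg i)
  have hi4 : ∀ i : Fin n, Integrable fun x =>
      u x * fderiv ℝ (fun x => fderiv ℝ f x (basisVec i)) x (basisVec i) := fun i => by
    have := (EuclideanSpace.proj (𝕜 := ℝ) i).integrable_comp (hi3 i)
    simpa [hcoord] using this
  have key : ∀ i : Fin n, ∫ x, fderiv ℝ f x (basisVec i) * G x i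
      = - ∫ x, u x * fderiv ℝ (fun x => fderiv ℝ f x (basisVec i)) x (basisVec i) := by
    intro i
    have h1 := congrArg (EuclideanSpace.proj (𝕜 := ℝ) i) (h _ (hp i) (hpc i))
    rw [map_neg, ← ContinuousLinearMap.integral_comp_comm _ (hi3 i),
      ← ContinuousLinearMap.integral_comp_comm _ (hi1 i)] at h1
    simp only [PiLp.proj_apply, PiLp.smul_apply, smul_eq_mul, hcoord] at h1
    linarith
  have e1 : ∀ x, (inner ℝ (G x) (gradient f x) : ℝ)
      = ∑ i, fderiv ℝ f x (basisVec i) * G x i := fun x => by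
    rw [PiLp.inner_apply]
    refine Finset.sum_congr rfl fun i _ => ?_
    rw [hcoord]
    simp
  simp_rw [e1, lap, Finset.mul_sum]
  rw [integral_finsetSum _ fun i _ => hi2 i, integral_finsetSum _ fun i _ => hi4 i,
    ← Finset.sum_neg_distrib]
  exact Finset.sum_congr rfl fun i _ => key i

/-- By Fatou's lemma, powers are lower semicontinuous on `L²`. So `t ↦ ∫ |v(t,x)|^r m(x) dx` is
measurable for a continuous curve `v` in `L²`, although no joint measurability in `(t, x)` is
available: the elements of `L²` are classes of functions. -/
theorem lowerSemicontinuous_lintegral_rpow {n : ℕ} (r : ℝ) {m : E n → ℝ≥0∞}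
    (hm : Measurable m) :
    LowerSemicontinuous fun g : L2 n => ∫⁻ x, ‖g x‖ₑ ^ r * m x := by
  rw [lowerSemicontinuous_iff_isClosed_preimage]
  intro c
  refine IsSeqClosed.isClosed fun g g₀ hg hlim => ?_
  obtain ⟨ns, -, hns⟩ := (tendstoInMeasure_of_tendsto_Lp hlim).exists_seq_tendsto_ae
  have h1 : ∫⁻ x, ‖g₀ x‖ₑ ^ r * m x
      ≤ ∫⁻ x, liminf (fun i => ‖g (ns i) x‖ₑ ^ r * m x) atTop := by
    refine lintegral_mono_ae ?_
    filter_upwards [hns] with x hx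
    have h2 : Tendsto (fun i => ‖g (ns i) x‖ₑ ^ r) atTop (𝓝 (‖g₀ x‖ₑ ^ r)) :=
      (ENNReal.continuous_rpow_const.tendsto _).comp hx.enorm
    by_cases h0 : ‖g₀ x‖ₑ ^ r = 0
    · simp [h0]
    · by_cases h3 : m x = ∞
      · have : Tendsto (fun i => ‖g (ns i) x‖ₑ ^ r * m x) atTop (𝓝 (‖g₀ x‖ₑ ^ r * m x)) :=
          ENNReal.Tendsto.mul_const h2 (Or.inl h0)
        exact this.liminf_eq.ge
      · have : Tendsto (fun i => ‖g (ns i) x‖ₑ ^ r * m x) atTop (𝓝 (‖g₀ x‖ₑ ^ r * m x)) :=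
          ENNReal.Tendsto.mul_const h2 (Or.inr h3)
        exact this.liminf_eq.ge
  refine h1.trans ((lintegral_liminf_le' fun i => ?_).trans ?_)
  · exact ((Lp.aestronglyMeasurable (g (ns i))).enorm.pow_const r).mul hm.aemeasurable
  · exact liminf_le_of_le (by isBoundedDefault) fun b hb => by
      obtain ⟨i, hi⟩ := hb.exists
      exact hi.trans (hg (ns i))

theorem measurableSet_timeInterval (T : ℝ≥0∞) : MeasurableSet (timeInterval T) :=
  (measurableSet_le measurable_const measurable_id).inter
    (measurableSet_lt ENNReal.measurable_ofReal measurable_const)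

theorem aemeasurable_lintegral_rpow {n : ℕ} {T : ℝ≥0∞} {v : ℝ → L2 n}
    (hv : ContinuousOn v (timeInterval T)) (r : ℝ) {m : E n → ℝ≥0∞}
    (hm : Measurable m) :
    AEMeasurable (fun t => ∫⁻ x, ‖v t x‖ₑ ^ r * m x) (volume.restrict (timeInterval T)) := by
  borelize (L2 n)
  exact (lowerSemicontinuous_lintegral_rpow r hm).measurable.comp_aemeasurable
    (hv.aemeasurable (measurableSet_timeInterval T))

section

/-! ### The weak formulation for separated test functions -/

theorem Icc_subset_timeInterval {T : ℝ≥0∞} {S : ℝ} (hS : ENNReal.ofReal S < T) :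
    Icc 0 S ⊆ timeInterval T := fun _ ht => ⟨ht.1, (ENNReal.ofReal_le_ofReal ht.2).trans_lt hS⟩

theorem setIntegral_timeInterval {T : ℝ≥0∞} {S : ℝ} (hS0 : 0 ≤ S) (hS : ENNReal.ofReal S < T)
    {F : ℝ → ℝ} (hF : ∀ t, S ≤ t → F t = 0) :
    ∫ t in timeInterval T, F t = ∫ t in (0 : ℝ)..S, F t := by
  rw [intervalIntegral.integral_of_le hS0, ← integral_Icc_eq_integral_Ioc]
  refine (setIntegral_eq_of_subset_of_forall_sdiff_eq_zero (measurableSet_timeInterval T)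
    (Icc_subset_timeInterval hS) fun t ht => hF t ?_)
  by_contra h
  exact ht.2 ⟨ht.1.1, (not_le.1 h).le⟩

theorem deriv_eq_zero_of_eqOn_Ici {θ θ₁ : ℝ → ℝ} {S : ℝ} (h : ∀ t, HasDerivAt θ (θ₁ t) t)
    (h0 : ∀ t, S ≤ t → θ t = 0) (t : ℝ) (ht : S ≤ t) : θ₁ t = 0 := by
  have h1 : HasDerivWithinAt θ 0 (Ici S) t :=
    (hasDerivWithinAt_const t (Ici S) (0 : ℝ)).congr (fun s hs => h0 s hs) (h0 t ht)
  exact (uniqueDiffOn_Ici S t ht).eq_deriv _ (h t).hasDerivWithinAt h1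

/-- A smooth cutoff equal to `1` for `t ≥ -1/2` and to `0` for `t ≤ -1`. -/
noncomputable def pastCutoff (t : ℝ) : ℝ := Real.smoothTransition (2 * t + 2)

theorem pastCutoff_eq_one {t : ℝ} (ht : -(1 / 2) ≤ t) : pastCutoff t = 1 :=
  Real.smoothTransition.one_of_one_le (by linarith)

theorem pastCutoff_eq_zero {t : ℝ} (ht : t ≤ -1) : pastCutoff t = 0 :=
  Real.smoothTransition.zero_of_nonpos (by linarith)

theorem contDiff_pastCutoff : ContDiff ℝ (⊤ : ℕ∞) pastCutoff :=
  Real.smoothTransition.contDiff.comp (by fun_prop)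

theorem isTestFunction_mul {n : ℕ} {T : ℝ≥0∞} {θ : ℝ → ℝ} (hθ : ContDiff ℝ (⊤ : ℕ∞) θ) {S : ℝ}
    (hS : ENNReal.ofReal S < T) (hθS : ∀ t, S ≤ t → θ t = 0) {f : E n → ℝ}
    (hf : ContDiff ℝ (⊤ : ℕ∞) f) (hfc : HasCompactSupport f) :
    IsTestFunction T fun t x => pastCutoff t * θ t * f x := by
  have hsub : tsupport (fun z : ℝ × E n => pastCutoff z.1 * θ z.1 * f z.2)
      ⊆ Icc (-1) S ×ˢ tsupport f := by
    refine closure_minimal (fun z hz => ?_) (isClosed_Icc.prod (isClosed_tsupport f))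
    have hz' : pastCutoff z.1 * θ z.1 * f z.2 ≠ 0 := hz
    refine ⟨⟨?_, ?_⟩, subset_tsupport f (right_ne_zero_of_mul hz')⟩
    · by_contra h
      exact hz' (by simp [pastCutoff_eq_zero (not_le.1 h).le])
    · by_contra h
      exact hz' (by simp [hθS _ (not_le.1 h).le])
  refine ⟨?_, ?_, fun z hz => ?_⟩
  · exact ((contDiff_pastCutoff.comp contDiff_fst).mul (hθ.comp contDiff_fst)).mul
      (hf.comp contDiff_snd)
  · exact (isCompact_Icc.prod hfc).of_isClosed_subset (isClosed_tsupport _) hsub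
  · exact (ENNReal.ofReal_le_ofReal (hsub hz).1.2).trans_lt hS

variable {n : ℕ} {T : ℝ≥0∞} {D V : E n → ℝ} {p ε : ℝ} {f₀ g₀ : E n → ℝ} {u ut : ℝ → L2 n}
  {gu : ℝ → L2Vec n} {w : ℝ → L2 n}

theorem IsEnergyClass.continuousOn_pairing (hE : IsEnergyClass T u ut gu) {f : E n → ℝ}
    (hf : Continuous f) (hfc : HasCompactSupport f) :
    ContinuousOn (fun t => ∫ x, u t x * f x) (timeInterval T) := by
  obtain ⟨F, hF⟩ := exists_pairing hf hfc
  simp_rw [hF]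
  exact continuousOn_const.inner hE.continuousOn

/-- Integration by parts in time, for the curve `u` paired with a fixed function of `x`. There is no
boundary term at `S`, where `θ` vanishes. -/
theorem IsEnergyClass.integral_by_parts (hE : IsEnergyClass T u ut gu) {f : E n → ℝ}
    (hf : Continuous f) (hfc : HasCompactSupport f) {θ θ₁ : ℝ → ℝ}
    (hθ : ∀ t, HasDerivAt θ (θ₁ t) t) (hθc : Continuous θ₁) {S : ℝ} (hS0 : 0 ≤ S)
    (hS : ENNReal.ofReal S < T) (hθS : θ S = 0) :
    ∫ t in (0 : ℝ)..S, θ t * ∫ x, ut t x * f x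
      = - (θ 0 * ∫ x, u 0 x * f x) - ∫ t in (0 : ℝ)..S, θ₁ t * ∫ x, u t x * f x := by
  obtain ⟨F, hF⟩ := exists_pairing hf hfc
  simp_rw [hF]
  have hsub := Icc_subset_timeInterval hS
  have c1 : ContinuousOn (fun t => inner ℝ F (u t)) (Icc 0 S) :=
    (continuousOn_const.inner hE.continuousOn).mono hsub
  have c2 : ContinuousOn (fun t => inner ℝ F (ut t)) (Icc 0 S) :=
    (continuousOn_const.inner hE.continuousOn_deriv).mono hsub
  have hθ0 : Continuous θ := continuous_iff_continuousAt.2 fun t => (hθ t).continuousAt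
  have i1 : IntervalIntegrable (fun t => θ t * inner ℝ F (ut t)) volume 0 S :=
    (ContinuousOn.intervalIntegrable (by
      rw [uIcc_of_le hS0]; exact hθ0.continuousOn.mul c2))
  have i2 : IntervalIntegrable (fun t => θ₁ t * inner ℝ F (u t)) volume 0 S :=
    (ContinuousOn.intervalIntegrable (by
      rw [uIcc_of_le hS0]; exact hθc.continuousOn.mul c1))
  have key := intervalIntegral.integral_eq_sub_of_hasDerivAt_of_le hS0
    (f := fun t => θ t * inner ℝ F (u t))
    (f' := fun t => θ₁ t * inner ℝ F (u t) + θ t * inner ℝ F (ut t))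
    (hθ0.continuousOn.mul c1) (fun t ht => ?_) (i2.add i1)
  · rw [intervalIntegral.integral_add i2 i1] at key
    simp only [hθS, zero_mul] at key
    linarith
  · have h1 : HasDerivAt u (ut t) t :=
      (hE.hasDeriv t (hsub ⟨ht.1.le, ht.2.le⟩)).hasDerivAt
        (mem_of_superset (Icc_mem_nhds ht.1 ht.2) hsub)
    have h2 : HasDerivAt (fun t => inner ℝ F (u t)) (inner ℝ F (ut t)) t :=
      (innerSL ℝ F).hasFDerivAt.comp_hasDerivAt t h1
    exact (hθ t).mul h2

/-- The weak equation tested with `θ(t) f(x)`, with all derivatives moved to the test function. -/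
theorem WeakEquation.smooth_separated (hW : WeakEquation T D V p ε f₀ g₀ u ut gu w)
    (hE : IsEnergyClass T u ut gu) (hA : AttainsData ε f₀ g₀ u ut) (hD : Continuous D)
    (hV : Continuous V) {θ θ₁ θ₂ : ℝ → ℝ} (hθ : ContDiff ℝ (⊤ : ℕ∞) θ)
    (hθ₁ : ∀ t, HasDerivAt θ (θ₁ t) t) (hθ₂ : ∀ t, HasDerivAt θ₁ (θ₂ t) t) (hθ₂c : Continuous θ₂)
    {S : ℝ} (hS0 : 0 ≤ S) (hS : ENNReal.ofReal S < T) (hθS : ∀ t, S ≤ t → θ t = 0) {f : E n → ℝ}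
    (hf : ContDiff ℝ (⊤ : ℕ∞) f) (hfc : HasCompactSupport f) :
    ε * θ 0 * (∫ x, g₀ x * f x) + ε * θ 0 * (∫ x, f₀ x * (D x * f x))
        - ε * θ₁ 0 * (∫ x, f₀ x * f x) + (∫ t in (0 : ℝ)..S, θ t * ∫ x, |w t x| ^ p * f x)
      = (∫ t in (0 : ℝ)..S, θ₂ t * ∫ x, u t x * f x)
        - (∫ t in (0 : ℝ)..S, θ₁ t * ∫ x, u t x * (D x * f x))
        + (∫ t in (0 : ℝ)..S, θ t * ∫ x, u t x * (V x * f x - lap f x)) := by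
  have hf2 : ContDiff ℝ 2 f := by exact_mod_cast contDiff_infty.1 hf 2
  have hθ₁S := deriv_eq_zero_of_eqOn_Ici hθ₁ hθS
  have hθ₁c : Continuous θ₁ := continuous_iff_continuousAt.2 fun t => (hθ₂ t).continuousAt
  have hsub := Icc_subset_timeInterval hS
  have hfT : ∀ t ∈ Icc 0 S, pastCutoff t = 1 := fun t ht => pastCutoff_eq_one (by linarith [ht.1])
  have hder : ∀ t ∈ Icc 0 S, ∀ x : E n,
      deriv (fun s => pastCutoff s * θ s * f x) t = θ₁ t * f x := by
    intro t ht x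
    have h1 : (fun s => pastCutoff s * θ s * f x) =ᶠ[𝓝 t] fun s => θ s * f x := by
      filter_upwards [Ioi_mem_nhds (show -(1 / 2) < t by linarith [ht.1])] with s hs
      rw [pastCutoff_eq_one (le_of_lt hs), one_mul]
    rw [h1.deriv_eq]
    exact ((hθ₁ t).mul_const (f x)).deriv
  have hder0 : ∀ t, S ≤ t → ∀ x : E n, deriv (fun s => pastCutoff s * θ s * f x) t = 0 :=
    fun t ht x => by
      have h1 : HasDerivAt pastCutoff (deriv pastCutoff t) t :=
        (contDiff_pastCutoff.differentiable (by simp) t).hasDerivAt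
      have h2 : HasDerivAt (fun s => pastCutoff s * θ s * f x)
          ((deriv pastCutoff t * θ t + pastCutoff t * θ₁ t) * f x) t :=
        (h1.mul (hθ₁ t)).mul_const (f x)
      rw [h2.deriv, hθS t ht, hθ₁S t ht]
      simp
  have hgrad : ∀ t ∈ Icc 0 S, ∀ x : E n,
      gradient (fun x => pastCutoff t * θ t * f x) x = θ t • gradient f x := by
    intro t ht x
    rw [hfT t ht, one_mul]
    unfold gradient
    rw [fderiv_const_mul (hf2.differentiable (by norm_num) x), map_smul]
  have hw := hW _ (isTestFunction_mul hθ hS hθS hf hfc)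
  have hfD : HasCompactSupport fun x => D x * f x := hfc.mul_left
  have hDf : Continuous fun x => D x * f x := hD.mul hf2.continuous
  have hpc0 : pastCutoff 0 = 1 := pastCutoff_eq_one (by norm_num)
  have e : ∀ F G : ℝ → ℝ, (∀ t, S ≤ t → F t = 0) → (∀ t ∈ Icc 0 S, F t = G t) →
      ∫ t in timeInterval T, F t = ∫ t in (0 : ℝ)..S, G t := by
    intro F G h1 h2
    rw [setIntegral_timeInterval hS0 hS h1]
    exact intervalIntegral.integral_congr fun t ht => h2 t (by rwa [uIcc_of_le hS0] at ht)
  rw [e _ (fun t => θ t * ∫ x, |w t x| ^ p * f x) (fun t ht => by simp [hθS t ht])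
      (fun t ht => by
        rw [← integral_const_mul, hfT t ht]
        exact integral_congr_ae (ae_of_all _ fun x => by ring)),
    e _ (fun t => θ₁ t * ∫ x, ut t x * f x) (fun t ht => by simp [hder0 t ht])
      (fun t ht => by
        rw [← integral_const_mul]
        exact integral_congr_ae (ae_of_all _ fun x => by simp only [hder t ht]; ring)),
    e _ (fun t => θ t * ∫ x, inner ℝ (gu t x) (gradient f x)) (fun t ht => by
        have : gradient (fun x : E n => pastCutoff t * θ t * f x) = fun _ => 0 := by
          funext x
          simp [hθS t ht, gradient_fun_const]
        simp [this])
      (fun t ht => by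
        rw [← integral_const_mul]
        exact integral_congr_ae (ae_of_all _ fun x => by
          simp only [hgrad t ht, inner_smul_right])),
    e _ (fun t => θ₁ t * ∫ x, u t x * (D x * f x)) (fun t ht => by simp [hder0 t ht])
      (fun t ht => by
        rw [← integral_const_mul]
        exact integral_congr_ae (ae_of_all _ fun x => by simp only [hder t ht]; ring)),
    e _ (fun t => θ t * ∫ x, u t x * (V x * f x)) (fun t ht => by simp [hθS t ht])
      (fun t ht => by
        rw [← integral_const_mul, hfT t ht]
        exact integral_congr_ae (ae_of_all _ fun x => by ring)),
    hE.integral_by_parts hf2.continuous hfc hθ₂ hθ₂c hS0 hS (hθ₁S S le_rfl)] at hw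
  have h0 : ∫ x, u 0 x * f x = ε * ∫ x, f₀ x * f x := by
    rw [← integral_const_mul]
    refine integral_congr_ae ?_
    filter_upwards [hA.1] with x hx
    rw [hx]; ring
  have hgr : ∫ t in (0 : ℝ)..S, θ t * ∫ x, inner ℝ (gu t x) (gradient f x)
      = ∫ t in (0 : ℝ)..S, θ t * (-∫ x, u t x * lap f x) := by
    refine intervalIntegral.integral_congr fun t ht => ?_
    rw [uIcc_of_le hS0] at ht
    simp only [integral_inner_gradient (hE.weakGradient t (hsub ht)) hf hfc]
  have hlc := continuous_lap hf2
  have hls := hasCompactSupport_lap hfc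
  have hfV : HasCompactSupport fun x => V x * f x := hfc.mul_left
  have hVf : Continuous fun x => V x * f x := hV.mul hf2.continuous
  have hθ0 : Continuous θ := hθ.continuous
  have hii : ∀ {h : E n → ℝ}, Continuous h → HasCompactSupport h →
      IntervalIntegrable (fun t => θ t * ∫ x, u t x * h x) volume 0 S := fun hc hs =>
    ContinuousOn.intervalIntegrable (by
      rw [uIcc_of_le hS0]
      exact hθ0.continuousOn.mul ((hE.continuousOn_pairing hc hs).mono hsub))
  have hlast : ∫ t in (0 : ℝ)..S, θ t * ∫ x, u t x * (V x * f x - lap f x)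
      = (∫ t in (0 : ℝ)..S, θ t * ∫ x, u t x * (V x * f x))
        + ∫ t in (0 : ℝ)..S, θ t * (-∫ x, u t x * lap f x) := by
    simp only [mul_neg, intervalIntegral.integral_neg, ← sub_eq_add_neg]
    rw [← intervalIntegral.integral_sub (hii hVf hfV) (hii hlc hls)]
    refine intervalIntegral.integral_congr fun t _ => ?_
    simp only [mul_sub]
    rw [integral_sub (integrable_mul_of_L2 _ hVf hfV) (integrable_mul_of_L2 _ hlc hls)]
    ring
  have hd1 : ∫ x, g₀ x * (pastCutoff 0 * θ 0 * f x) = θ 0 * ∫ x, g₀ x * f x := by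
    rw [← integral_const_mul, hpc0]
    exact integral_congr_ae (ae_of_all _ fun x => by ring)
  have hd2 : ∫ x, f₀ x * D x * (pastCutoff 0 * θ 0 * f x)
      = θ 0 * ∫ x, f₀ x * (D x * f x) := by
    rw [← integral_const_mul, hpc0]
    exact integral_congr_ae (ae_of_all _ fun x => by ring)
  rw [hd1, hd2, h0, hgr] at hw
  rw [hlast]
  linarith

end

section

/-! ### Passage to the limit in the test function -/

theorem tsupport_subset_of_eq_zero {n : ℕ} {f : E n → ℝ} {ρ : ℝ}
    (h : ∀ x, ρ < ‖x‖ → f x = 0) : tsupport f ⊆ Metric.closedBall 0 ρ :=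
  closure_minimal (fun x hx => by
    rw [mem_closedBall_zero_iff]
    by_contra hc
    exact hx (h x (not_le.1 hc))) Metric.isClosed_closedBall

theorem eq_zero_of_tsupport_subset {n : ℕ} {f : E n → ℝ} {ρ : ℝ}
    (h : tsupport f ⊆ Metric.closedBall 0 ρ) {x : E n} (hx : ρ < ‖x‖) : f x = 0 := by
  by_contra hc
  have := h (subset_tsupport f hc)
  rw [mem_closedBall_zero_iff] at this
  linarith

/-- Bounded pointwise convergence of functions supported in a fixed ball may be integrated against
a locally integrable function. -/
theorem tendsto_integral_mul {n : ℕ} {G : E n → ℝ} (hG : LocallyIntegrable G) {ρ M : ℝ}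
    {h : ℕ → E n → ℝ} {h₀ : E n → ℝ} (hc : ∀ k, Continuous (h k))
    (hs : ∀ k x, ρ < ‖x‖ → h k x = 0) (hM : ∀ k x, |h k x| ≤ M)
    (hlim : ∀ x, Tendsto (fun k => h k x) atTop (𝓝 (h₀ x))) :
    Tendsto (fun k => ∫ x, G x * h k x) atTop (𝓝 (∫ x, G x * h₀ x)) := by
  have hi : IntegrableOn (fun x => |G x| * M) (Metric.closedBall 0 ρ) volume :=
    (hG.integrableOn_isCompact (isCompact_closedBall (0 : E n) ρ)).abs.mul_const M
  refine tendsto_integral_of_dominated_convergence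
    ((Metric.closedBall (0 : E n) ρ).indicator fun x => |G x| * M)
    (fun k => hG.aestronglyMeasurable.mul (hc k).aestronglyMeasurable)
    (hi.integrable_indicator Metric.isClosed_closedBall.measurableSet)
    (fun k => ae_of_all _ fun x => ?_) (ae_of_all _ fun x => (hlim x).const_mul (G x))
  by_cases hx : x ∈ Metric.closedBall (0 : E n) ρ
  · rw [indicator_of_mem hx, Real.norm_eq_abs, abs_mul]
    exact mul_le_mul_of_nonneg_left (hM k x) (abs_nonneg _)
  · rw [indicator_of_notMem hx, hs k x (by simpa using hx)]
    simp

/-- Pairings with functions bounded by `M` and supported in a fixed ball are bounded on `L²` by a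
common constant; this is the domination in `t` for limits of test functions. -/
theorem exists_abs_integral_mul_le {n : ℕ} (ρ M : ℝ) :
    ∃ C : ℝ, ∀ (u : L2 n) (h : E n → ℝ), Continuous h → (∀ x, ρ < ‖x‖ → h x = 0) →
      (∀ x, |h x| ≤ M) → |∫ x, u x * h x| ≤ C * ‖u‖ := by
  have hfin : volume (Metric.closedBall (0 : E n) ρ) ≠ ∞ :=
    (isCompact_closedBall (0 : E n) ρ).measure_lt_top.ne
  let χ : L2 n := indicatorConstLp 2 Metric.isClosed_closedBall.measurableSet hfin M
  refine ⟨‖χ‖, fun u h hc hs hM => ?_⟩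
  have hcs : HasCompactSupport h := (isCompact_closedBall (0 : E n) ρ).of_isClosed_subset
    (isClosed_tsupport h) (tsupport_subset_of_eq_zero hs)
  have hm : MemLp h 2 (volume : Measure (E n)) := hc.memLp_of_hasCompactSupport hcs
  have e : ∫ x, u x * h x = inner ℝ (hm.toLp h) u := by
    rw [L2.inner_def]
    refine integral_congr_ae ?_
    filter_upwards [hm.coeFn_toLp] with x hx
    rw [hx]
    simp
  have hle : ‖hm.toLp h‖ ≤ ‖χ‖ := by
    refine Lp.norm_le_norm_of_ae_le ?_
    filter_upwards [hm.coeFn_toLp, indicatorConstLp_coeFn (p := 2)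
      (hs := Metric.isClosed_closedBall.measurableSet) (hμs := hfin) (c := M)] with x hx hx'
    rw [hx, hx']
    by_cases hxb : x ∈ Metric.closedBall (0 : E n) ρ
    · rw [indicator_of_mem hxb]
      exact (hM x).trans (le_abs_self M)
    · rw [hs x (by simpa using hxb)]
      simp
  rw [e]
  exact (abs_real_inner_le_norm _ _).trans (mul_le_mul_of_nonneg_right hle (norm_nonneg _))

variable {n : ℕ} {T : ℝ≥0∞} {D V : E n → ℝ} {p ε : ℝ} {f₀ g₀ : E n → ℝ} {u ut : ℝ → L2 n}
  {gu : ℝ → L2Vec n} {w : ℝ → L2 n}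

theorem IsEnergyClass.tendsto_pairing (hE : IsEnergyClass T u ut gu) {θ : ℝ → ℝ}
    (hθ : Continuous θ) {S : ℝ} (hS0 : 0 ≤ S) (hS : ENNReal.ofReal S < T) {ρ M : ℝ}
    {h : ℕ → E n → ℝ} {h₀ : E n → ℝ} (hc : ∀ k, Continuous (h k))
    (hs : ∀ k x, ρ < ‖x‖ → h k x = 0) (hM : ∀ k x, |h k x| ≤ M)
    (hlim : ∀ x, Tendsto (fun k => h k x) atTop (𝓝 (h₀ x))) :
    Tendsto (fun k => ∫ t in (0 : ℝ)..S, θ t * ∫ x, u t x * h k x) atTop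
      (𝓝 (∫ t in (0 : ℝ)..S, θ t * ∫ x, u t x * h₀ x)) := by
  have hsub := Icc_subset_timeInterval hS
  obtain ⟨C, hC⟩ := exists_abs_integral_mul_le (n := n) ρ M
  have hbd : ContinuousOn (fun t => |θ t| * (C * ‖u t‖)) (Icc 0 S) :=
    hθ.abs.continuousOn.mul (continuousOn_const.mul (hE.continuousOn.mono hsub).norm)
  have hcs : ∀ k, HasCompactSupport (h k) := fun k =>
    (isCompact_closedBall (0 : E n) ρ).of_isClosed_subset
      (isClosed_tsupport _) (tsupport_subset_of_eq_zero (hs k))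
  refine intervalIntegral.tendsto_integral_filter_of_dominated_convergence
    (fun t => |θ t| * (C * ‖u t‖)) (Eventually.of_forall fun k => ?_)
    (Eventually.of_forall fun k => ae_of_all _ fun t _ => ?_)
    (ContinuousOn.intervalIntegrable (by rwa [uIcc_of_le hS0])) (ae_of_all _ fun t _ => ?_)
  · rw [uIoc_of_le hS0]
    refine ContinuousOn.aestronglyMeasurable ?_ measurableSet_Ioc
    exact (hθ.continuousOn.mul ((hE.continuousOn_pairing (hc k) (hcs k)).mono hsub)).mono
      Ioc_subset_Icc_self
  · rw [Real.norm_eq_abs, abs_mul]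
    exact mul_le_mul_of_nonneg_left (hC _ _ (hc k) (hs k) (hM k)) (abs_nonneg _)
  · exact (tendsto_integral_mul ((Lp.memLp (u t)).locallyIntegrable (by norm_num)) hc hs hM
      hlim).const_mul _

theorem enorm_rpow_eq {a r : ℝ} (hr : 0 ≤ r) : ‖a‖ₑ ^ r = ENNReal.ofReal (|a| ^ r) := by
  rw [← ENNReal.ofReal_rpow_of_nonneg (abs_nonneg a) hr, ← Real.norm_eq_abs, ofReal_norm]

theorem aestronglyMeasurable_abs_rpow (v : L2 n) (r : ℝ) :
    AEStronglyMeasurable (fun x => |v x| ^ r) volume :=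
  ((Lp.aestronglyMeasurable v).norm.aemeasurable.pow_const r).aestronglyMeasurable

theorem aemeasurable_setLIntegral_rpow (hw : ContinuousOn w (timeInterval T)) (r ρ : ℝ) :
    AEMeasurable (fun t => ∫⁻ x in Metric.closedBall (0 : E n) ρ, ‖w t x‖ₑ ^ r)
      (volume.restrict (timeInterval T)) := by
  have := aemeasurable_lintegral_rpow hw r (m := (Metric.closedBall (0 : E n) ρ).indicator 1)
    (measurable_one.indicator Metric.isClosed_closedBall.measurableSet)
  refine this.congr (ae_of_all _ fun t => ?_)
  beta_reduce
  rw [← lintegral_indicator Metric.isClosed_closedBall.measurableSet]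
  refine lintegral_congr fun x => ?_
  by_cases hx : x ∈ Metric.closedBall (0 : E n) ρ <;> simp [hx]

/-- Almost every time slice of a function in `L^r_loc` is locally `r`-integrable. -/
theorem ae_integrable_rpow {r : ℝ} (hr : 0 < r) {S : ℝ} (hw : ContinuousOn w (timeInterval T))
    (hL : IsLocLp T r w) (hS : ENNReal.ofReal S < T) (hS0 : 0 ≤ S) (ρ : ℝ) :
    ∀ᵐ t ∂(volume.restrict (Ioc 0 S)),
      IntegrableOn (fun x => |w t x| ^ r) (Metric.closedBall 0 ρ) := by
  have hsub : Ioo 0 S ⊆ timeInterval T :=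
    Ioo_subset_Icc_self.trans (Icc_subset_timeInterval hS)
  have h1 := hL S (Icc_subset_timeInterval hS ⟨hS0, le_rfl⟩) _ (isCompact_closedBall (0 : E n) ρ)
  have hm : AEMeasurable (fun t => ∫⁻ x in Metric.closedBall (0 : E n) ρ, ‖w t x‖ₑ ^ r)
      (volume.restrict (Ioo 0 S)) := 
    (aemeasurable_setLIntegral_rpow hw r ρ).mono_measure (Measure.restrict_mono hsub le_rfl)
  rw [restrict_Ioo_eq_restrict_Ioc] at h1 hm
  filter_upwards [ae_lt_top' hm h1.ne] with t ht
  refine ⟨(aestronglyMeasurable_abs_rpow (w t) r).restrict, ?_⟩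
  refine lt_of_le_of_lt (le_of_eq ?_) ht
  refine lintegral_congr fun x => ?_
  rw [enorm_rpow_eq hr.le, Real.enorm_eq_ofReal (by positivity)]

theorem intervalIntegrable_integral_rpow {r : ℝ} (hr : 0 < r)
    (hw : ContinuousOn w (timeInterval T)) (hL : IsLocLp T r w) {S : ℝ} (hS0 : 0 ≤ S)
    (hS : ENNReal.ofReal S < T) (ρ : ℝ) :
    IntervalIntegrable (fun t => ∫ x in Metric.closedBall (0 : E n) ρ, |w t x| ^ r) volume 0 S := by
  have hsub : Ioc 0 S ⊆ timeInterval T :=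
    Ioc_subset_Icc_self.trans (Icc_subset_timeInterval hS)
  have h1 := hL S (Icc_subset_timeInterval hS ⟨hS0, le_rfl⟩) _ (isCompact_closedBall (0 : E n) ρ)
  rw [restrict_Ioo_eq_restrict_Ioc] at h1
  have hm : AEMeasurable (fun t => ∫⁻ x in Metric.closedBall (0 : E n) ρ, ‖w t x‖ₑ ^ r)
      (volume.restrict (Ioc 0 S)) := 
    (aemeasurable_setLIntegral_rpow hw r ρ).mono_measure (Measure.restrict_mono hsub le_rfl)
  rw [intervalIntegrable_iff_integrableOn_Ioc_of_le hS0]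
  refine (integrable_toReal_of_lintegral_ne_top hm h1.ne).congr (ae_of_all _ fun t => ?_)
  beta_reduce
  rw [integral_eq_lintegral_of_nonneg_ae (ae_of_all _ fun x => by positivity)
    (aestronglyMeasurable_abs_rpow (w t) r).restrict]
  simp_rw [enorm_rpow_eq hr.le]

theorem aestronglyMeasurable_integral_rpow {r : ℝ} (hr : 0 < r)
    (hw : ContinuousOn w (timeInterval T)) (hL : IsLocLp T r w) {S : ℝ} (hS0 : 0 ≤ S)
    (hS : ENNReal.ofReal S < T) {ρ M : ℝ} {h : E n → ℝ} (hc : Continuous h)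
    (hs : ∀ x, ρ < ‖x‖ → h x = 0) (hM : ∀ x, |h x| ≤ M) :
    AEStronglyMeasurable (fun t => ∫ x, |w t x| ^ r * h x) (volume.restrict (Ioc 0 S)) := by
  have hsub : Ioc 0 S ⊆ timeInterval T :=
    Ioc_subset_Icc_self.trans (Icc_subset_timeInterval hS)
  have hmes : ∀ g : E n → ℝ, Continuous g →
      AEMeasurable (fun t => (∫⁻ x, ‖w t x‖ₑ ^ r * ENNReal.ofReal (g x)).toReal)
        (volume.restrict (Ioc 0 S)) := fun g hg =>
    ((aemeasurable_lintegral_rpow hw r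
      (ENNReal.measurable_ofReal.comp hg.measurable)).mono_measure
        (Measure.restrict_mono hsub le_rfl)).ennreal_toReal
  refine (((hmes h hc).sub (hmes (fun x => -h x) hc.neg)).aestronglyMeasurable).congr ?_
  filter_upwards [ae_integrable_rpow hr hw hL hS hS0 ρ] with t ht
  have hi : Integrable (fun x => |w t x| ^ r * h x) := by
    have h1 : IntegrableOn (fun x => |w t x| ^ r * h x) (Metric.closedBall 0 ρ) :=
      ht.mul_bdd (c := M) hc.aestronglyMeasurable (ae_of_all _ fun x => hM x)
    refine (integrableOn_iff_integrable_of_support_subset fun x hx => ?_).1 h1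
    by_contra hx'
    exact hx (by simp [hs x (by simpa using hx')])
  rw [integral_eq_lintegral_pos_part_sub_lintegral_neg_part hi]
  simp only [Pi.sub_apply]
  congr 2
  · refine lintegral_congr fun x => ?_
    rw [enorm_rpow_eq hr.le, ENNReal.ofReal_mul (by positivity)]
  · refine lintegral_congr fun x => ?_
    rw [enorm_rpow_eq hr.le, ← mul_neg, ENNReal.ofReal_mul (by positivity)]

theorem abs_integral_rpow_mul_le {r : ℝ} {v : E n → ℝ} {ρ M : ℝ}
    (hi : IntegrableOn (fun x => |v x| ^ r) (Metric.closedBall 0 ρ)) {h : E n → ℝ}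
    (hs : ∀ x, ρ < ‖x‖ → h x = 0) (hM : ∀ x, |h x| ≤ M) :
    |∫ x, |v x| ^ r * h x| ≤ M * ∫ x in Metric.closedBall (0 : E n) ρ, |v x| ^ r := by
  rw [← integral_const_mul, ← integral_indicator Metric.isClosed_closedBall.measurableSet,
    ← Real.norm_eq_abs]
  refine norm_integral_le_of_norm_le
    ((integrable_indicator_iff Metric.isClosed_closedBall.measurableSet).2 (hi.const_mul M))
    (ae_of_all _ fun x => ?_)
  by_cases hx : x ∈ Metric.closedBall (0 : E n) ρ
  · rw [indicator_of_mem hx, Real.norm_eq_abs, abs_mul, abs_of_nonneg (by positivity), mul_comm]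
    exact mul_le_mul_of_nonneg_right (hM x) (by positivity)
  · rw [indicator_of_notMem hx, hs x (by simpa using hx)]
    simp

theorem intervalIntegrable_mul_integral_rpow {r : ℝ} (hr : 0 < r)
    (hw : ContinuousOn w (timeInterval T)) (hL : IsLocLp T r w) {θ : ℝ → ℝ} (hθ : Continuous θ)
    {S : ℝ} (hS0 : 0 ≤ S) (hS : ENNReal.ofReal S < T) {ρ M : ℝ} {h : E n → ℝ} (hc : Continuous h)
    (hs : ∀ x, ρ < ‖x‖ → h x = 0) (hM : ∀ x, |h x| ≤ M) :
    IntervalIntegrable (fun t => θ t * ∫ x, |w t x| ^ r * h x) volume 0 S := by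
  refine IntervalIntegrable.continuousOn_mul ?_ hθ.continuousOn
  refine ((intervalIntegrable_integral_rpow hr hw hL hS0 hS ρ).const_mul M).mono_fun ?_ ?_
  · rw [uIoc_of_le hS0]
    exact aestronglyMeasurable_integral_rpow hr hw hL hS0 hS hc hs hM
  · rw [uIoc_of_le hS0]
    filter_upwards [ae_integrable_rpow hr hw hL hS hS0 ρ] with t ht
    exact (abs_integral_rpow_mul_le ht hs hM).trans (le_abs_self _)

theorem tendsto_integral_rpow {r : ℝ} (hr : 0 < r) (hw : ContinuousOn w (timeInterval T))
    (hL : IsLocLp T r w) {θ : ℝ → ℝ} (hθ : Continuous θ) {S : ℝ} (hS0 : 0 ≤ S)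
    (hS : ENNReal.ofReal S < T) {ρ M : ℝ} {h : ℕ → E n → ℝ} {h₀ : E n → ℝ}
    (hc : ∀ k, Continuous (h k)) (hs : ∀ k x, ρ < ‖x‖ → h k x = 0) (hM : ∀ k x, |h k x| ≤ M)
    (hlim : ∀ x, Tendsto (fun k => h k x) atTop (𝓝 (h₀ x))) :
    Tendsto (fun k => ∫ t in (0 : ℝ)..S, θ t * ∫ x, |w t x| ^ r * h k x) atTop
      (𝓝 (∫ t in (0 : ℝ)..S, θ t * ∫ x, |w t x| ^ r * h₀ x)) := by
  have hae : ∀ᵐ t ∂(volume : Measure ℝ), t ∈ uIoc 0 S →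
      IntegrableOn (fun x => |w t x| ^ r) (Metric.closedBall 0 ρ) := by
    rw [uIoc_of_le hS0]
    exact (ae_restrict_iff' measurableSet_Ioc).1 (ae_integrable_rpow hr hw hL hS hS0 ρ)
  refine intervalIntegral.tendsto_integral_filter_of_dominated_convergence
    (fun t => |θ t| * (M * ∫ x in Metric.closedBall (0 : E n) ρ, |w t x| ^ r))
    (Eventually.of_forall fun k => ?_) (Eventually.of_forall fun k => ?_)
    (((intervalIntegrable_integral_rpow hr hw hL hS0 hS ρ).const_mul M).continuousOn_mul
      hθ.abs.continuousOn) ?_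
  · rw [uIoc_of_le hS0]
    exact hθ.aestronglyMeasurable.mul
      (aestronglyMeasurable_integral_rpow hr hw hL hS0 hS (hc k) (hs k) (hM k))
  · filter_upwards [hae] with t ht htS
    rw [Real.norm_eq_abs, abs_mul]
    exact mul_le_mul_of_nonneg_left (abs_integral_rpow_mul_le (ht htS) (hs k) (hM k))
      (abs_nonneg _)
  · filter_upwards [hae] with t ht htS
    refine Tendsto.const_mul _ ?_
    have hi := ht htS
    refine tendsto_integral_of_dominated_convergence
      ((Metric.closedBall (0 : E n) ρ).indicator fun x => |w t x| ^ r * M)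
      (fun k => (aestronglyMeasurable_abs_rpow (w t) r).mul (hc k).aestronglyMeasurable)
      ((integrable_indicator_iff Metric.isClosed_closedBall.measurableSet).2 (hi.mul_const M))
      (fun k => ae_of_all _ fun x => ?_) (ae_of_all _ fun x => (hlim x).const_mul _)
    by_cases hx : x ∈ Metric.closedBall (0 : E n) ρ
    · rw [indicator_of_mem hx, Real.norm_eq_abs, abs_mul, abs_of_nonneg (by positivity)]
      exact mul_le_mul_of_nonneg_left (hM k x) (by positivity)
    · rw [indicator_of_notMem hx, hs k x (by simpa using hx)]
      simp

end

section

variable {n : ℕ} {T : ℝ≥0∞} {D V : E n → ℝ} {p ε : ℝ} {f₀ g₀ : E n → ℝ} {u ut : ℝ → L2 n}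
  {gu : ℝ → L2Vec n} {w : ℝ → L2 n}

/-- The separated weak identity for a compactly supported factor of class `C²`. -/
theorem WeakEquation.separated_of_compact (hW : WeakEquation T D V p ε f₀ g₀ u ut gu w)
    (hp : 0 < p) (hE : IsEnergyClass T u ut gu) (hA : AttainsData ε f₀ g₀ u ut)
    (hw : ContinuousOn w (timeInterval T)) (hL : IsLocLp T p w) (hD : Continuous D)
    (hV : Continuous V) (hf₀ : Continuous f₀) (hg₀ : Continuous g₀) {θ θ₁ θ₂ : ℝ → ℝ}
    (hθ : ContDiff ℝ (⊤ : ℕ∞) θ) (hθ₁ : ∀ t, HasDerivAt θ (θ₁ t) t)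
    (hθ₂ : ∀ t, HasDerivAt θ₁ (θ₂ t) t) (hθ₂c : Continuous θ₂) {S : ℝ} (hS0 : 0 ≤ S)
    (hS : ENNReal.ofReal S < T) (hθS : ∀ t, S ≤ t → θ t = 0) {f : E n → ℝ}
    (hf : ContDiff ℝ 2 f) (hfc : HasCompactSupport f) :
    ε * θ 0 * (∫ x, g₀ x * f x) + ε * θ 0 * (∫ x, f₀ x * (D x * f x))
        - ε * θ₁ 0 * (∫ x, f₀ x * f x) + (∫ t in (0 : ℝ)..S, θ t * ∫ x, |w t x| ^ p * f x)
      = (∫ t in (0 : ℝ)..S, θ₂ t * ∫ x, u t x * f x)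
        - (∫ t in (0 : ℝ)..S, θ₁ t * ∫ x, u t x * (D x * f x))
        + (∫ t in (0 : ℝ)..S, θ t * ∫ x, u t x * (V x * f x - lap f x)) := by
  obtain ⟨ρ, hρ⟩ : ∃ ρ, tsupport f ⊆ Metric.closedBall 0 ρ := hfc.isBounded.subset_closedBall 0
  choose F hF1 hF2 hF3 hF4 using fun k : ℕ =>
    exists_smooth_approx hf hρ (Nat.one_div_pos_of_nat (α := ℝ) (n := k))
  have hk1 : ∀ k : ℕ, 1 / ((k : ℝ) + 1) ≤ 1 := fun k => by
    rw [div_le_one (by positivity)]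
    linarith [Nat.cast_nonneg (α := ℝ) k]
  have hFc : ∀ k, HasCompactSupport (F k) := fun k =>
    (isCompact_closedBall (0 : E n) (ρ + 1)).of_isClosed_subset (isClosed_tsupport _) (hF2 k)
  have hF5 : ∀ k, ContDiff ℝ 2 (F k) := fun k => by exact_mod_cast contDiff_infty.1 (hF1 k) 2
  have hl1 : ∀ x, Tendsto (fun k => F k x) atTop (𝓝 (f x)) := fun x => by
    rw [tendsto_iff_dist_tendsto_zero]
    exact squeeze_zero (fun _ => dist_nonneg) (fun k => hF3 k x)
      tendsto_one_div_add_atTop_nhds_zero_nat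
  have hl2 : ∀ x, Tendsto (fun k => lap (F k) x) atTop (𝓝 (lap f x)) := fun x => by
    rw [tendsto_iff_dist_tendsto_zero]
    exact squeeze_zero (fun _ => dist_nonneg) (fun k => hF4 k x)
      tendsto_one_div_add_atTop_nhds_zero_nat
  have hz : ∀ k x, ρ + 1 < ‖x‖ → F k x = 0 := fun k x hx => eq_zero_of_tsupport_subset (hF2 k) hx
  have hzl : ∀ k x, ρ + 1 < ‖x‖ → lap (F k) x = 0 := fun k x hx => by
    have h1 : F k =ᶠ[𝓝 x] fun _ => 0 := by
      filter_upwards [(isOpen_lt continuous_const continuous_norm).mem_nhds hx] with y hy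
      exact hz k y hy
    rw [lap_congr h1]
    simp [lap]
  obtain ⟨M₁, hM₁⟩ := hf.continuous.bounded_above_of_compact_support hfc
  obtain ⟨M₂, hM₂⟩ := (continuous_lap hf).bounded_above_of_compact_support
    (hasCompactSupport_lap hfc)
  have hb1 : ∀ k x, |F k x| ≤ M₁ + 1 := fun k x => by
    have h1 := abs_sub_abs_le_abs_sub (F k x) (f x)
    have h2 := hM₁ x
    rw [Real.norm_eq_abs] at h2
    linarith [hF3 k x, hk1 k]
  have hb2 : ∀ k x, |lap (F k) x| ≤ M₂ + 1 := fun k x => by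
    have h1 := abs_sub_abs_le_abs_sub (lap (F k) x) (lap f x)
    have h2 := hM₂ x
    rw [Real.norm_eq_abs] at h2
    linarith [hF4 k x, hk1 k]
  have hcoef : ∀ a : E n → ℝ, Continuous a → ∃ M, ∀ k x, |a x * F k x| ≤ M := by
    intro a ha
    obtain ⟨N, hN⟩ := (isCompact_closedBall (0 : E n) (ρ + 1)).exists_bound_of_continuousOn
      ha.continuousOn
    refine ⟨|N| * (M₁ + 1), fun k x => ?_⟩
    have h0 : 0 ≤ M₁ + 1 := (abs_nonneg _).trans (hb1 0 0)
    by_cases hx : x ∈ Metric.closedBall (0 : E n) (ρ + 1)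
    · rw [abs_mul]
      exact mul_le_mul ((hN x hx).trans (le_abs_self N)) (hb1 k x) (abs_nonneg _) (abs_nonneg _)
    · rw [hz k x (by simpa using hx)]
      simp only [mul_zero, abs_zero]
      positivity
  obtain ⟨M₃, hM₃⟩ := hcoef D hD
  obtain ⟨M₄, hM₄⟩ := hcoef V hV
  have cF : ∀ k, Continuous (F k) := fun k => (hF5 k).continuous
  have cD : ∀ k, Continuous fun x => D x * F k x := fun k => hD.mul (cF k)
  have cV : ∀ k, Continuous fun x => V x * F k x - lap (F k) x := fun k =>
    (hV.mul (cF k)).sub (continuous_lap (hF5 k))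
  have zD : ∀ k x, ρ + 1 < ‖x‖ → D x * F k x = 0 := fun k x hx => by simp [hz k x hx]
  have zV : ∀ k x, ρ + 1 < ‖x‖ → V x * F k x - lap (F k) x = 0 := fun k x hx => by
    simp [hz k x hx, hzl k x hx]
  have bV : ∀ k x, |V x * F k x - lap (F k) x| ≤ M₄ + (M₂ + 1) := fun k x =>
    (abs_sub _ _).trans (add_le_add (hM₄ k x) (hb2 k x))
  have lD : ∀ x, Tendsto (fun k => D x * F k x) atTop (𝓝 (D x * f x)) := fun x =>
    (hl1 x).const_mul _
  have lV : ∀ x, Tendsto (fun k => V x * F k x - lap (F k) x) atTop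
      (𝓝 (V x * f x - lap f x)) := fun x => ((hl1 x).const_mul _).sub (hl2 x)
  have hθ₁c : Continuous θ₁ := continuous_iff_continuousAt.2 fun t => (hθ₂ t).continuousAt
  have t1 := ((tendsto_integral_mul hg₀.locallyIntegrable cF hz hb1 hl1).const_mul (ε * θ 0))
  have t2 := ((tendsto_integral_mul hf₀.locallyIntegrable cD zD hM₃ lD).const_mul (ε * θ 0))
  have t3 := ((tendsto_integral_mul hf₀.locallyIntegrable cF hz hb1 hl1).const_mul (ε * θ₁ 0))
  have t4 := tendsto_integral_rpow hp hw hL hθ.continuous hS0 hS cF hz hb1 hl1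
  have t5 := hE.tendsto_pairing hθ₂c hS0 hS cF hz hb1 hl1
  have t6 := hE.tendsto_pairing hθ₁c hS0 hS cD zD hM₃ lD
  have t7 := hE.tendsto_pairing hθ.continuous hS0 hS cV zV bV lV
  refine tendsto_nhds_unique (((t1.add t2).sub t3).add t4) (((t5.sub t6).add t7).congr fun k => ?_)
  exact (hW.smooth_separated hE hA hD hV hθ hθ₁ hθ₂ hθ₂c hS0 hS hθS (hF1 k) (hFc k)).symm

/-- A smooth spatial cutoff equal to one near the closed ball of radius `ρ`. -/
theorem exists_spatial_cutoff (n : ℕ) (ρ : ℝ) : ∃ ζ : E n → ℝ, ContDiff ℝ 2 ζ ∧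
    HasCompactSupport ζ ∧ ∀ x, ‖x‖ ≤ ρ → ζ =ᶠ[𝓝 x] fun _ => 1 := by
  let b : ContDiffBump (0 : E n) := ⟨|ρ| + 1, |ρ| + 2, by positivity, by linarith⟩
  refine ⟨b, b.contDiff, b.hasCompactSupport, fun x hx => ?_⟩
  have : x ∈ Metric.ball (0 : E n) (|ρ| + 1) := by
    rw [mem_ball_zero_iff]
    linarith [le_abs_self ρ]
  filter_upwards [Metric.isOpen_ball.mem_nhds this] with y hy
  exact b.one_of_mem_closedBall (Metric.ball_subset_closedBall hy)

theorem integrable_mul_of_support {v : L2 n} {ρ : ℝ} (hv : ∀ᵐ x, ρ < ‖x‖ → v x = 0) {h : E n → ℝ}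
    (hh : Continuous h) : Integrable fun x => v x * h x := by
  obtain ⟨ζ, hζ1, hζ2, hζ3⟩ := exists_spatial_cutoff n ρ
  refine (integrable_mul_of_L2 v (f := fun x => ζ x * h x) (hζ1.continuous.mul hh)
    hζ2.mul_right).congr ?_
  filter_upwards [hv] with x hx
  by_cases hxρ : ρ < ‖x‖
  · simp [hx hxρ]
  · rw [(hζ3 x (not_lt.1 hxρ)).eq_of_nhds, one_mul]

theorem FiniteSpeed.ae_eq_zero {R : ℝ} (hF : FiniteSpeed T R u) {S : ℝ}
    (hS : ENNReal.ofReal S < T) {t : ℝ} (ht : t ∈ Icc 0 S) : ∀ᵐ x, S + R < ‖x‖ → u t x = 0 := by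
  filter_upwards [hF t (Icc_subset_timeInterval hS ht)] with x hx hx'
  exact hx (by linarith [ht.2])

theorem IsEnergyClass.continuousOn_pairing_of_finiteSpeed (hE : IsEnergyClass T u ut gu) {R : ℝ}
    (hF : FiniteSpeed T R u) {S : ℝ} (hS : ENNReal.ofReal S < T) {h : E n → ℝ}
    (hh : Continuous h) : ContinuousOn (fun t => ∫ x, u t x * h x) (Icc 0 S) := by
  obtain ⟨ζ, hζ1, hζ2, hζ3⟩ := exists_spatial_cutoff n (S + R)
  refine ((hE.continuousOn_pairing (f := fun x => ζ x * h x) (hζ1.continuous.mul hh)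
    hζ2.mul_right).mono (Icc_subset_timeInterval hS)).congr fun t ht => ?_
  refine integral_congr_ae ?_
  filter_upwards [hF.ae_eq_zero hS ht] with x hx
  by_cases hxρ : S + R < ‖x‖
  · simp [hx hxρ]
  · rw [(hζ3 x (not_lt.1 hxρ)).eq_of_nhds, one_mul]

/-- The separated weak identity for an arbitrary factor of class `C²`, thanks to finite speed of
propagation. -/
theorem WeakEquation.separated (hW : WeakEquation T D V p ε f₀ g₀ u ut gu w)
    (hp : 0 < p) (hE : IsEnergyClass T u ut gu) (hA : AttainsData ε f₀ g₀ u ut)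
    (hw : ContinuousOn w (timeInterval T)) (hL : IsLocLp T p w) (hD : Continuous D)
    (hV : Continuous V) {R : ℝ} (hdata : IsData f₀ g₀ R) (hFu : FiniteSpeed T R u)
    (hFw : FiniteSpeed T R w) {θ θ₁ θ₂ : ℝ → ℝ}
    (hθ : ContDiff ℝ (⊤ : ℕ∞) θ) (hθ₁ : ∀ t, HasDerivAt θ (θ₁ t) t)
    (hθ₂ : ∀ t, HasDerivAt θ₁ (θ₂ t) t) (hθ₂c : Continuous θ₂) {S : ℝ} (hS0 : 0 ≤ S)
    (hS : ENNReal.ofReal S < T) (hθS : ∀ t, S ≤ t → θ t = 0) {f : E n → ℝ}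
    (hf : ContDiff ℝ 2 f) :
    ε * θ 0 * (∫ x, g₀ x * f x) + ε * θ 0 * (∫ x, f₀ x * (D x * f x))
        - ε * θ₁ 0 * (∫ x, f₀ x * f x) + (∫ t in (0 : ℝ)..S, θ t * ∫ x, |w t x| ^ p * f x)
      = (∫ t in (0 : ℝ)..S, θ₂ t * ∫ x, u t x * f x)
        - (∫ t in (0 : ℝ)..S, θ₁ t * ∫ x, u t x * (D x * f x))
        + (∫ t in (0 : ℝ)..S, θ t * ∫ x, u t x * (V x * f x - lap f x)) := by
  obtain ⟨ζ, hζ1, hζ2, hζ3⟩ := exists_spatial_cutoff n (S + R)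
  have key := hW.separated_of_compact hp hE hA hw hL hD hV hdata.smooth_left.continuous
    hdata.smooth_right.continuous hθ hθ₁ hθ₂ hθ₂c hS0 hS hθS (hζ1.mul hf) hζ2.mul_right
  have hloc : ∀ x, ‖x‖ ≤ S + R → (fun x => ζ x * f x) =ᶠ[𝓝 x] f := fun x hx => by
    filter_upwards [hζ3 x hx] with y hy
    rw [hy, one_mul]
  have hval : ∀ x, ‖x‖ ≤ S + R → ζ x * f x = f x := fun x hx => (hloc x hx).eq_of_nhds
  have hlap : ∀ x, ‖x‖ ≤ S + R → lap (fun x => ζ x * f x) x = lap f x := fun x hx =>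
    lap_congr (hloc x hx)
  have gen : ∀ (v h h' : E n → ℝ), (∀ᵐ x, S + R < ‖x‖ → v x = 0) →
      (∀ x, ‖x‖ ≤ S + R → h x = h' x) → ∫ x, v x * h x = ∫ x, v x * h' x := by
    intro v h h' hv hh
    refine integral_congr_ae ?_
    filter_upwards [hv] with x hx
    by_cases hxρ : S + R < ‖x‖
    · simp [hx hxρ]
    · rw [hh x (not_lt.1 hxρ)]
  have genT : ∀ (v : ℝ → E n → ℝ) (h h' : E n → ℝ) (θ : ℝ → ℝ),
      (∀ t ∈ Icc 0 S, ∀ᵐ x, S + R < ‖x‖ → v t x = 0) →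
      (∀ x, ‖x‖ ≤ S + R → h x = h' x) → ∫ t in (0 : ℝ)..S, θ t * ∫ x, v t x * h x
        = ∫ t in (0 : ℝ)..S, θ t * ∫ x, v t x * h' x := by
    intro v h h' θ hv hh
    refine intervalIntegral.integral_congr fun t ht => ?_
    rw [uIcc_of_le hS0] at ht
    simp only [gen _ _ _ (hv t ht) hh]
  have z1 : ∀ᵐ x, S + R < ‖x‖ → f₀ x = 0 := ae_of_all _ fun x hx =>
    eq_zero_of_tsupport_subset hdata.support_left (by linarith)
  have z2 : ∀ᵐ x, S + R < ‖x‖ → g₀ x = 0 := ae_of_all _ fun x hx =>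
    eq_zero_of_tsupport_subset hdata.support_right (by linarith)
  have z3 : ∀ t ∈ Icc 0 S, ∀ᵐ x, S + R < ‖x‖ → |w t x| ^ p = 0 := fun t ht => by
    filter_upwards [hFw.ae_eq_zero hS ht] with x hx hx'
    rw [hx hx', abs_zero, Real.zero_rpow hp.ne']
  have z4 : ∀ t ∈ Icc 0 S, ∀ᵐ x, S + R < ‖x‖ → u t x = 0 := fun t ht => hFu.ae_eq_zero hS ht
  rw [gen g₀ _ _ z2 hval, gen f₀ _ (fun x => D x * f x) z1 (fun x hx => by rw [hval x hx]),
    gen f₀ _ _ z1 hval, genT (fun t x => |w t x| ^ p) _ _ θ z3 hval,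
    genT (fun t x => u t x) _ _ θ₂ z4 hval,
    genT (fun t x => u t x) _ (fun x => D x * f x) θ₁ z4 (fun x hx => by rw [hval x hx]),
    genT (fun t x => u t x) _ (fun x => V x * f x - lap f x) θ z4
      (fun x hx => by rw [hval x hx, hlap x hx])] at key
  exact key

end

section

/-! ### The basic integral inequality -/

/-- `Z` is a smooth decreasing cutoff, equal to `1` for `t ≤ 1/2` and to `0` for `t ≥ 1`, whose
derivatives `Z₁, Z₂, Z₃` up to order three are bounded by `C Z^s`. -/
structure IsTimeCutoff (s C : ℝ) (Z Z₁ Z₂ Z₃ : ℝ → ℝ) : Prop where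
  contDiff : ContDiff ℝ (⊤ : ℕ∞) Z
  contDiff₁ : ContDiff ℝ (⊤ : ℕ∞) Z₁
  deriv₁ : ∀ t, HasDerivAt Z (Z₁ t) t
  deriv₂ : ∀ t, HasDerivAt Z₁ (Z₂ t) t
  deriv₃ : ∀ t, HasDerivAt Z₂ (Z₃ t) t
  continuous₃ : Continuous Z₃
  nonneg : ∀ t, 0 ≤ Z t
  le_one : ∀ t, Z t ≤ 1
  eq_one : ∀ t, t ≤ 1 / 2 → Z t = 1
  eq_zero : ∀ t, 1 ≤ t → Z t = 0
  nonpos₁ : ∀ t, Z₁ t ≤ 0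
  bound₁ : ∀ t, |Z₁ t| ≤ C * Z t ^ s
  bound₂ : ∀ t, |Z₂ t| ≤ C * Z t ^ s
  bound₃ : ∀ t, |Z₃ t| ≤ C * Z t ^ s

theorem eq_zero_of_const_Iic {θ θ₁ : ℝ → ℝ} {S c : ℝ} (h : ∀ t, HasDerivAt θ (θ₁ t) t)
    (h0 : ∀ t, t ≤ S → θ t = c) (t : ℝ) (ht : t ≤ S) : θ₁ t = 0 := by
  have h1 : HasDerivWithinAt θ 0 (Iic S) t :=
    (hasDerivWithinAt_const t (Iic S) c).congr (fun s hs => h0 s hs) (h0 t ht)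
  exact (uniqueDiffOn_Iic S t ht).eq_deriv _ (h t).hasDerivWithinAt h1

namespace IsTimeCutoff

variable {s C : ℝ} {Z Z₁ Z₂ Z₃ : ℝ → ℝ}

theorem eq_zero₁ (h : IsTimeCutoff s C Z Z₁ Z₂ Z₃) : ∀ t, t ≤ 1 / 2 → Z₁ t = 0 :=
  eq_zero_of_const_Iic h.deriv₁ h.eq_one

theorem eq_zero₂ (h : IsTimeCutoff s C Z Z₁ Z₂ Z₃) : ∀ t, t ≤ 1 / 2 → Z₂ t = 0 :=
  eq_zero_of_const_Iic h.deriv₂ h.eq_zero₁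

theorem eq_zero₃ (h : IsTimeCutoff s C Z Z₁ Z₂ Z₃) : ∀ t, t ≤ 1 / 2 → Z₃ t = 0 :=
  eq_zero_of_const_Iic h.deriv₃ h.eq_zero₂

end IsTimeCutoff

/-- A high power of a smooth cutoff is a cutoff in the above sense: each derivative costs one
power. -/
theorem exists_timeCutoff {s : ℝ} (hs0 : 0 ≤ s) (hs : s < 1) :
    ∃ (C : ℝ) (Z Z₁ Z₂ Z₃ : ℝ → ℝ), 0 ≤ C ∧ IsTimeCutoff s C Z Z₁ Z₂ Z₃ := by
  obtain ⟨k, hk⟩ := exists_nat_ge (3 * s / (1 - s))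
  have hks : ((k : ℝ) + 3) * s ≤ k := by
    rw [div_le_iff₀ (by linarith)] at hk
    linarith
  obtain ⟨η, hη⟩ : ∃ η : ℝ → ℝ, η = fun t => Real.smoothTransition (2 - 2 * t) := ⟨_, rfl⟩
  have hη0 : ∀ t, 0 ≤ η t := fun t => by rw [hη]; exact Real.smoothTransition.nonneg _
  have hη1 : ∀ t, η t ≤ 1 := fun t => by rw [hη]; exact Real.smoothTransition.le_one _
  have hηone : ∀ t, t ≤ 1 / 2 → η t = 1 := fun t ht => by
    rw [hη]; exact Real.smoothTransition.one_of_one_le (by linarith)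
  have hηz : ∀ t, 1 ≤ t → η t = 0 := fun t ht => by
    rw [hη]; exact Real.smoothTransition.zero_of_nonpos (by linarith)
  have hηanti : Antitone η := fun a b hab => by
    rw [hη]; exact Real.smoothTransition.monotone (by linarith)
  have c0 : ContDiff ℝ (⊤ : ℕ∞) η := by
    rw [hη]; exact Real.smoothTransition.contDiff.comp (by fun_prop)
  have cd : ∀ f : ℝ → ℝ, ContDiff ℝ (⊤ : ℕ∞) f → ContDiff ℝ (⊤ : ℕ∞) (deriv f) := fun f hf =>
    ((contDiff_succ_iff_deriv (n := ((⊤ : ℕ∞) : WithTop ℕ∞))).1 (by simpa using hf)).2.2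
  have hd : ∀ f : ℝ → ℝ, ContDiff ℝ (⊤ : ℕ∞) f → ∀ t, HasDerivAt f (deriv f t) t := fun f hf t =>
    (hf.differentiable (by simp) t).hasDerivAt
  obtain ⟨η₁, e1⟩ : ∃ η₁, η₁ = deriv η := ⟨_, rfl⟩
  obtain ⟨η₂, e2⟩ : ∃ η₂, η₂ = deriv η₁ := ⟨_, rfl⟩
  obtain ⟨η₃, e3⟩ : ∃ η₃, η₃ = deriv η₂ := ⟨_, rfl⟩
  have c1 : ContDiff ℝ (⊤ : ℕ∞) η₁ := e1 ▸ cd η c0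
  have c2 : ContDiff ℝ (⊤ : ℕ∞) η₂ := e2 ▸ cd η₁ c1
  have c3 : ContDiff ℝ (⊤ : ℕ∞) η₃ := e3 ▸ cd η₂ c2
  have d1 : ∀ t, HasDerivAt η (η₁ t) t := e1 ▸ hd η c0
  have d2 : ∀ t, HasDerivAt η₁ (η₂ t) t := e2 ▸ hd η₁ c1
  have d3 : ∀ t, HasDerivAt η₂ (η₃ t) t := e3 ▸ hd η₂ c2
  have hbd : ∀ f : ℝ → ℝ, Continuous f → (∀ t, t ≤ 1 / 2 → f t = 0) → (∀ t, 1 ≤ t → f t = 0) →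
      ∃ M, 0 ≤ M ∧ ∀ t, |f t| ≤ M := by
    intro f hf h1 h2
    obtain ⟨M, hM⟩ := isCompact_Icc.exists_bound_of_continuousOn (s := Icc (1 / 2 : ℝ) 1)
      hf.continuousOn
    refine ⟨|M|, abs_nonneg _, fun t => ?_⟩
    by_cases ha : t ≤ 1 / 2
    · rw [h1 t ha]; simp
    by_cases hb : 1 ≤ t
    · rw [h2 t hb]; simp
    exact (hM t ⟨(not_le.1 ha).le, (not_le.1 hb).le⟩).trans (le_abs_self M)
  have a1 := eq_zero_of_const_Iic d1 hηone
  have a2 := eq_zero_of_const_Iic d2 a1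
  have a3 := eq_zero_of_const_Iic d3 a2
  have b1 := deriv_eq_zero_of_eqOn_Ici d1 hηz
  have b2 := deriv_eq_zero_of_eqOn_Ici d2 b1
  have b3 := deriv_eq_zero_of_eqOn_Ici d3 b2
  obtain ⟨M₁, hM₁, m1⟩ := hbd η₁ c1.continuous a1 b1
  obtain ⟨M₂, hM₂, m2⟩ := hbd η₂ c2.continuous a2 b2
  obtain ⟨M₃, hM₃, m3⟩ := hbd η₃ c3.continuous a3 b3
  have hneg : ∀ t, η₁ t ≤ 0 := fun t => by
    rw [e1]; exact hηanti.deriv_nonpos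
  let K : ℝ := k
  have hK : 0 ≤ K := Nat.cast_nonneg k
  let C₁ := (K + 3) * M₁
  let C₂ := (K + 3) * (K + 2) * M₁ ^ 2 + (K + 3) * M₂
  let C₃ := (K + 3) * (K + 2) * (K + 1) * M₁ ^ 3 + 3 * (K + 3) * (K + 2) * M₁ * M₂ + (K + 3) * M₃
  have hC₁ : 0 ≤ C₁ := by positivity
  have hC₂ : 0 ≤ C₂ := by positivity
  have hC₃ : 0 ≤ C₃ := by positivity
  have hpow : ∀ t, η t ^ k ≤ (η t ^ (k + 3)) ^ s := by
    intro t
    rcases (hη0 t).eq_or_lt with h0 | h0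
    · rcases Nat.eq_zero_or_pos k with rfl | hkp
      · have : s = 0 := by
          have : (0 + 3) * s ≤ 0 := by simpa using hks
          linarith
        simp [this]
      · rw [← h0, zero_pow hkp.ne']
        positivity
    · rw [← Real.rpow_natCast, ← Real.rpow_natCast, ← Real.rpow_mul (hη0 t)]
      refine Real.rpow_le_rpow_of_exponent_ge h0 (hη1 t) ?_
      push_cast
      exact hks
  have hp : ∀ t, 0 ≤ η t ^ k := fun t => pow_nonneg (hη0 t) k
  refine ⟨C₁ + C₂ + C₃, fun t => η t ^ (k + 3), fun t => (K + 3) * η t ^ (k + 2) * η₁ t,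
    fun t => (K + 3) * (K + 2) * η t ^ (k + 1) * η₁ t ^ 2 + (K + 3) * η t ^ (k + 2) * η₂ t,
    fun t => (K + 3) * (K + 2) * (K + 1) * η t ^ k * η₁ t ^ 3
      + 3 * (K + 3) * (K + 2) * η t ^ (k + 1) * η₁ t * η₂ t + (K + 3) * η t ^ (k + 2) * η₃ t,
    by positivity, ?_⟩
  have hbound : ∀ (t X c : ℝ), 0 ≤ c → c ≤ C₁ + C₂ + C₃ → |X| ≤ c * η t ^ k →
      |X| ≤ (C₁ + C₂ + C₃) * (η t ^ (k + 3)) ^ s := fun t X c hc0 hc hX =>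
    hX.trans (mul_le_mul hc (hpow t) (hp t) (by positivity))
  have hle : ∀ t (j : ℕ), η t ^ (k + j) ≤ η t ^ k := fun t j =>
    pow_le_pow_of_le_one (hη0 t) (hη1 t) (Nat.le_add_right k j)
  refine ⟨c0.pow _, (contDiff_const.mul (c0.pow _)).mul c1, fun t => ?_, fun t => ?_, fun t => ?_,
    ?_, fun t => pow_nonneg (hη0 t) _, fun t => pow_le_one₀ (hη0 t) (hη1 t),
    fun t ht => by simp [hηone t ht], fun t ht => by simp [hηz t ht], fun t => ?_, fun t => ?_,
    fun t => ?_, fun t => ?_⟩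
  · refine ((d1 t).pow (k + 3)).congr_deriv ?_
    simp only [K]; push_cast
    ring_nf
  · refine ((((d1 t).pow (k + 2)).const_mul (K + 3)).mul (d2 t)).congr_deriv ?_
    simp only [K, Pi.pow_apply]; push_cast
    ring
  · refine (((((d1 t).pow (k + 1)).const_mul ((K + 3) * (K + 2))).mul ((d2 t).pow 2)).add
      ((((d1 t).pow (k + 2)).const_mul (K + 3)).mul (d3 t))).congr_deriv ?_
    simp only [K, Pi.pow_apply]; push_cast
    ring
  · have := c0.continuous
    have := c1.continuous
    have := c2.continuous
    have := c3.continuous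
    fun_prop
  · exact mul_nonpos_of_nonneg_of_nonpos
      (mul_nonneg (by positivity) (pow_nonneg (hη0 t) _)) (hneg t)
  · refine hbound t _ C₁ hC₁ (by linarith) ?_
    rw [abs_mul, abs_of_nonneg (mul_nonneg (by positivity) (pow_nonneg (hη0 t) _))]
    have l2 := hle t 2
    have n1 := m1 t
    have p0 := hp t
    generalize η t ^ (k + 2) = A at *
    calc (K + 3) * A * |η₁ t| ≤ (K + 3) * η t ^ k * M₁ := by gcongr
      _ = _ := by simp only [C₁]; ring
  · refine hbound t _ C₂ hC₂ (by linarith) ?_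
    refine (abs_add_le _ _).trans ?_
    simp only [abs_mul, abs_pow, abs_of_nonneg (hη0 t), abs_of_nonneg (show 0 ≤ K + 3 by positivity),
      abs_of_nonneg (show 0 ≤ K + 2 by positivity)]
    have l1 := hle t 1
    have l2 := hle t 2
    have n1 := m1 t
    have n2 := m2 t
    have p0 := hp t
    generalize η t ^ (k + 1) = A₁ at *
    generalize η t ^ (k + 2) = A at *
    calc (K + 3) * (K + 2) * A₁ * |η₁ t| ^ 2 + (K + 3) * A * |η₂ t|
        ≤ (K + 3) * (K + 2) * η t ^ k * M₁ ^ 2 + (K + 3) * η t ^ k * M₂ := by gcongr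
      _ = _ := by simp only [C₂]; ring
  · refine hbound t _ C₃ hC₃ (by linarith) ?_
    refine (abs_add_three _ _ _).trans ?_
    simp only [abs_mul, abs_pow, abs_of_nonneg (hη0 t), abs_of_nonneg (show 0 ≤ K + 3 by positivity),
      abs_of_nonneg (show 0 ≤ K + 2 by positivity), abs_of_nonneg (show 0 ≤ K + 1 by positivity),
      abs_of_nonneg (show (0 : ℝ) ≤ 3 by norm_num)]
    have l1 := hle t 1
    have l2 := hle t 2
    have n1 := m1 t
    have n2 := m2 t
    have n3 := m3 t
    have p0 := hp t
    generalize η t ^ (k + 1) = A₁ at *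
    generalize η t ^ (k + 2) = A at *
    calc (K + 3) * (K + 2) * (K + 1) * η t ^ k * |η₁ t| ^ 3
          + 3 * (K + 3) * (K + 2) * A₁ * |η₁ t| * |η₂ t| + (K + 3) * A * |η₃ t|
        ≤ (K + 3) * (K + 2) * (K + 1) * η t ^ k * M₁ ^ 3
          + 3 * (K + 3) * (K + 2) * η t ^ k * M₁ * M₂ + (K + 3) * η t ^ k * M₃ := by gcongr
      _ = _ := by simp only [C₃]; ring

end

section

variable {n : ℕ} {T : ℝ≥0∞} {D V : E n → ℝ} {p ε R : ℝ} {f₀ g₀ : E n → ℝ} {u ut : ℝ → L2 n}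
  {gu : ℝ → L2Vec n} {w : ℝ → L2 n}

theorem FiniteSpeed.integrable_rpow_mul {r : ℝ} (hFw : FiniteSpeed T R w) (hr : 0 < r) {S t : ℝ}
    (hS : ENNReal.ofReal S < T) (ht : t ∈ Icc 0 S)
    (hi : IntegrableOn (fun x => |w t x| ^ r) (Metric.closedBall 0 (S + R))) {h : E n → ℝ}
    (hh : Continuous h) : Integrable fun x => |w t x| ^ r * h x := by
  have h1 : IntegrableOn (fun x => |w t x| ^ r * h x) (Metric.closedBall 0 (S + R)) :=
    hi.mul_continuousOn hh.continuousOn (isCompact_closedBall _ _)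
  refine (h1.integrable_indicator Metric.isClosed_closedBall.measurableSet).congr ?_
  filter_upwards [hFw.ae_eq_zero hS ht] with x hx
  by_cases hxρ : x ∈ Metric.closedBall (0 : E n) (S + R)
  · rw [indicator_of_mem hxρ]
  · rw [indicator_of_notMem hxρ, hx (by simpa using hxρ), abs_zero, Real.zero_rpow hr.ne', zero_mul]

/-- The iterated Bochner integral of the nonlinearity agrees with the iterated lower integral, where
no integrability has to be checked any more. -/
theorem FiniteSpeed.ofReal_integral_rpow {r : ℝ} (hFw : FiniteSpeed T R w) (hr : 0 < r)
    (hw : ContinuousOn w (timeInterval T)) (hL : IsLocLp T r w) {θ : ℝ → ℝ} (hθ : Continuous θ)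
    (hθ0 : ∀ t, 0 ≤ θ t) {S : ℝ} (hS0 : 0 ≤ S) (hS : ENNReal.ofReal S < T) {h : E n → ℝ}
    (hh : Continuous h) (hh0 : ∀ x, 0 ≤ h x) :
    ENNReal.ofReal (∫ t in (0 : ℝ)..S, θ t * ∫ x, |w t x| ^ r * h x)
      = ∫⁻ t in Ioc 0 S, ∫⁻ x, ‖w t x‖ₑ ^ r * ENNReal.ofReal (θ t * h x) := by
  obtain ⟨ζ, hζ1, hζ2, hζ3⟩ := exists_spatial_cutoff n (S + R)
  obtain ⟨ρ, hρ⟩ : ∃ ρ, tsupport (fun x => ζ x * h x) ⊆ Metric.closedBall 0 ρ :=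
    (HasCompactSupport.mul_right hζ2 : HasCompactSupport fun x => ζ x * h x).isBounded.subset_closedBall 0
  have hζh : Continuous fun x => ζ x * h x := hζ1.continuous.mul hh
  obtain ⟨M, hM⟩ := hζh.bounded_above_of_compact_support (HasCompactSupport.mul_right hζ2)
  have hint : IntervalIntegrable (fun t => θ t * ∫ x, |w t x| ^ r * h x) volume 0 S := by
    refine (intervalIntegrable_mul_integral_rpow hr hw hL hθ hS0 hS hζh
      (fun x hx => eq_zero_of_tsupport_subset hρ hx) hM).congr ?_
    rw [uIoc_of_le hS0]
    intro t ht
    beta_reduce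
    congr 1
    refine integral_congr_ae ?_
    filter_upwards [hFw.ae_eq_zero hS (Ioc_subset_Icc_self ht)] with x hx
    by_cases hxρ : S + R < ‖x‖
    · simp [hx hxρ, Real.zero_rpow hr.ne']
    · rw [(hζ3 x (not_lt.1 hxρ)).eq_of_nhds, one_mul]
  rw [intervalIntegral.integral_of_le hS0, ofReal_integral_eq_lintegral_ofReal hint.1
    (ae_of_all _ fun t => mul_nonneg (hθ0 t) (integral_nonneg fun x =>
      mul_nonneg (Real.rpow_nonneg (abs_nonneg _) _) (hh0 x)))]
  refine lintegral_congr_ae ?_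
  filter_upwards [ae_integrable_rpow hr hw hL hS hS0 (S + R),
    ae_restrict_mem measurableSet_Ioc] with t ht ht'
  rw [← integral_const_mul, ofReal_integral_eq_lintegral_ofReal
    ((hFw.integrable_rpow_mul hr hS (Ioc_subset_Icc_self ht') ht hh).const_mul _)
    (ae_of_all _ fun x => mul_nonneg (hθ0 t)
      (mul_nonneg (Real.rpow_nonneg (abs_nonneg _) _) (hh0 x)))]
  refine lintegral_congr fun x => ?_
  rw [enorm_rpow_eq hr.le, ← ENNReal.ofReal_mul (Real.rpow_nonneg (abs_nonneg _) _)]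
  congr 1
  ring

/-- The right-hand side of the separated identity as one iterated integral. -/
theorem IsEnergyClass.integral_combine (hE : IsEnergyClass T u ut gu) (hF : FiniteSpeed T R u)
    {S : ℝ} (hS0 : 0 ≤ S) (hS : ENNReal.ofReal S < T) {a b c : ℝ → ℝ} (ha : Continuous a)
    (hb : Continuous b) (hc : Continuous c) {f g h : E n → ℝ} (hf : Continuous f)
    (hg : Continuous g) (hh : Continuous h) :
    IntervalIntegrable (fun t => ∫ x, u t x * (a t * f x - b t * g x + c t * h x)) volume 0 S ∧
    (∫ t in (0 : ℝ)..S, a t * ∫ x, u t x * f x) - (∫ t in (0 : ℝ)..S, b t * ∫ x, u t x * g x)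
        + (∫ t in (0 : ℝ)..S, c t * ∫ x, u t x * h x)
      = ∫ t in (0 : ℝ)..S, ∫ x, u t x * (a t * f x - b t * g x + c t * h x) := by
  have key : ∀ (a : ℝ → ℝ) (f : E n → ℝ), Continuous a → Continuous f →
      IntervalIntegrable (fun t => a t * ∫ x, u t x * f x) volume 0 S := fun a f ha hf => by
    refine ContinuousOn.intervalIntegrable ?_
    rw [uIcc_of_le hS0]
    exact ha.continuousOn.mul (hE.continuousOn_pairing_of_finiteSpeed hF hS hf)
  have h1 : ∀ t ∈ uIcc 0 S, a t * (∫ x, u t x * f x) - b t * (∫ x, u t x * g x)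
      + c t * (∫ x, u t x * h x) = ∫ x, u t x * (a t * f x - b t * g x + c t * h x) := by
    intro t ht
    rw [uIcc_of_le hS0] at ht
    have hi : ∀ f : E n → ℝ, Continuous f → Integrable fun x => u t x * f x := fun f hf =>
      integrable_mul_of_support (hF.ae_eq_zero hS ht) hf
    have hfg : Integrable fun x => a t * (u t x * f x) - b t * (u t x * g x) :=
      ((hi f hf).const_mul _).sub ((hi g hg).const_mul _)
    rw [← integral_const_mul, ← integral_const_mul, ← integral_const_mul,
      ← integral_sub ((hi f hf).const_mul _) ((hi g hg).const_mul _),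
      ← integral_add hfg ((hi h hh).const_mul _)]
    refine integral_congr_ae (ae_of_all _ fun x => ?_)
    beta_reduce
    ring
  constructor
  · refine (((key a f ha hf).sub (key b g hb hg)).add (key c h hc hh)).congr ?_
    intro t ht
    exact h1 t (uIoc_subset_uIcc ht)
  · rw [← intervalIntegral.integral_sub (key a f ha hf) (key b g hb hg),
      ← intervalIntegral.integral_add ((key a f ha hf).sub (key b g hb hg)) (key c h hc hh)]
    exact intervalIntegral.integral_congr h1

/-- `u` is one component of a weak solution, driven by the other component `w`: it solves
`u_tt - Δu + D u_t + V u = |w|^p` weakly on `[0, T)` with data `(ε f₀, ε g₀)`. -/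
def IsComponent (T : ℝ≥0∞) (D V : E n → ℝ) (p ε R : ℝ) (f₀ g₀ : E n → ℝ) (u w : ℝ → L2 n) : Prop :=
  ContinuousOn w (timeInterval T) ∧ FiniteSpeed T R u ∧ FiniteSpeed T R w ∧ IsLocLp T p w ∧
  ∃ (ut : ℝ → L2 n) (gu : ℝ → L2Vec n), IsEnergyClass T u ut gu ∧ AttainsData ε f₀ g₀ u ut ∧
    WeakEquation T D V p ε f₀ g₀ u ut gu w

/-- The real form of the basic identity: the separated identities with factors `e^{-λt} a(t)`,
`φ` and `e^{-λt} a'(t)`, `φψ` are added. The corrector `φψ` is chosen so that the terms with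
`D φ` cancel. -/
theorem IsComponent.exists_identity (hC : IsComponent T D V p ε R f₀ g₀ u w) (hn : 1 ≤ n)
    (hp : 0 < p) (hdata : IsData f₀ g₀ R) {Dp Vp φ ψ : ℝ → ℝ}
    (hD : ∀ x, D x = Dp ‖x‖) (hV : ∀ x, V x = Vp ‖x‖) (hDc : Continuous Dp) (hVc : Continuous Vp)
    {lam : ℝ}
    (hφ : IsRadialSolution n φ (fun r => (lam ^ 2 + lam * Dp r + Vp r) * φ r))
    (hψ : IsRadialSolution n (fun r => φ r * ψ r)
      (fun r => (lam ^ 2 + lam * Dp r + Vp r) * (φ r * ψ r) - Dp r * φ r))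
    {a a₁ a₂ a₃ : ℝ → ℝ} (ha : ContDiff ℝ (⊤ : ℕ∞) a) (ha' : ContDiff ℝ (⊤ : ℕ∞) a₁)
    (d₁ : ∀ t, HasDerivAt a (a₁ t) t) (d₂ : ∀ t, HasDerivAt a₁ (a₂ t) t)
    (d₃ : ∀ t, HasDerivAt a₂ (a₃ t) t) (hc₃ : Continuous a₃) {S : ℝ} (hS0 : 0 ≤ S)
    (hS : ENNReal.ofReal S < T) (haS : ∀ t, S ≤ t → a t = 0) (h0 : a 0 = 1) (h1 : a₁ 0 = 0)
    (h2 : a₂ 0 = 0) :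
    ε * (∫ x, g₀ x * φ ‖x‖) + ε * (∫ x, f₀ x * (D x * φ ‖x‖)) + ε * lam * (∫ x, f₀ x * φ ‖x‖)
        + (∫ t in (0 : ℝ)..S, (Real.exp (-lam * t) * a t) * ∫ x, |w t x| ^ p * φ ‖x‖)
        + (∫ t in (0 : ℝ)..S, (Real.exp (-lam * t) * a₁ t) *
            ∫ x, |w t x| ^ p * (φ ‖x‖ * ψ ‖x‖))
      = ∫ t in (0 : ℝ)..S, ∫ x, u t x * (Real.exp (-lam * t) * φ ‖x‖ *
          ((a₂ t - 2 * lam * a₁ t)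
            + ψ ‖x‖ * (a₃ t - 2 * lam * a₂ t - D x * a₂ t))) := by
  obtain ⟨hw, hFu, hFw, hL, ut, gu, hE, hA, hW⟩ := hC
  obtain rfl : D = fun x => Dp ‖x‖ := funext hD
  obtain rfl : V = fun x => Vp ‖x‖ := funext hV
  have he : ∀ t, HasDerivAt (fun t => Real.exp (-lam * t)) (-lam * Real.exp (-lam * t)) t :=
    fun t => by
      have := ((hasDerivAt_id t).const_mul (-lam)).exp
      simpa [mul_comm] using this
  have hec : ContDiff ℝ (⊤ : ℕ∞) fun t => Real.exp (-lam * t) := by fun_prop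
  have hc0 : Continuous a := ha.continuous
  have hc1 : Continuous a₁ := ha'.continuous
  have hc2 : Continuous a₂ := continuous_iff_continuousAt.2 fun t => (d₃ t).continuousAt
  have haS1 := deriv_eq_zero_of_eqOn_Ici d₁ haS
  have hφc : Continuous fun x : E n => φ ‖x‖ := hφ.continuous.comp continuous_norm
  have hχc : Continuous fun x : E n => φ ‖x‖ * ψ ‖x‖ := hψ.continuous.comp continuous_norm
  have hDc' : Continuous fun x : E n => Dp ‖x‖ := hDc.comp continuous_norm
  have hVc' : Continuous fun x : E n => Vp ‖x‖ := hVc.comp continuous_norm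
  have q1 : Continuous fun x : E n => (lam ^ 2 + lam * Dp ‖x‖ + Vp ‖x‖) * φ ‖x‖ :=
    hφ.continuous_rhs.comp continuous_norm
  have q2 : Continuous fun x : E n =>
      (lam ^ 2 + lam * Dp ‖x‖ + Vp ‖x‖) * (φ ‖x‖ * ψ ‖x‖) - Dp ‖x‖ * φ ‖x‖ :=
    hψ.continuous_rhs.comp continuous_norm
  have r1 : Continuous fun x : E n => Dp ‖x‖ * φ ‖x‖ := hDc'.mul hφc
  have r2 : Continuous fun x : E n => Dp ‖x‖ * (φ ‖x‖ * ψ ‖x‖) := hDc'.mul hχc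
  have s1 : Continuous fun x : E n =>
      Vp ‖x‖ * φ ‖x‖ - (lam ^ 2 + lam * Dp ‖x‖ + Vp ‖x‖) * φ ‖x‖ := (hVc'.mul hφc).sub q1
  have s2 : Continuous fun x : E n => Vp ‖x‖ * (φ ‖x‖ * ψ ‖x‖)
      - ((lam ^ 2 + lam * Dp ‖x‖ + Vp ‖x‖) * (φ ‖x‖ * ψ ‖x‖) - Dp ‖x‖ * φ ‖x‖) :=
    (hVc'.mul hχc).sub q2
  have i1 := hW.separated hp hE hA hw hL hDc' hVc' hdata hFu hFw
    (θ := fun t => Real.exp (-lam * t) * a t)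
    (θ₁ := fun t => Real.exp (-lam * t) * (a₁ t - lam * a t))
    (θ₂ := fun t => Real.exp (-lam * t) * (a₂ t - 2 * lam * a₁ t + lam ^ 2 * a t))
    (hec.mul ha) (fun t => ((he t).mul (d₁ t)).congr_deriv (by ring))
    (fun t => ((he t).mul ((d₂ t).sub ((d₁ t).const_mul lam))).congr_deriv
      (by simp only [Pi.sub_apply]; ring))
    (by fun_prop) hS0 hS (fun t ht => by simp [haS t ht]) (hφ.contDiff_norm hn)
  have i2 := hW.separated hp hE hA hw hL hDc' hVc' hdata hFu hFw
    (θ := fun t => Real.exp (-lam * t) * a₁ t)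
    (θ₁ := fun t => Real.exp (-lam * t) * (a₂ t - lam * a₁ t))
    (θ₂ := fun t => Real.exp (-lam * t) * (a₃ t - 2 * lam * a₂ t + lam ^ 2 * a₁ t))
    (hec.mul ha') (fun t => ((he t).mul (d₂ t)).congr_deriv (by ring))
    (fun t => ((he t).mul ((d₃ t).sub ((d₂ t).const_mul lam))).congr_deriv
      (by simp only [Pi.sub_apply]; ring))
    (by fun_prop) hS0 hS (fun t ht => by simp [haS1 t ht]) (hψ.contDiff_norm hn)
  simp only [hφ.lap_norm hn, hψ.lap_norm hn] at i1 i2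
  obtain ⟨j1, k1⟩ := hE.integral_combine hFu hS0 hS
    (a := fun t => Real.exp (-lam * t) * (a₂ t - 2 * lam * a₁ t + lam ^ 2 * a t))
    (b := fun t => Real.exp (-lam * t) * (a₁ t - lam * a t))
    (c := fun t => Real.exp (-lam * t) * a t) (by fun_prop) (by fun_prop) (by fun_prop)
    hφc r1 s1
  obtain ⟨j2, k2⟩ := hE.integral_combine hFu hS0 hS
    (a := fun t => Real.exp (-lam * t) * (a₃ t - 2 * lam * a₂ t + lam ^ 2 * a₁ t))
    (b := fun t => Real.exp (-lam * t) * (a₂ t - lam * a₁ t))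
    (c := fun t => Real.exp (-lam * t) * a₁ t) (by fun_prop) (by fun_prop) (by fun_prop)
    hχc r2 s2
  rw [k1] at i1
  rw [k2] at i2
  simp only [h0, h1, h2, mul_zero, Real.exp_zero, mul_one, sub_zero, zero_sub, zero_mul] at i1 i2
  have hsum := intervalIntegral.integral_add j1 j2
  rw [← i1, ← i2] at hsum
  refine Eq.trans ?_ (hsum.symm.trans ?_)
  · ring
  · refine intervalIntegral.integral_congr fun t ht => ?_
    rw [uIcc_of_le hS0] at ht
    beta_reduce
    have hi : ∀ f : E n → ℝ, Continuous f → Integrable fun x => u t x * f x := fun f hf =>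
      integrable_mul_of_support (hFu.ae_eq_zero hS ht) hf
    rw [← integral_add]
    · refine integral_congr_ae (ae_of_all _ fun x => ?_)
      beta_reduce
      ring
    · exact hi _ (((continuous_const.mul hφc).sub (continuous_const.mul r1)).add
        (continuous_const.mul s1))
    · exact hi _ (((continuous_const.mul hχc).sub (continuous_const.mul r2)).add
        (continuous_const.mul s2))

end

section

variable {n : ℕ} {T : ℝ≥0∞} {D V : E n → ℝ} {p ε R : ℝ} {f₀ g₀ : E n → ℝ} {u w : ℝ → L2 n}

theorem integral_le_integral_mul {f h : E n → ℝ} (hf : Continuous f) (hc : HasCompactSupport f)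
    (hf0 : ∀ x, 0 ≤ f x) (hh : Continuous h) (h1 : ∀ x, 1 ≤ h x) :
    ∫ x, f x ≤ ∫ x, f x * h x :=
  integral_mono (hf.integrable_of_hasCompactSupport hc)
    ((hf.mul hh).integrable_of_hasCompactSupport hc.mul_right)
    fun x => le_mul_of_one_le_right (hf0 x) (h1 x)

/-- The pointwise bound on the factor that multiplies `u`. Every term is of size `λ/τ` because
`1/τ ≤ λ`, `|ψ| ≤ α r ≤ 2 α τ` and `d r ≤ α`. -/
theorem abs_kernel_le {α C Zs τ lam r d ψ z₁ z₂ z₃ : ℝ} (hα : 0 ≤ α) (hτ : 0 < τ)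
    (hlam : 0 < lam) (hτlam : 1 ≤ τ * lam) (hr : 0 ≤ r) (hrτ : r ≤ 2 * τ) (hd0 : 0 ≤ d)
    (hdr : d * r ≤ α) (hψ : |ψ| ≤ α * r) (h₁ : |z₁| ≤ C * Zs) (h₂ : |z₂| ≤ C * Zs)
    (h₃ : |z₃| ≤ C * Zs) :
    |(z₂ / τ ^ 2 - 2 * lam * (z₁ / τ)) + ψ * (z₃ / τ ^ 3 - 2 * lam * (z₂ / τ ^ 2)
      - d * (z₂ / τ ^ 2))| ≤ C * (3 + 6 * α + α ^ 2) * (lam / τ) * Zs := by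
  obtain ⟨B, hB⟩ : ∃ B, B = C * Zs := ⟨_, rfl⟩
  rw [← hB] at h₁ h₂ h₃
  have hB0 : 0 ≤ B := (abs_nonneg _).trans h₁
  have hl : 1 / τ ≤ lam := by rw [div_le_iff₀ hτ]; linarith
  have e2 : B / τ ^ 2 ≤ B * (lam / τ) := by
    calc B / τ ^ 2 = B * (1 / τ / τ) := by field_simp
      _ ≤ B * (lam / τ) := by gcongr
  have t1 : |z₂ / τ ^ 2| ≤ B * (lam / τ) := by
    rw [abs_div, abs_of_pos (by positivity : 0 < τ ^ 2)]
    exact le_trans (by gcongr) e2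
  have t2 : |2 * lam * (z₁ / τ)| ≤ 2 * B * (lam / τ) := by
    rw [abs_mul, abs_div, abs_of_pos hτ, abs_of_pos (by positivity : 0 < 2 * lam)]
    calc 2 * lam * (|z₁| / τ) ≤ 2 * lam * (B / τ) := by gcongr
      _ = _ := by ring
  have hψ2 : |ψ| ≤ α * (2 * τ) := hψ.trans (by gcongr)
  have t3 : |ψ * (z₃ / τ ^ 3)| ≤ 2 * α * (B * (lam / τ)) := by
    rw [abs_mul, abs_div, abs_of_pos (by positivity : 0 < τ ^ 3)]
    calc |ψ| * (|z₃| / τ ^ 3) ≤ α * (2 * τ) * (B / τ ^ 3) := by gcongr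
      _ = 2 * α * (B / τ ^ 2) := by field_simp
      _ ≤ _ := by gcongr
  have t4 : |ψ * (2 * lam * (z₂ / τ ^ 2))| ≤ 4 * α * (B * (lam / τ)) := by
    rw [abs_mul, abs_mul, abs_div, abs_of_pos (by positivity : 0 < τ ^ 2),
      abs_of_pos (by positivity : 0 < 2 * lam)]
    calc |ψ| * (2 * lam * (|z₂| / τ ^ 2)) ≤ α * (2 * τ) * (2 * lam * (B / τ ^ 2)) := by gcongr
      _ = _ := by field_simp; ring
  have t5 : |ψ * (d * (z₂ / τ ^ 2))| ≤ α ^ 2 * (B * (lam / τ)) := by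
    rw [abs_mul, abs_mul, abs_div, abs_of_pos (by positivity : 0 < τ ^ 2), abs_of_nonneg hd0]
    calc |ψ| * (d * (|z₂| / τ ^ 2)) ≤ α * r * (d * (B / τ ^ 2)) := by gcongr
      _ = α * (d * r) * (B / τ ^ 2) := by ring
      _ ≤ α * α * (B * (lam / τ)) := by gcongr
      _ = _ := by ring
  have hsplit : (z₂ / τ ^ 2 - 2 * lam * (z₁ / τ)) + ψ * (z₃ / τ ^ 3 - 2 * lam * (z₂ / τ ^ 2)
      - d * (z₂ / τ ^ 2)) = z₂ / τ ^ 2 - 2 * lam * (z₁ / τ) + ψ * (z₃ / τ ^ 3)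
      - ψ * (2 * lam * (z₂ / τ ^ 2)) - ψ * (d * (z₂ / τ ^ 2)) := by ring
  have hfin : C * (3 + 6 * α + α ^ 2) * (lam / τ) * Zs = B * (lam / τ) + 2 * B * (lam / τ)
      + 2 * α * (B * (lam / τ)) + 4 * α * (B * (lam / τ)) + α ^ 2 * (B * (lam / τ)) := by
    rw [hB]; ring
  rw [hsplit, hfin]
  rw [abs_le] at *
  constructor <;> linarith [t1.1, t1.2, t2.1, t2.2, t3.1, t3.2, t4.1, t4.2, t5.1, t5.2]

/-- Testing with the cutoff at time `τ` of `e^{-λt} φ_λ`: the data and the nonlinearity are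
controlled by the solution on the dyadic window `(τ/2, τ]`, with a gain `λ/τ`. -/
theorem IsComponent.basic_inequality (hC : IsComponent T D V p ε R f₀ g₀ u w) (hn : 1 ≤ n)
    (hp : 0 < p) (hε : 0 ≤ ε) (hdata : IsData f₀ g₀ R) {Dp Vp φ ψ : ℝ → ℝ}
    (hD : ∀ x, D x = Dp ‖x‖) (hV : ∀ x, V x = Vp ‖x‖) {α β ω : ℝ}
    (hP : IsProfilePair Dp Vp α β ω) {lam : ℝ} (hlam : 0 < lam) (hφ1 : ∀ r, 1 ≤ φ r)
    (hψl : ∀ r, 0 ≤ r → -(α * r) ≤ ψ r) (hψ0 : ∀ r, 0 ≤ r → ψ r ≤ 0)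
    (hφ : IsRadialSolution n φ (fun r => (lam ^ 2 + lam * Dp r + Vp r) * φ r))
    (hψ : IsRadialSolution n (fun r => φ r * ψ r)
      (fun r => (lam ^ 2 + lam * Dp r + Vp r) * (φ r * ψ r) - Dp r * φ r))
    {s C : ℝ} {Z Z₁ Z₂ Z₃ : ℝ → ℝ} (hZ : IsTimeCutoff s C Z Z₁ Z₂ Z₃) {τ : ℝ} (hτ : 0 < τ)
    (hRτ : R ≤ τ) (hτlam : 1 ≤ τ * lam) (hτT : ENNReal.ofReal τ < T) :
    ENNReal.ofReal (ε * ((∫ x, g₀ x) + lam * ∫ x, f₀ x))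
        + ∫⁻ t in Ioc 0 τ, ∫⁻ x, ‖w t x‖ₑ ^ p *
          ENNReal.ofReal (Z (t / τ) * (Real.exp (-lam * t) * φ ‖x‖))
      ≤ ENNReal.ofReal (C * (3 + 6 * α + α ^ 2) * (lam / τ)) *
          ∫⁻ t in Ioc (τ / 2) τ, ∫⁻ x, ‖u t x‖ₑ *
            ENNReal.ofReal (Z (t / τ) ^ s * (Real.exp (-lam * t) * φ ‖x‖)) := by
  have hα := hP.alpha_nonneg
  have hdiv : ∀ t : ℝ, HasDerivAt (fun t => t / τ) (1 / τ) t := fun t =>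
    (hasDerivAt_id t).div_const τ
  have hdc : ContDiff ℝ (⊤ : ℕ∞) fun t : ℝ => t / τ := by fun_prop
  have hid := hC.exists_identity hn hp hdata hD hV hP.continuous_D hP.continuous_V hφ hψ
    (a := fun t => Z (t / τ)) (a₁ := fun t => Z₁ (t / τ) / τ) (a₂ := fun t => Z₂ (t / τ) / τ ^ 2)
    (a₃ := fun t => Z₃ (t / τ) / τ ^ 3) (hZ.contDiff.comp hdc) ((hZ.contDiff₁.comp hdc).div_const τ)
    (fun t => ((hZ.deriv₁ _).comp t (hdiv t)).congr_deriv (by field_simp))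
    (fun t => (((hZ.deriv₂ _).comp t (hdiv t)).div_const τ).congr_deriv (by field_simp))
    (fun t => (((hZ.deriv₃ _).comp t (hdiv t)).div_const (τ ^ 2)).congr_deriv (by field_simp))
    ((hZ.continuous₃.comp hdc.continuous).div_const _) hτ.le hτT
    (fun t ht => hZ.eq_zero _ (by rwa [one_le_div hτ]))
    (by rw [zero_div]; exact hZ.eq_one 0 (by norm_num))
    (by rw [zero_div, hZ.eq_zero₁ 0 (by norm_num), zero_div])
    (by rw [zero_div, hZ.eq_zero₂ 0 (by norm_num), zero_div])
  obtain ⟨hw, hFu, hFw, hL, -⟩ := hC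
  have hφc : Continuous fun x : E n => φ ‖x‖ := hφ.continuous.comp continuous_norm
  have hcs₀ : HasCompactSupport f₀ :=
    (isCompact_closedBall (0 : E n) R).of_isClosed_subset (isClosed_tsupport _) hdata.support_left
  have hcs₁ : HasCompactSupport g₀ :=
    (isCompact_closedBall (0 : E n) R).of_isClosed_subset (isClosed_tsupport _) hdata.support_right
  have hφ0 : ∀ r, 0 ≤ φ r := fun r => zero_le_one.trans (hφ1 r)
  have b1 : ∫ x, g₀ x ≤ ∫ x, g₀ x * φ ‖x‖ := integral_le_integral_mul
    hdata.smooth_right.continuous hcs₁ hdata.nonneg_right hφc fun x => hφ1 _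
  have b2 : ∫ x, f₀ x ≤ ∫ x, f₀ x * φ ‖x‖ := integral_le_integral_mul
    hdata.smooth_left.continuous hcs₀ hdata.nonneg_left hφc fun x => hφ1 _
  have b3 : 0 ≤ ∫ x, f₀ x * (D x * φ ‖x‖) := integral_nonneg fun x =>
    mul_nonneg (hdata.nonneg_left x) (mul_nonneg (by rw [hD]; exact hP.D_nonneg _) (hφ0 _))
  -- the nonlinear term of the corrector has a sign because `Z' ≤ 0` and `ψ ≤ 0`
  have b4 : 0 ≤ ∫ t in (0 : ℝ)..τ, (Real.exp (-lam * t) * (Z₁ (t / τ) / τ)) *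
      ∫ x, |w t x| ^ p * (φ ‖x‖ * ψ ‖x‖) :=
    intervalIntegral.integral_nonneg hτ.le fun t _ => mul_nonneg_of_nonpos_of_nonpos
      (mul_nonpos_of_nonneg_of_nonpos (Real.exp_nonneg _)
        (div_nonpos_of_nonpos_of_nonneg (hZ.nonpos₁ _) hτ.le))
      (integral_nonpos fun x => mul_nonpos_of_nonneg_of_nonpos
        (Real.rpow_nonneg (abs_nonneg _) _)
        (mul_nonpos_of_nonneg_of_nonpos (hφ0 _) (hψ0 _ (norm_nonneg x))))
  have b5 : 0 ≤ ∫ t in (0 : ℝ)..τ, (Real.exp (-lam * t) * Z (t / τ)) *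
      ∫ x, |w t x| ^ p * φ ‖x‖ :=
    intervalIntegral.integral_nonneg hτ.le fun t _ => mul_nonneg
      (mul_nonneg (Real.exp_nonneg _) (hZ.nonneg _))
      (integral_nonneg fun x => mul_nonneg (Real.rpow_nonneg (abs_nonneg _) _) (hφ0 _))
  have hdat0 : 0 ≤ ε * ((∫ x, g₀ x) + lam * ∫ x, f₀ x) := mul_nonneg hε (add_nonneg
    (integral_nonneg hdata.nonneg_right) (mul_nonneg hlam.le (integral_nonneg hdata.nonneg_left)))
  have hN : ∫⁻ t in Ioc 0 τ, ∫⁻ x, ‖w t x‖ₑ ^ p *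
          ENNReal.ofReal (Z (t / τ) * (Real.exp (-lam * t) * φ ‖x‖))
      = ENNReal.ofReal (∫ t in (0 : ℝ)..τ, (Real.exp (-lam * t) * Z (t / τ)) *
          ∫ x, |w t x| ^ p * φ ‖x‖) := by
    rw [hFw.ofReal_integral_rpow hp hw hL (θ := fun t => Real.exp (-lam * t) * Z (t / τ))
      (by have := hZ.contDiff.continuous; fun_prop)
      (fun t => mul_nonneg (Real.exp_nonneg _) (hZ.nonneg _)) hτ.le hτT hφc fun x => hφ0 _]
    refine lintegral_congr fun t => lintegral_congr fun x => ?_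
    congr 2
    ring
  rw [hN, ← ENNReal.ofReal_add hdat0 b5]
  refine (ENNReal.ofReal_le_ofReal (le_trans ?_ hid.le)).trans
    ((Real.ofReal_le_enorm _).trans ?_)
  · have c1 := mul_le_mul_of_nonneg_left b1 hε
    have c2 := mul_le_mul_of_nonneg_left b2 (mul_nonneg hε hlam.le)
    have c3 := mul_nonneg hε b3
    linarith
  rw [intervalIntegral.integral_of_le hτ.le]
  refine (enorm_integral_le_lintegral_enorm _).trans ?_
  rw [← lintegral_const_mul' _ _ ENNReal.ofReal_ne_top]
  have hsub : Ioc (τ / 2) τ ⊆ Ioc 0 τ := Ioc_subset_Ioc_left (by positivity)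
  calc _ ≤ ∫⁻ t in Ioc 0 τ, (Ioc (τ / 2) τ).indicator (fun t =>
          ENNReal.ofReal (C * (3 + 6 * α + α ^ 2) * (lam / τ)) * ∫⁻ x, ‖u t x‖ₑ *
            ENNReal.ofReal (Z (t / τ) ^ s * (Real.exp (-lam * t) * φ ‖x‖))) t := by
        refine lintegral_mono_ae ?_
        filter_upwards [ae_restrict_mem measurableSet_Ioc] with t ht
        by_cases htτ : t ≤ τ / 2
        · have h2 : t / τ ≤ 1 / 2 := by rw [div_le_iff₀ hτ]; linarith
          simp [hZ.eq_zero₁ _ h2, hZ.eq_zero₂ _ h2, hZ.eq_zero₃ _ h2]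
        · rw [indicator_of_mem (show t ∈ Ioc (τ / 2) τ from ⟨not_le.1 htτ, ht.2⟩)]
          refine (enorm_integral_le_lintegral_enorm _).trans ?_
          rw [← lintegral_const_mul' _ _ ENNReal.ofReal_ne_top]
          refine lintegral_mono_ae ?_
          filter_upwards [hFu.ae_eq_zero hτT (Ioc_subset_Icc_self ht)] with x hx
          by_cases hxτ : τ + R < ‖x‖
          · simp [hx hxτ]
          rw [enorm_mul, mul_left_comm, ← ENNReal.ofReal_mul' (mul_nonneg
            (Real.rpow_nonneg (hZ.nonneg _) _) (mul_nonneg (Real.exp_nonneg _) (hφ0 _)))]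
          gcongr
          rw [← ofReal_norm, Real.norm_eq_abs, abs_mul,
            abs_of_nonneg (mul_nonneg (Real.exp_nonneg _) (hφ0 _))]
          refine ENNReal.ofReal_le_ofReal ?_
          have hr := norm_nonneg x
          have hdr : D x * ‖x‖ ≤ α := by
            rw [hD]
            have h1 := hP.D_le_inv hr
            rw [Real.rpow_neg_one] at h1
            calc Dp ‖x‖ * ‖x‖ ≤ α * (1 + ‖x‖)⁻¹ * (1 + ‖x‖) := by
                  gcongr
                  linarith
              _ = α := by field_simp
          have hk := abs_kernel_le (lam := lam) (ψ := ψ ‖x‖) hα hτ hlam hτlam hr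
            (by linarith [not_lt.1 hxτ]) (by rw [hD]; exact hP.D_nonneg _) hdr
            (by rw [abs_of_nonpos (hψ0 _ hr)]; linarith [hψl _ hr])
            (hZ.bound₁ (t / τ)) (hZ.bound₂ (t / τ)) (hZ.bound₃ (t / τ))
          calc _ ≤ Real.exp (-lam * t) * φ ‖x‖ * _ :=
                mul_le_mul_of_nonneg_left hk (mul_nonneg (Real.exp_nonneg _) (hφ0 _))
            _ = _ := by ring
    _ = _ := by
        rw [lintegral_indicator measurableSet_Ioc, Measure.restrict_restrict measurableSet_Ioc,
          inter_eq_left.2 hsub]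

end

section

/-! ### Hölder's inequality on a dyadic window -/

variable {n : ℕ} {T : ℝ≥0∞} {R : ℝ} {u : ℝ → L2 n}

/-- A function of the distance to the boundary of a large ball is integrated as in one dimension,
at the cost of the factor `ρ^(n-1)`. -/
theorem exists_lintegral_closedBall_le (n : ℕ) (hn : 1 ≤ n) :
    ∃ c : ℝ, 0 ≤ c ∧ ∀ (ρ : ℝ) (h : ℝ → ℝ), 0 ≤ ρ → Continuous h → (∀ σ, 0 ≤ h σ) →
      ∫⁻ x in Metric.closedBall (0 : E n) ρ, ENNReal.ofReal (h (ρ - ‖x‖))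
        ≤ ENNReal.ofReal (c * ρ ^ (n - 1) * ∫ σ in (0 : ℝ)..ρ, h σ) := by
  have : Nonempty (Fin n) := ⟨⟨0, hn⟩⟩
  refine ⟨n * volume.real (Metric.ball (0 : E n) 1), by positivity, fun ρ h hρ hh h0 => ?_⟩
  have hcont : Continuous fun x : E n => h (ρ - ‖x‖) := by fun_prop
  have hcont' : Continuous fun y : ℝ => h (ρ - y) := by fun_prop
  rw [← ofReal_integral_eq_lintegral_ofReal
    (hcont.continuousOn.integrableOn_compact (isCompact_closedBall _ _)) (ae_of_all _ fun x => h0 _)]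
  refine ENNReal.ofReal_le_ofReal ?_
  have h1 : ∫ x in Metric.closedBall (0 : E n) ρ, h (ρ - ‖x‖)
      = ∫ x : E n, (Iic ρ).indicator (fun y => h (ρ - y)) ‖x‖ := by
    rw [← integral_indicator Metric.isClosed_closedBall.measurableSet]
    refine integral_congr_ae (ae_of_all _ fun x => ?_)
    by_cases hx : ‖x‖ ≤ ρ <;> simp [indicator, hx]
  rw [h1, integral_fun_norm_addHaar]
  simp only [finrank_euclideanSpace, Fintype.card_fin, nsmul_eq_mul, smul_eq_mul]
  have h2 : ∫ y in Ioi (0 : ℝ), y ^ (n - 1) * (Iic ρ).indicator (fun y => h (ρ - y)) y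
      = ∫ y in (0 : ℝ)..ρ, y ^ (n - 1) * h (ρ - y) := by
    rw [intervalIntegral.integral_of_le hρ, ← Ioi_inter_Iic, inter_comm,
      ← Measure.restrict_restrict measurableSet_Iic, ← integral_indicator measurableSet_Iic]
    refine integral_congr_ae (ae_of_all _ fun x => ?_)
    by_cases hx : x ≤ ρ <;> simp [indicator, hx]
  have h3 : ∫ y in (0 : ℝ)..ρ, y ^ (n - 1) * h (ρ - y) ≤ ρ ^ (n - 1) * ∫ σ in (0 : ℝ)..ρ, h σ := by
    have h4 : ∫ σ in (0 : ℝ)..ρ, h σ = ∫ y in (0 : ℝ)..ρ, h (ρ - y) := by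
      rw [intervalIntegral.integral_comp_sub_left h ρ]; simp
    rw [h4, ← intervalIntegral.integral_const_mul]
    refine intervalIntegral.integral_mono_on hρ (Continuous.intervalIntegrable (by fun_prop) _ _)
      (Continuous.intervalIntegrable (by fun_prop) _ _) fun y hy => ?_
    exact mul_le_mul_of_nonneg_right (pow_le_pow_left₀ hy.1 hy.2 _) (h0 _)
  rw [h2]
  calc _ ≤ (n : ℝ) * (volume.real (Metric.ball (0 : E n) 1) *
        (ρ ^ (n - 1) * ∫ σ in (0 : ℝ)..ρ, h σ)) := by gcongr
    _ = _ := by ring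

/-- The weighted `L^r` mass of `u` on the dyadic window `(τ/2, τ]`. -/
noncomputable def windowIntegral (Z : ℝ → ℝ) (r : ℝ) (u : ℝ → L2 n) (τ : ℝ) : ℝ≥0∞ :=
  ∫⁻ t in Ioc (τ / 2) τ, ∫⁻ x, ‖u t x‖ₑ ^ r * ENNReal.ofReal (Z (t / τ))

theorem windowIntegral_lt_top {Z : ℝ → ℝ} (hZ : ∀ t, Z t ≤ 1) {r : ℝ} (hr : 0 < r)
    (hF : FiniteSpeed T R u) (hL : IsLocLp T r u) {τ : ℝ} (hτ : 0 < τ)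
    (hτT : ENNReal.ofReal τ < T) : windowIntegral Z r u τ < ∞ := by
  have h1 := hL τ (Icc_subset_timeInterval hτT ⟨hτ.le, le_rfl⟩) _
    (isCompact_closedBall (0 : E n) (τ + R))
  rw [restrict_Ioo_eq_restrict_Ioc] at h1
  refine lt_of_le_of_lt ?_ h1
  have hsub : Ioc (τ / 2) τ ⊆ Ioc 0 τ := Ioc_subset_Ioc_left (by positivity)
  refine le_trans ?_ (lintegral_mono_set hsub)
  refine lintegral_mono_ae ?_
  filter_upwards [ae_restrict_mem measurableSet_Ioc] with t ht
  rw [← lintegral_indicator Metric.isClosed_closedBall.measurableSet]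
  refine lintegral_mono_ae ?_
  filter_upwards [hF.ae_eq_zero hτT (Ioc_subset_Icc_self (hsub ht))] with x hx
  by_cases hxρ : x ∈ Metric.closedBall (0 : E n) (τ + R)
  · rw [indicator_of_mem hxρ]
    exact mul_le_of_le_one_right' (ENNReal.ofReal_le_one.2 (hZ _))
  · rw [hx (by simpa using hxρ)]
    simp [hr]

/-- Hölder's inequality in space and then in time, for a weight dominated by a function of the
distance `t + R - |x|` to the light cone. -/
theorem lintegral_window_le {q q' : ℝ} (hqq : q.HolderConjugate q')
    (hu : ContinuousOn u (timeInterval T)) (hF : FiniteSpeed T R u) (hR : 0 ≤ R) {Z : ℝ → ℝ}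
    (hZc : Continuous Z) (hZ0 : ∀ t, 0 ≤ Z t) (hZ1 : ∀ t, Z t ≤ 1) {s : ℝ} (hs : 1 / q ≤ s)
    {τ : ℝ} (hτ : 0 < τ) (hτT : ENNReal.ofReal τ < T) (hRτ : R ≤ τ) {b : ℝ → E n → ℝ}
    (hb : ∀ t, Continuous (b t)) {A I : ℝ} {h : ℝ → ℝ} (hA : 0 ≤ A) (hh : Continuous h)
    (h0 : ∀ σ, 0 ≤ h σ)
    (hbd : ∀ t ∈ Ioc (τ / 2) τ, ∀ x, ‖x‖ ≤ t + R → b t x ≤ A * h (t + R - ‖x‖))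
    (hI : ∀ ρ, 0 ≤ ρ → ρ ≤ 2 * τ → ∫ σ in (0 : ℝ)..ρ, h σ ^ q' ≤ I) {c : ℝ} (hc0 : 0 ≤ c)
    (hc : ∀ (ρ : ℝ) (h : ℝ → ℝ), 0 ≤ ρ → Continuous h → (∀ σ, 0 ≤ h σ) →
      ∫⁻ x in Metric.closedBall (0 : E n) ρ, ENNReal.ofReal (h (ρ - ‖x‖))
        ≤ ENNReal.ofReal (c * ρ ^ (n - 1) * ∫ σ in (0 : ℝ)..ρ, h σ)) :
    ∫⁻ t in Ioc (τ / 2) τ, ∫⁻ x, ‖u t x‖ₑ * ENNReal.ofReal (Z (t / τ) ^ s * b t x)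
      ≤ ENNReal.ofReal (A * (c * (2 * τ) ^ (n - 1) * I * τ) ^ (1 / q'))
        * windowIntegral Z q u τ ^ (1 / q) := by
  have hq0 := hqq.pos
  have hq0' := hqq.symm.pos
  have hI0 : 0 ≤ I := le_trans (by simp) (hI 0 le_rfl (by positivity))
  obtain ⟨M, hM⟩ : ∃ M, M = c * (2 * τ) ^ (n - 1) * I := ⟨_, rfl⟩
  have hM0 : 0 ≤ M := by rw [hM]; positivity
  obtain ⟨y, hy⟩ : ∃ y : ℝ → ℝ≥0∞, y = fun t =>
    ∫⁻ x, ‖u t x‖ₑ ^ q * ENNReal.ofReal (Z (t / τ)) := ⟨_, rfl⟩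
  have hsub : Ioc (τ / 2) τ ⊆ Icc 0 τ := fun t ht => ⟨by linarith [ht.1], ht.2⟩
  have hym : AEMeasurable y (volume.restrict (Ioc (τ / 2) τ)) := by
    have h1 : AEMeasurable (fun t => ∫⁻ x, ‖u t x‖ₑ ^ q) (volume.restrict (Ioc (τ / 2) τ)) := by
      have := aemeasurable_lintegral_rpow hu q (m := 1) measurable_one
      simp only [Pi.one_apply, mul_one] at this
      exact this.mono_measure (Measure.restrict_mono
        (hsub.trans (Icc_subset_timeInterval hτT)) le_rfl)
    have h2 : Measurable fun t : ℝ => ENNReal.ofReal (Z (t / τ)) := by fun_prop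
    refine (h1.mul h2.aemeasurable).congr (ae_of_all _ fun t => ?_)
    simp only [hy, Pi.mul_apply]
    rw [lintegral_mul_const' _ _ ENNReal.ofReal_ne_top]
  have hZs : ∀ t, Z t ^ s ≤ Z t ^ (1 / q) := fun t => by
    have hq1 : 0 < 1 / q := by positivity
    rcases (hZ0 t).eq_or_lt with h' | h'
    · rw [← h', Real.zero_rpow (hq1.trans_le hs).ne', Real.zero_rpow hq1.ne']
    · exact Real.rpow_le_rpow_of_exponent_ge h' (hZ1 t) hs
  have hinner : ∀ t ∈ Ioc (τ / 2) τ,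
      ∫⁻ x, ‖u t x‖ₑ * ENNReal.ofReal (Z (t / τ) ^ s * b t x)
        ≤ ENNReal.ofReal (A * M ^ (1 / q')) * y t ^ (1 / q) := by
    intro t ht
    have hρ0 : 0 ≤ t + R := by linarith [(hsub ht).1]
    have hρ1 : t + R ≤ 2 * τ := by linarith [ht.2]
    have hball : ∫⁻ x in Metric.closedBall (0 : E n) (t + R), ENNReal.ofReal (b t x) ^ q'
        ≤ ENNReal.ofReal (A ^ q' * M) := by
      calc _ ≤ ∫⁻ x in Metric.closedBall (0 : E n) (t + R),
            ENNReal.ofReal (A ^ q') * ENNReal.ofReal (h (t + R - ‖x‖) ^ q') := by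
            refine setLIntegral_mono_ae' Metric.isClosed_closedBall.measurableSet
              (ae_of_all _ fun x hx => ?_)
            rw [mem_closedBall_zero_iff] at hx
            rw [← ENNReal.ofReal_mul (by positivity), ← Real.mul_rpow hA (h0 _),
              ← ENNReal.ofReal_rpow_of_nonneg (mul_nonneg hA (h0 _)) hq0'.le]
            exact ENNReal.rpow_le_rpow (ENNReal.ofReal_le_ofReal (hbd t ht x hx)) hq0'.le
        _ ≤ ENNReal.ofReal (A ^ q') * ENNReal.ofReal (c * (t + R) ^ (n - 1) *
              ∫ σ in (0 : ℝ)..(t + R), h σ ^ q') := by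
            rw [lintegral_const_mul' _ _ ENNReal.ofReal_ne_top]
            gcongr
            exact hc (t + R) (fun σ => h σ ^ q') hρ0
              (hh.rpow_const fun _ => Or.inr hq0'.le) fun σ => Real.rpow_nonneg (h0 σ) _
        _ ≤ _ := by
            rw [← ENNReal.ofReal_mul (by positivity)]
            refine ENNReal.ofReal_le_ofReal (mul_le_mul_of_nonneg_left ?_ (by positivity))
            rw [hM]
            exact mul_le_mul (mul_le_mul_of_nonneg_left (pow_le_pow_left₀ hρ0 hρ1 _) hc0)
              (hI _ hρ0 hρ1) (intervalIntegral.integral_nonneg hρ0 fun σ _ =>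
                Real.rpow_nonneg (h0 σ) _) (by positivity)
    calc _ ≤ ∫⁻ x, ((fun x => ‖u t x‖ₑ * ENNReal.ofReal (Z (t / τ)) ^ (1 / q)) *
          (Metric.closedBall (0 : E n) (t + R)).indicator fun x => ENNReal.ofReal (b t x)) x := by
          refine lintegral_mono_ae ?_
          filter_upwards [hF t (Icc_subset_timeInterval hτT (hsub ht))] with x hx
          rw [Pi.mul_apply]
          by_cases hxρ : x ∈ Metric.closedBall (0 : E n) (t + R)
          · rw [indicator_of_mem hxρ, ENNReal.ofReal_mul (Real.rpow_nonneg (hZ0 _) _), mul_assoc,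
              ENNReal.ofReal_rpow_of_nonneg (hZ0 _) (by positivity)]
            exact mul_le_mul_right (mul_le_mul_left (ENNReal.ofReal_le_ofReal (hZs _)) _) _
          · rw [hx (by simpa using hxρ)]
            simp
      _ ≤ _ := ENNReal.lintegral_mul_le_Lp_mul_Lq _ hqq
          ((Lp.aestronglyMeasurable (u t)).enorm.mul_const _)
          (((hb t).measurable.ennreal_ofReal).indicator
            Metric.isClosed_closedBall.measurableSet).aemeasurable
      _ ≤ y t ^ (1 / q) * ENNReal.ofReal (A ^ q' * M) ^ (1 / q') := by
          refine mul_le_mul' (le_of_eq ?_) (ENNReal.rpow_le_rpow ?_ (by positivity))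
          · rw [hy]
            congr 1
            refine lintegral_congr fun x => ?_
            rw [ENNReal.mul_rpow_of_nonneg _ _ hq0.le, ← ENNReal.rpow_mul,
              one_div_mul_cancel hq0.ne', ENNReal.rpow_one]
          · refine le_trans (le_of_eq ?_) hball
            rw [← lintegral_indicator Metric.isClosed_closedBall.measurableSet]
            refine lintegral_congr fun x => ?_
            by_cases hx : x ∈ Metric.closedBall (0 : E n) (t + R)
            · simp only [indicator_of_mem hx]
            · simp only [indicator_of_notMem hx, ENNReal.zero_rpow_of_pos hq0']
      _ = _ := by
          rw [mul_comm, ENNReal.ofReal_rpow_of_nonneg (by positivity) (by positivity),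
            Real.mul_rpow (by positivity) hM0, ← Real.rpow_mul hA, mul_one_div_cancel hq0'.ne',
            Real.rpow_one]
  calc _ ≤ ∫⁻ t in Ioc (τ / 2) τ, ENNReal.ofReal (A * M ^ (1 / q')) * y t ^ (1 / q) :=
        setLIntegral_mono_ae' measurableSet_Ioc (ae_of_all _ hinner)
    _ = ENNReal.ofReal (A * M ^ (1 / q')) *
          ∫⁻ t in Ioc (τ / 2) τ, ((fun t => y t ^ (1 / q)) * (fun _ => 1) : ℝ → ℝ≥0∞) t := by
        rw [lintegral_const_mul' _ _ ENNReal.ofReal_ne_top]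
        simp
    _ ≤ ENNReal.ofReal (A * M ^ (1 / q')) *
          ((∫⁻ t in Ioc (τ / 2) τ, (y t ^ (1 / q)) ^ q) ^ (1 / q) *
            (∫⁻ t in Ioc (τ / 2) τ, (1 : ℝ≥0∞) ^ q') ^ (1 / q')) := by
        gcongr
        exact ENNReal.lintegral_mul_le_Lp_mul_Lq _ hqq (hym.pow_const _) aemeasurable_const
    _ ≤ ENNReal.ofReal (A * M ^ (1 / q')) *
          (windowIntegral Z q u τ ^ (1 / q) * ENNReal.ofReal τ ^ (1 / q')) := by
        gcongr
        · refine le_of_eq ?_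
          rw [windowIntegral, hy]
          refine lintegral_congr fun t => ?_
          rw [← ENNReal.rpow_mul, one_div_mul_cancel hq0.ne', ENNReal.rpow_one]
        · simp only [ENNReal.one_rpow, lintegral_const, Measure.restrict_apply MeasurableSet.univ,
            univ_inter, Real.volume_Ioc, one_mul]
          exact ENNReal.ofReal_le_ofReal (by linarith)
    _ = _ := by
        rw [← hM, Real.mul_rpow hM0 hτ.le, ← mul_assoc A,
          ENNReal.ofReal_mul (p := A * M ^ (1 / q')) (by positivity),
          ENNReal.ofReal_rpow_of_nonneg hτ.le (by positivity)]
        ring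

end

/-! ### Weights concentrated near the light cone -/

theorem exists_one_add_rpow_le {μ : ℝ} (hμ : 0 < μ) :
    ∃ K : ℝ, 0 < K ∧ ∀ y : ℝ, 0 ≤ y → (1 + y) ^ μ ≤ K * Real.exp (y / 2) := by
  refine ⟨(2 * μ) ^ μ * Real.exp (1 / 2), by positivity, fun y hy => ?_⟩
  have h1 : 1 + y ≤ 2 * μ * Real.exp ((1 + y) / (2 * μ)) := by
    have := (Real.add_one_le_exp ((1 + y) / (2 * μ)))
    have h2 : (1 + y) / (2 * μ) ≤ Real.exp ((1 + y) / (2 * μ)) := by linarith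
    rw [div_le_iff₀ (by positivity)] at h2
    linarith
  calc (1 + y) ^ μ ≤ (2 * μ * Real.exp ((1 + y) / (2 * μ))) ^ μ :=
        Real.rpow_le_rpow (by positivity) h1 hμ.le
    _ = (2 * μ) ^ μ * Real.exp (1 / 2) * Real.exp (y / 2) := by
        rw [Real.mul_rpow (by positivity) (by positivity), ← Real.exp_mul, mul_assoc, ← Real.exp_add]
        congr 2
        field_simp

/-- Inside the light cone `e^{-λt} φ_λ` is of size `(λτ)^(-μ)` and decays exponentially away from
the boundary of the cone; this uses `(1 + λr)(1 + λσ) ≥ λt` for `r + σ = t + R`. -/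
theorem exp_mul_le_of_profile_le {μ C K R lam τ t r φ : ℝ} (hμ : 0 < μ) (hC : 0 ≤ C)
    (hK : ∀ y : ℝ, 0 ≤ y → (1 + y) ^ μ ≤ K * Real.exp (y / 2)) (hR : 0 ≤ R) (hlam : 0 < lam)
    (hlam1 : lam ≤ 1) (hτ : 0 < τ) (ht : τ / 2 ≤ t) (hr : 0 ≤ r) (hrt : r ≤ t + R)
    (hφ : φ ≤ C * ((1 + lam * r) ^ (-μ) * Real.exp (lam * r))) :
    Real.exp (-lam * t) * φ ≤ C * Real.exp R * 2 ^ μ * K *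
      ((lam * τ) ^ (-μ) * Real.exp (-lam * (t + R - r) / 2)) := by
  obtain ⟨σ, hσ⟩ : ∃ σ, σ = t + R - r := ⟨_, rfl⟩
  have hσ0 : 0 ≤ σ := by linarith
  have hσ' : 0 ≤ lam * σ := by positivity
  have hr' : 0 ≤ lam * r := by positivity
  have h1 : lam * τ / 2 ≤ (1 + lam * r) * (1 + lam * σ) := by
    have e1 : (1 + lam * r) * (1 + lam * σ) = 1 + lam * (t + R) + lam * r * (lam * σ) := by
      rw [hσ]; ring
    have e2 : lam * (τ / 2) ≤ lam * (t + R) := by gcongr; linarith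
    have e3 : 0 ≤ lam * r * (lam * σ) := by positivity
    rw [e1]; linarith
  have h2 : (1 + lam * r) ^ (-μ) ≤ (lam * τ / 2) ^ (-μ) * (1 + lam * σ) ^ μ := by
    have h3 : ((1 + lam * r) * (1 + lam * σ)) ^ (-μ) ≤ (lam * τ / 2) ^ (-μ) :=
      Real.rpow_le_rpow_of_nonpos (by positivity) h1 (by linarith)
    calc (1 + lam * r) ^ (-μ)
        = ((1 + lam * r) * (1 + lam * σ)) ^ (-μ) * (1 + lam * σ) ^ μ := by
          rw [Real.mul_rpow (by positivity) (by positivity), mul_assoc,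
            ← Real.rpow_add (by positivity), neg_add_cancel, Real.rpow_zero, mul_one]
      _ ≤ _ := by gcongr
  have h4 : (lam * τ / 2) ^ (-μ) = 2 ^ μ * (lam * τ) ^ (-μ) := by
    rw [Real.div_rpow (by positivity) (by norm_num), Real.rpow_neg (by norm_num : (0 : ℝ) ≤ 2)]
    field_simp
  have hKσ := hK _ hσ'
  have hexp : Real.exp (-lam * t) * Real.exp (lam * r) = Real.exp (lam * R) * Real.exp (-lam * σ) := by
    rw [← Real.exp_add, ← Real.exp_add, hσ]
    congr 1
    ring
  have hexp2 : Real.exp (lam * σ / 2) * Real.exp (-lam * σ) = Real.exp (-lam * σ / 2) := by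
    rw [← Real.exp_add]
    congr 1
    ring
  have hexp3 : Real.exp (lam * R) ≤ Real.exp R := by
    gcongr
    exact mul_le_of_le_one_left hR hlam1
  rw [← hσ]
  calc Real.exp (-lam * t) * φ
      ≤ Real.exp (-lam * t) * (C * ((1 + lam * r) ^ (-μ) * Real.exp (lam * r))) := by gcongr
    _ = C * (1 + lam * r) ^ (-μ) * (Real.exp (-lam * t) * Real.exp (lam * r)) := by ring
    _ = C * (1 + lam * r) ^ (-μ) * (Real.exp (lam * R) * Real.exp (-lam * σ)) := by rw [hexp]
    _ ≤ C * (2 ^ μ * (lam * τ) ^ (-μ) * (K * Real.exp (lam * σ / 2))) *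
          (Real.exp R * Real.exp (-lam * σ)) := by
        refine mul_le_mul (mul_le_mul_of_nonneg_left ?_ hC)
          (mul_le_mul_of_nonneg_right hexp3 (Real.exp_nonneg _)) (by positivity) ?_
        · rw [← h4]
          exact h2.trans (by gcongr)
        · exact mul_nonneg hC (mul_nonneg (by positivity)
            ((Real.rpow_nonneg (by positivity) μ).trans hKσ))
    _ = C * Real.exp R * 2 ^ μ * K * (lam * τ) ^ (-μ) *
          (Real.exp (lam * σ / 2) * Real.exp (-lam * σ)) := by ring
    _ = _ := by rw [hexp2]; ring

/-- The weights `b i = e^{-λt} φ_λ` for the dyadic parameters `λ = 2^(-i)`. -/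
theorem exists_weights {n : ℕ} (hn : 3 ≤ n) {p : ℝ} (hp : 0 < p) {D V : E n → ℝ} {Dp Vp : ℝ → ℝ}
    (hD : ∀ x, D x = Dp ‖x‖) (hV : ∀ x, V x = Vp ‖x‖) {α β ω : ℝ}
    (hP : IsProfilePair Dp Vp α β ω) {R : ℝ} (hR : 0 < R) {f₀ g₀ : E n → ℝ}
    (hdata : IsData f₀ g₀ R) {s CZ : ℝ} {Z Z₁ Z₂ Z₃ : ℝ → ℝ}
    (hZ : IsTimeCutoff s CZ Z Z₁ Z₂ Z₃) :
    ∃ (K : ℝ) (b : ℕ → ℝ → E n → ℝ), 0 < K ∧ (∀ i t, Continuous (b i t)) ∧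
      (∀ i t x, Real.exp (-(1 / 2) ^ i * t) ≤ b i t x) ∧
      (∀ (i : ℕ) (τ t : ℝ) (x : E n), 0 < τ → τ / 2 ≤ t → ‖x‖ ≤ t + R →
        b i t x ≤ K * (((1 / 2) ^ i * τ) ^ (-(((n : ℝ) - 1) / 2)) *
          Real.exp (-(1 / 2) ^ i * (t + R - ‖x‖) / 2))) ∧
      ∀ (ε : ℝ) (T : ℝ≥0∞) (u w : ℝ → L2 n), 0 ≤ ε → IsComponent T D V p ε R f₀ g₀ u w →
        ∀ i k : ℕ, i ≤ k → R ≤ 2 ^ k → ENNReal.ofReal (2 ^ k) < T →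
          ENNReal.ofReal (ε * ((∫ x, g₀ x) + (1 / 2) ^ i * ∫ x, f₀ x))
            + ∫⁻ t in Ioc (0 : ℝ) (2 ^ k), ∫⁻ x, ‖w t x‖ₑ ^ p *
              ENNReal.ofReal (Z (t / 2 ^ k) * b i t x)
          ≤ ENNReal.ofReal (K * ((1 / 2) ^ i / 2 ^ k)) *
              ∫⁻ t in Ioc ((2 : ℝ) ^ k / 2) (2 ^ k), ∫⁻ x, ‖u t x‖ₑ *
                ENNReal.ofReal (Z (t / 2 ^ k) ^ s * b i t x) := by
  obtain ⟨C, hC1, hfam⟩ := hP.exists_family hn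
  choose φ ψ h1 h2 h3 h4 h5 h6 using hfam
  have hμ : 0 < ((n : ℝ) - 1) / 2 := by
    have : (3 : ℝ) ≤ n := by exact_mod_cast hn
    linarith
  obtain ⟨K, hK0, hK⟩ := exists_one_add_rpow_le hμ
  have hl0 : ∀ i : ℕ, (0 : ℝ) < (1 / 2) ^ i := fun i => by positivity
  have hl1 : ∀ i : ℕ, ((1 : ℝ) / 2) ^ i ≤ 1 := fun i => pow_le_one₀ (by norm_num) (by norm_num)
  have hα := hP.alpha_nonneg
  have hCZ : 0 ≤ CZ := by
    have := hZ.bound₁ 0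
    rw [hZ.eq_one 0 (by norm_num), Real.one_rpow, mul_one] at this
    exact (abs_nonneg _).trans this
  obtain ⟨K₁, hK₁⟩ : ∃ K₁, K₁ = C * Real.exp R * 2 ^ (((n : ℝ) - 1) / 2) * K := ⟨_, rfl⟩
  have hK₁0 : 0 < K₁ := by rw [hK₁]; positivity
  obtain ⟨K₂, hK₂⟩ : ∃ K₂, K₂ = CZ * (3 + 6 * α + α ^ 2) := ⟨_, rfl⟩
  have hK₂0 : 0 ≤ K₂ := by rw [hK₂]; positivity
  refine ⟨K₁ + K₂, fun i t x => Real.exp (-(1 / 2) ^ i * t) * φ _ (hl0 i) (hl1 i) ‖x‖,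
    by positivity, fun i t => ?_, fun i t x => ?_, fun i τ t x hτ ht hx => ?_,
    fun ε T u w hε hcomp i k hik hRk hkT => ?_⟩
  · exact continuous_const.mul ((h5 _ (hl0 i) (hl1 i)).continuous.comp continuous_norm)
  · exact le_mul_of_one_le_right (Real.exp_nonneg _) (h1 _ _ _ _)
  · refine (exp_mul_le_of_profile_le hμ (by linarith) hK hR.le (hl0 i) (hl1 i) hτ ht
      (norm_nonneg x) hx (h2 _ (hl0 i) (hl1 i) _ (norm_nonneg x))).trans ?_
    rw [← hK₁]
    exact mul_le_mul_of_nonneg_right (by linarith) (by positivity)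
  · have hτ : (0 : ℝ) < 2 ^ k := by positivity
    have hτlam : (1 : ℝ) ≤ 2 ^ k * (1 / 2) ^ i := by
      rw [one_div, inv_pow, ← div_eq_mul_inv, one_le_div (by positivity)]
      exact pow_le_pow_right₀ (by norm_num) hik
    have key := hcomp.basic_inequality (by omega) hp hε hdata hD hV hP (hl0 i)
      (h1 _ (hl0 i) (hl1 i)) (h3 _ (hl0 i) (hl1 i)) (h4 _ (hl0 i) (hl1 i)) (h5 _ (hl0 i) (hl1 i))
      (h6 _ (hl0 i) (hl1 i)) hZ hτ hRk hτlam hkT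
    refine key.trans ?_
    gcongr
    rw [← hK₂]
    linarith

/-- The dyadic exponentials `2^(-iκ) e^{-2^(-i) σ/2}` add up to a power of `σ`. With
`y = 2^(-i)(1 + σ)` the `i`-th term is compared with `F(y) - F(y/2)`, where
`F(y) = y^κ/(1 + y^κ)`, and the sum telescopes. -/
theorem exists_sum_exp_le {κ : ℝ} (hκ : 0 < κ) (hκ1 : κ ≤ 1) :
    ∃ C : ℝ, 0 < C ∧ ∀ (m : ℕ) (σ : ℝ), 0 ≤ σ →
      ∑ i ∈ Finset.range m, (((1 : ℝ) / 2) ^ i) ^ κ * Real.exp (-(1 / 2) ^ i * σ / 2)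
        ≤ C * (1 + σ) ^ (-κ) := by
  obtain ⟨K, hK0, hK⟩ := exists_one_add_rpow_le (μ := 2) (by norm_num)
  obtain ⟨θ, hθ⟩ : ∃ θ : ℝ, θ = (1 / 2) ^ κ := ⟨_, rfl⟩
  have hθ0 : 0 < θ := by rw [hθ]; positivity
  have hθ1 : θ < 1 := by rw [hθ]; exact Real.rpow_lt_one (by norm_num) (by norm_num) hκ
  obtain ⟨C, hC⟩ : ∃ C, C = 4 * K / (1 - θ) := ⟨_, rfl⟩
  have hC0 : 0 < C := by rw [hC]; exact div_pos (by positivity) (by linarith)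
  let F : ℝ → ℝ := fun z => z / (1 + z)
  have hF : ∀ y : ℝ, 0 ≤ y →
      y ^ κ * Real.exp (-y / 2) ≤ C * (F (y ^ κ) - F (θ * y ^ κ)) := by
    intro y hy
    have hz : 0 ≤ y ^ κ := by positivity
    have hzy : 1 + y ^ κ ≤ 2 * (1 + y) := by
      have : y ^ κ ≤ (1 + y) ^ (1 : ℝ) :=
        (Real.rpow_le_rpow hy (by linarith) hκ.le).trans
          (Real.rpow_le_rpow_of_exponent_le (by linarith) hκ1)
      rw [Real.rpow_one] at this
      linarith
    generalize y ^ κ = z at *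
    have h1 : (1 + z) ^ 2 ≤ 4 * K * Real.exp (y / 2) := by
      have h2 := hK y hy
      rw [Real.rpow_two] at h2
      calc (1 + z) ^ 2 ≤ (2 * (1 + y)) ^ 2 := by gcongr
        _ = 4 * (1 + y) ^ 2 := by ring
        _ ≤ 4 * (K * Real.exp (y / 2)) := by gcongr
        _ = _ := by ring
    have h3 : F z - F (θ * z) = z * (1 - θ) / ((1 + z) * (1 + θ * z)) := by
      simp only [F]
      have : 1 + z ≠ 0 := by positivity
      have : 1 + θ * z ≠ 0 := by positivity
      field_simp
      ring
    have h4 : (1 + z) * (1 + θ * z) ≤ 4 * K * Real.exp (y / 2) := by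
      refine le_trans ?_ h1
      rw [sq]
      gcongr
      exact mul_le_of_le_one_left hz hθ1.le
    rw [h3, hC, neg_div, Real.exp_neg]
    have h5 : 0 < 1 - θ := by linarith
    have : 4 * K / (1 - θ) * (z * (1 - θ) / ((1 + z) * (1 + θ * z)))
        = z * (4 * K / ((1 + z) * (1 + θ * z))) := by field_simp
    rw [this]
    refine mul_le_mul_of_nonneg_left ?_ hz
    rw [inv_eq_one_div, div_le_div_iff₀ (by positivity) (by positivity)]
    linarith
  refine ⟨Real.exp (1 / 2) * C, by positivity, fun m σ hσ => ?_⟩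
  have hterm : ∀ i : ℕ, (((1 : ℝ) / 2) ^ i) ^ κ * Real.exp (-(1 / 2) ^ i * σ / 2)
      ≤ Real.exp (1 / 2) * C * (1 + σ) ^ (-κ) *
        (F (θ ^ i * (1 + σ) ^ κ) - F (θ ^ (i + 1) * (1 + σ) ^ κ)) := by
    intro i
    have hl0 : (0 : ℝ) < (1 / 2) ^ i := by positivity
    have hl1 : ((1 : ℝ) / 2) ^ i ≤ 1 := pow_le_one₀ (by norm_num) (by norm_num)
    have hθi : θ ^ i = (((1 : ℝ) / 2) ^ i) ^ κ := by
      rw [hθ, ← Real.rpow_natCast, ← Real.rpow_natCast, ← Real.rpow_mul (by norm_num),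
        ← Real.rpow_mul (by norm_num), mul_comm]
    have h1 := hF ((1 / 2) ^ i * (1 + σ)) (by positivity)
    rw [Real.mul_rpow hl0.le (by positivity), ← hθi] at h1
    rw [← hθi, pow_succ']
    generalize ((1 : ℝ) / 2) ^ i = l at *
    have h2 : Real.exp (-l * σ / 2) ≤ Real.exp (1 / 2) * Real.exp (-(l * (1 + σ)) / 2) := by
      rw [← Real.exp_add]
      refine Real.exp_le_exp.2 ?_
      linarith
    have hσκ : (1 + σ) ^ (-κ) * (1 + σ) ^ κ = 1 := by
      rw [← Real.rpow_add (by positivity), neg_add_cancel, Real.rpow_zero]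
    calc θ ^ i * Real.exp (-l * σ / 2)
        ≤ θ ^ i * (Real.exp (1 / 2) * Real.exp (-(l * (1 + σ)) / 2)) := by gcongr
      _ = Real.exp (1 / 2) * (1 + σ) ^ (-κ) *
            (θ ^ i * (1 + σ) ^ κ * Real.exp (-(l * (1 + σ)) / 2)) := by
          linear_combination (-(θ ^ i * Real.exp (1 / 2) * Real.exp (-(l * (1 + σ)) / 2))) * hσκ
      _ ≤ Real.exp (1 / 2) * (1 + σ) ^ (-κ) *
            (C * (F (θ ^ i * (1 + σ) ^ κ) - F (θ * (θ ^ i * (1 + σ) ^ κ)))) := by gcongr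
      _ = _ := by rw [mul_assoc θ]; ring
  refine (Finset.sum_le_sum fun i _ => hterm i).trans ?_
  rw [← Finset.mul_sum, Finset.sum_range_sub']
  refine mul_le_of_le_one_right (by positivity) ?_
  have hF0 : 0 ≤ F (θ ^ m * (1 + σ) ^ κ) := by simp only [F]; positivity
  have hF1 : F (θ ^ 0 * (1 + σ) ^ κ) ≤ 1 := by
    simp only [F]
    rw [div_le_one (by positivity)]
    linarith
  linarith

theorem sum_lintegral_le {ι α : Type*} [MeasurableSpace α] (ν : Measure α) (s : Finset ι)
    (f : ι → α → ℝ≥0∞) : ∑ i ∈ s, ∫⁻ a, f i a ∂ν ≤ ∫⁻ a, ∑ i ∈ s, f i a ∂ν := by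
  classical
  induction s using Finset.induction_on with
  | empty => simp
  | insert a s ha ih =>
    simp only [Finset.sum_insert ha]
    exact (add_le_add_right ih _).trans (le_lintegral_add _ _)

/-! ### The three estimates on dyadic windows -/

/-- Both data may not vanish at once, so at least one of the two integrals is positive. -/
theorem IsData.integral_pos {n : ℕ} {f₀ g₀ : E n → ℝ} {R : ℝ} (h : IsData f₀ g₀ R) :
    0 < (∫ x, g₀ x) + ∫ x, f₀ x := by
  have key : ∀ f : E n → ℝ, Continuous f → tsupport f ⊆ Metric.closedBall 0 R → (∀ x, 0 ≤ f x) →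
      f ≠ 0 → 0 < ∫ x, f x := fun f hf hs h0 hne => by
    obtain ⟨x, hx⟩ := Function.ne_iff.1 hne
    exact hf.integral_pos_of_hasCompactSupport_nonneg_nonzero
      ((isCompact_closedBall (0 : E n) R).of_isClosed_subset (isClosed_tsupport _) hs)
      h0 (x := x) hx
  by_cases hf : f₀ = 0
  · have hg : g₀ ≠ 0 := fun hg => h.nontrivial ⟨hf, hg⟩
    exact add_pos_of_pos_of_nonneg
      (key _ h.smooth_right.continuous h.support_right h.nonneg_right hg)
      (integral_nonneg h.nonneg_left)
  · exact add_pos_of_nonneg_of_pos (integral_nonneg h.nonneg_right)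
      (key _ h.smooth_left.continuous h.support_left h.nonneg_left hf)

theorem rpow_volume_eq {n : ℕ} (hn : 1 ≤ n) {c τ I κ : ℝ} (hc : 0 ≤ c) (hτ : 0 < τ) (hI : 0 ≤ I) :
    (c * (2 * τ) ^ (n - 1) * I * τ) ^ κ
      = (c * 2 ^ (n - 1)) ^ κ * I ^ κ * τ ^ ((n : ℝ) * κ) := by
  have h1 : c * (2 * τ) ^ (n - 1) * I * τ = c * 2 ^ (n - 1) * I * τ ^ n := by
    obtain ⟨m, rfl⟩ : ∃ m, n = m + 1 := ⟨n - 1, by omega⟩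
    simp only [Nat.add_sub_cancel]
    ring
  rw [h1, Real.mul_rpow (by positivity) (by positivity), Real.mul_rpow (by positivity) hI,
    ← Real.rpow_natCast τ n, ← Real.rpow_mul hτ.le]

/-- The solution in the window `(2^i/2, 2^i]` is seen by the weight with parameter `2^(-i)`. -/
theorem windowIntegral_le {n : ℕ} {s C : ℝ} {Z Z₁ Z₂ Z₃ : ℝ → ℝ}
    (hZ : IsTimeCutoff s C Z Z₁ Z₂ Z₃) {p : ℝ} {w : ℝ → L2 n} {b : ℝ → E n → ℝ} {i k : ℕ}
    (hik : i ≤ k) (hb : ∀ t x, Real.exp (-(1 / 2) ^ i * t) ≤ b t x) :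
    windowIntegral Z p w (2 ^ i) ≤ ENNReal.ofReal (Real.exp 1) *
      ∫⁻ t in Ioc (0 : ℝ) (2 ^ k), ∫⁻ x, ‖w t x‖ₑ ^ p *
        ENNReal.ofReal (Z (t / 2 ^ k) * b t x) := by
  have h2i : (0 : ℝ) < 2 ^ i := by positivity
  have hsub : Ioc ((2 : ℝ) ^ i / 2) (2 ^ i) ⊆ Ioc (0 : ℝ) (2 ^ k) := fun t ht =>
    ⟨by linarith [ht.1], ht.2.trans (pow_le_pow_right₀ (by norm_num) hik)⟩
  rw [← lintegral_const_mul' _ _ ENNReal.ofReal_ne_top]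
  refine le_trans ?_ (lintegral_mono_set hsub)
  refine setLIntegral_mono_ae' measurableSet_Ioc (ae_of_all _ fun t ht => ?_)
  rw [← lintegral_const_mul' _ _ ENNReal.ofReal_ne_top]
  refine lintegral_mono fun x => ?_
  rw [mul_left_comm, ← ENNReal.ofReal_mul (Real.exp_nonneg _)]
  gcongr
  have hZle : Z (t / 2 ^ i) ≤ Z (t / 2 ^ k) := by
    rcases hik.eq_or_lt with rfl | hlt
    · exact le_rfl
    · rw [hZ.eq_one (t / 2 ^ k)]
      · exact hZ.le_one _
      · have : (2 : ℝ) ^ i * 2 ≤ 2 ^ k := by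
          rw [← pow_succ]; exact pow_le_pow_right₀ (by norm_num) hlt
        rw [div_le_iff₀ (by positivity)]
        linarith [ht.2]
  have hexp : 1 ≤ Real.exp 1 * b t x := by
    refine le_trans ?_ (mul_le_mul_of_nonneg_left (hb t x) (Real.exp_nonneg _))
    rw [← Real.exp_add]
    refine Real.one_le_exp ?_
    have h1 : ((1 : ℝ) / 2) ^ i * t ≤ (1 / 2) ^ i * 2 ^ i := by gcongr; exact ht.2
    rw [← mul_pow, show (1 : ℝ) / 2 * 2 = 1 by norm_num, one_pow] at h1
    linarith
  calc Z (t / 2 ^ i) ≤ Z (t / 2 ^ k) * (Real.exp 1 * b t x) :=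
        hZle.trans (le_mul_of_one_le_right (hZ.nonneg _) hexp)
    _ = _ := by ring

theorem integral_exp_rpow_le {r : ℝ} (hr : 1 ≤ r) {ρ : ℝ} (hρ : 0 ≤ ρ) :
    ∫ σ in (0 : ℝ)..ρ, Real.exp (-|σ| / 2) ^ r ≤ 2 := by
  have hd : ∀ σ ∈ uIcc 0 ρ, HasDerivAt (fun σ : ℝ => -2 * Real.exp (-σ / 2))
      (Real.exp (-σ / 2)) σ := fun σ _ => by
    have h1 := ((((hasDerivAt_id σ).neg).div_const 2).exp).const_mul (-2)
    refine h1.congr_deriv ?_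
    simp only [id, Pi.neg_apply]
    ring
  have hi : IntervalIntegrable (fun σ : ℝ => Real.exp (-σ / 2)) volume 0 ρ :=
    Continuous.intervalIntegrable (by fun_prop) _ _
  have h2 := intervalIntegral.integral_eq_sub_of_hasDerivAt hd hi
  have h3 : ∫ σ in (0 : ℝ)..ρ, Real.exp (-|σ| / 2) ^ r ≤ ∫ σ in (0 : ℝ)..ρ, Real.exp (-σ / 2) := by
    refine intervalIntegral.integral_mono_on hρ (Continuous.intervalIntegrable
      (Continuous.rpow_const (by fun_prop) fun _ => Or.inr (by linarith)) _ _) hi fun σ hσ => ?_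
    rw [abs_of_nonneg hσ.1]
    calc Real.exp (-σ / 2) ^ r ≤ Real.exp (-σ / 2) ^ (1 : ℝ) :=
          Real.rpow_le_rpow_of_exponent_ge (Real.exp_pos _)
            (Real.exp_le_one_iff.2 (by linarith [hσ.1])) hr
      _ = _ := Real.rpow_one _
  refine h3.trans ?_
  rw [h2]
  have := Real.exp_nonneg (-ρ / 2)
  simp only [neg_zero, zero_div, Real.exp_zero]
  linarith

/-- The weight that decays like `σ^(-1/r)` has a logarithmically divergent `L^r` norm. -/
theorem integral_inv_le {ρ : ℝ} {k : ℕ} (hk : 1 ≤ k) (hρ : 0 ≤ ρ) (hρk : ρ ≤ 2 * 2 ^ k) {r : ℝ}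
    (hr : 0 < r) :
    ∫ σ in (0 : ℝ)..ρ, ((1 + |σ|) ^ (-(1 / r))) ^ r ≤ 3 * k := by
  have h1 : ∫ σ in (0 : ℝ)..ρ, ((1 + |σ|) ^ (-(1 / r))) ^ r = ∫ σ in (0 : ℝ)..ρ, (1 + σ)⁻¹ := by
    refine intervalIntegral.integral_congr fun σ hσ => ?_
    rw [uIcc_of_le hρ] at hσ
    have h0 : 0 < 1 + σ := by linarith [hσ.1]
    simp only [abs_of_nonneg hσ.1]
    rw [← Real.rpow_mul h0.le, neg_mul, one_div_mul_cancel hr.ne', Real.rpow_neg_one]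
  have h2 : ∫ σ in (0 : ℝ)..ρ, (1 + σ)⁻¹ = Real.log (1 + ρ) := by
    have := intervalIntegral.integral_comp_add_left (fun x : ℝ => x⁻¹) 1 (a := 0) (b := ρ)
    rw [this, add_zero, integral_inv_of_pos one_pos (by linarith), div_one]
  rw [h1, h2]
  have h3 : 1 + ρ ≤ 2 ^ (k + 2) := by
    have : (1 : ℝ) ≤ 2 ^ k := one_le_pow₀ (by norm_num)
    rw [pow_add]; linarith
  calc Real.log (1 + ρ) ≤ Real.log (2 ^ (k + 2)) := Real.log_le_log (by linarith) h3
    _ = (k + 2) * Real.log 2 := by rw [Real.log_pow]; push_cast; ring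
    _ ≤ (k + 2) * 1 := by
        gcongr
        linarith [Real.log_two_lt_d9]
    _ ≤ 3 * k := by
        have : (1 : ℝ) ≤ k := by exact_mod_cast hk
        linarith

/-- The estimates for one component of a solution on the windows `(2^k/2, 2^k]`: a lower bound
for the solution in terms of the data, a bound of `w` by `u` on one window, and a bound of a
weighted sum of `w` over all windows by `u` on the last one. -/
theorem exists_window_estimates {n : ℕ} (hn : 3 ≤ n) {p q q' : ℝ} (hp : 0 < p)
    (hqq : q.HolderConjugate q') {D V : E n → ℝ} {Dp Vp : ℝ → ℝ} (hD : ∀ x, D x = Dp ‖x‖)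
    (hV : ∀ x, V x = Vp ‖x‖) {α β ω : ℝ} (hP : IsProfilePair Dp Vp α β ω) {R : ℝ} (hR : 0 < R)
    {f₀ g₀ : E n → ℝ} (hdata : IsData f₀ g₀ R) {s CZ : ℝ} {Z Z₁ Z₂ Z₃ : ℝ → ℝ}
    (hZ : IsTimeCutoff s CZ Z Z₁ Z₂ Z₃) (hs : 1 / q ≤ s) {μ : ℝ} (hμ : μ = ((n : ℝ) - 1) / 2) :
    ∃ C : ℝ, 0 < C ∧ ∀ (ε : ℝ) (T : ℝ≥0∞) (u w : ℝ → L2 n), 0 ≤ ε →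
      IsComponent T D V p ε R f₀ g₀ u w → ContinuousOn u (timeInterval T) →
      ∀ k : ℕ, 1 ≤ k → R ≤ 2 ^ k → ENNReal.ofReal (2 ^ k) < T →
        ENNReal.ofReal ε ≤ ENNReal.ofReal (C * (2 ^ k) ^ (-1 - μ + n * (1 / q'))) *
          windowIntegral Z q u (2 ^ k) ^ (1 / q) ∧
        windowIntegral Z p w (2 ^ k) ≤
          ENNReal.ofReal (C * (2 ^ k) ^ (-2 + (n + 1) * (1 / q'))) *
            windowIntegral Z q u (2 ^ k) ^ (1 / q) ∧
        ∑ j ∈ Finset.range (k + 1), ENNReal.ofReal (((1 / 2) ^ j) ^ (μ - 1 / q)) *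
            windowIntegral Z p w (2 ^ j) ≤
          ENNReal.ofReal (C * ((2 ^ k) ^ (-1 - μ + n * (1 / q')) * (k : ℝ) ^ (1 / q'))) *
            windowIntegral Z q u (2 ^ k) ^ (1 / q) := by
  obtain ⟨K, b, hK, hbc, hblow, hbup, hcore⟩ := exists_weights hn hp hD hV hP hR hdata hZ
  obtain ⟨c, hc0, hc⟩ := exists_lintegral_closedBall_le n (by omega)
  have hq0' := hqq.symm.pos
  have hκ0 : 0 < 1 / q' := by positivity
  have hκ1 : 1 / q' ≤ 1 := by rw [div_le_one hq0']; exact hqq.symm.lt.le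
  obtain ⟨CS, hCS0, hCS⟩ := exists_sum_exp_le hκ0 hκ1
  have hκ : 1 / q' = 1 - 1 / q := by
    have := hqq.inv_add_inv_eq_one
    rw [one_div, one_div]; linarith
  obtain ⟨c₀, hc₀⟩ : ∃ c₀, c₀ = (∫ x, g₀ x) + ∫ x, f₀ x := ⟨_, rfl⟩
  have hc₀0 : 0 < c₀ := hc₀ ▸ hdata.integral_pos
  obtain ⟨B, hB⟩ : ∃ B, B = (c * 2 ^ (n - 1)) ^ (1 / q') := ⟨_, rfl⟩
  have hB0 : 0 ≤ B := by rw [hB]; positivity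
  have he := Real.exp_pos 1
  obtain ⟨C₁, hC₁⟩ : ∃ C₁, C₁ = K * K * B * 2 ^ (1 / q') / c₀ := ⟨_, rfl⟩
  obtain ⟨C₂, hC₂⟩ : ∃ C₂, C₂ = Real.exp 1 * K * K * B * 2 ^ (1 / q') := ⟨_, rfl⟩
  obtain ⟨C₃, hC₃⟩ : ∃ C₃, C₃ = Real.exp 1 * K * K * CS * B * 3 ^ (1 / q') := ⟨_, rfl⟩
  have hC₁0 : 0 ≤ C₁ := by rw [hC₁]; positivity
  have hC₂0 : 0 ≤ C₂ := by rw [hC₂]; positivity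
  have hC₃0 : 0 ≤ C₃ := by rw [hC₃]; positivity
  refine ⟨C₁ + C₂ + C₃ + 1, by positivity, fun ε T u w hε hcomp hu k hk hRk hkT => ?_⟩
  have hcore' := hcore ε T u w hε hcomp
  obtain ⟨-, hFu, -⟩ := hcomp
  obtain ⟨τ, hτ⟩ : ∃ τ : ℝ, τ = 2 ^ k := ⟨_, rfl⟩
  have hτ0 : 0 < τ := by rw [hτ]; positivity
  have hlτ : (1 / 2 : ℝ) ^ k * τ = 1 := by
    rw [hτ, ← mul_pow]; norm_num
  obtain ⟨M, hM⟩ : ∃ M : (ℝ → E n → ℝ) → ℝ≥0∞, M = fun b => ∫⁻ t in Ioc (τ / 2) τ, ∫⁻ x,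
      ‖u t x‖ₑ * ENNReal.ofReal (Z (t / τ) ^ s * b t x) := ⟨_, rfl⟩
  obtain ⟨Y, hY⟩ : ∃ Y, Y = windowIntegral Z q u τ ^ (1 / q) := ⟨_, rfl⟩
  rw [← hτ] at hRk hkT ⊢
  rw [← hY]
  rw [← hμ] at hbup
  -- Hölder's inequality with the weight `b ≤ A h(σ)`
  have hold : ∀ (b : ℝ → E n → ℝ) (A I : ℝ) (h : ℝ → ℝ), (∀ t, Continuous (b t)) → 0 ≤ A →
      Continuous h → (∀ σ, 0 ≤ h σ) →
      (∀ t ∈ Ioc (τ / 2) τ, ∀ x, ‖x‖ ≤ t + R → b t x ≤ A * h (t + R - ‖x‖)) →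
      (∀ ρ, 0 ≤ ρ → ρ ≤ 2 * τ → ∫ σ in (0 : ℝ)..ρ, h σ ^ q' ≤ I) →
      M b ≤ ENNReal.ofReal (A * (B * I ^ (1 / q') * τ ^ (n * (1 / q')))) * Y := by
    intro b A I h hb hA hh h0 hbd hI
    have hI0 : 0 ≤ I := le_trans (by simp) (hI 0 le_rfl (by positivity))
    have := lintegral_window_le hqq hu hFu hR.le hZ.contDiff.continuous hZ.nonneg hZ.le_one hs hτ0
      hkT hRk hb hA hh h0 hbd hI hc0 hc
    rw [rpow_volume_eq (by omega) hc0 hτ0 hI0] at this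
    rwa [hM, hY, hB]
  have hcor : ∀ i : ℕ, i ≤ k → ENNReal.ofReal (ε * ((∫ x, g₀ x) + (1 / 2) ^ i * ∫ x, f₀ x))
      + ∫⁻ t in Ioc (0 : ℝ) (2 ^ k), ∫⁻ x, ‖w t x‖ₑ ^ p *
        ENNReal.ofReal (Z (t / 2 ^ k) * b i t x)
      ≤ ENNReal.ofReal (K * ((1 / 2) ^ i / τ)) * M (b i) := by
    intro i hi
    have := hcore' i k hi (hτ ▸ hRk) (hτ ▸ hkT)
    rw [hM]
    convert this using 2 <;> simp only [hτ]
  have hwin : ∀ i : ℕ, i ≤ k → windowIntegral Z p w (2 ^ i) ≤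
      ENNReal.ofReal (Real.exp 1 * (K * ((1 / 2) ^ i / τ))) * M (b i) := by
    intro i hi
    refine (windowIntegral_le hZ hi (hblow i)).trans ?_
    rw [ENNReal.ofReal_mul he.le, mul_assoc]
    gcongr
    exact le_add_self.trans (hcor i hi)
  refine ⟨?_, ?_, ?_⟩
  · -- `λ = 1`, with the weight `e^(-σ/2)`
    have h1 := hold (b 0) (K * τ ^ (-μ)) 2 (fun σ => Real.exp (-|σ| / 2)) (hbc 0) (by positivity)
      (by fun_prop) (fun σ => Real.exp_nonneg _) (fun t ht x hx => by
        have := hbup 0 τ t x hτ0 ht.1.le hx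
        simp only [pow_zero, one_mul] at this
        rw [abs_of_nonneg (by linarith)]
        calc _ ≤ _ := this
          _ = _ := by rw [mul_assoc, neg_one_mul]) 
      (fun ρ hρ _ => integral_exp_rpow_le hqq.symm.lt.le hρ)
    have h2 := le_self_add.trans (hcor 0 (Nat.zero_le k))
    rw [pow_zero, one_mul, ← hc₀] at h2
    have h3 := h2.trans (mul_le_mul_right h1 _)
    rw [← mul_assoc, ← ENNReal.ofReal_mul (by positivity)] at h3
    have h4 : ENNReal.ofReal ε = ENNReal.ofReal (1 / c₀) * ENNReal.ofReal (ε * c₀) := by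
      rw [← ENNReal.ofReal_mul (by positivity)]
      congr 1
      field_simp
    rw [h4]
    refine (mul_le_mul_right h3 _).trans ?_
    rw [← mul_assoc, ← ENNReal.ofReal_mul (by positivity)]
    refine mul_le_mul_left (ENNReal.ofReal_le_ofReal ?_) _
    calc 1 / c₀ * (K * (1 / τ) * (K * τ ^ (-μ) * (B * 2 ^ (1 / q') * τ ^ (n * (1 / q')))))
        = C₁ * (τ ^ (-1 : ℝ) * τ ^ (-μ) * τ ^ (n * (1 / q'))) := by
          rw [hC₁, Real.rpow_neg_one]; field_simp
      _ = C₁ * τ ^ (-1 - μ + n * (1 / q')) := by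
          rw [← Real.rpow_add hτ0, ← Real.rpow_add hτ0, sub_eq_add_neg]
      _ ≤ _ := by gcongr; linarith
  · -- `λ = 1/τ`: the weight is bounded on the whole window
    have h1 := hold (b k) K (2 * τ) (fun _ => 1) (hbc k) hK.le continuous_const
      (fun σ => zero_le_one) (fun t ht x hx => by
        refine (hbup k τ t x hτ0 ht.1.le hx).trans ?_
        rw [hlτ, Real.one_rpow, one_mul]
        gcongr
        rw [Real.exp_le_one_iff]
        have : 0 ≤ (1 / 2 : ℝ) ^ k * (t + R - ‖x‖) := mul_nonneg (by positivity) (by linarith)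
        linarith)
      (fun ρ hρ hρ' => by simpa using hρ')
    have h2 := (hwin k le_rfl).trans (mul_le_mul_right h1 _)
    rw [← mul_assoc, ← ENNReal.ofReal_mul (by positivity), ← hτ] at h2
    refine h2.trans ?_
    refine mul_le_mul_left (ENNReal.ofReal_le_ofReal ?_) _
    have e1 : (1 / 2 : ℝ) ^ k = τ ^ (-1 : ℝ) := by
      rw [Real.rpow_neg_one, eq_inv_of_mul_eq_one_left hlτ]
    calc Real.exp 1 * (K * ((1 / 2) ^ k / τ)) * (K * (B * (2 * τ) ^ (1 / q') * τ ^ (n * (1 / q'))))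
        = C₂ * (τ ^ (-1 : ℝ) * τ ^ (-1 : ℝ) * τ ^ (1 / q') * τ ^ (n * (1 / q'))) := by
          rw [hC₂, e1, Real.mul_rpow (by norm_num) hτ0.le, div_eq_mul_inv, ← Real.rpow_neg_one τ]
          ring
      _ = C₂ * τ ^ (-2 + (n + 1) * (1 / q')) := by
          rw [← Real.rpow_add hτ0, ← Real.rpow_add hτ0, ← Real.rpow_add hτ0]
          congr 2
          ring
      _ ≤ _ := by gcongr; linarith
  · -- the superposition of all `λ = 2^(-j)`; the window `j` of `w` is seen by `b j` alone, and the
    -- factor `λ` gained in the basic inequality raises the exponent of the weight to `a + 1`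
    obtain ⟨a, ha⟩ : ∃ a, a = μ - 1 / q := ⟨_, rfl⟩
    rw [← ha]
    have hl : ∀ j : ℕ, (0 : ℝ) < (1 / 2) ^ j := fun j => by positivity
    let bs : ℝ → E n → ℝ := fun t x =>
      ∑ j ∈ Finset.range (k + 1), ((1 / 2 : ℝ) ^ j) ^ (a + 1) * b j t x
    have h1 := hold bs (K * CS * τ ^ (-μ)) (3 * k) (fun σ => (1 + |σ|) ^ (-(1 / q')))
      (fun t => continuous_finsetSum _ fun j _ => continuous_const.mul (hbc j t)) (by positivity)
      (Continuous.rpow_const (by fun_prop) fun σ => Or.inl (by positivity))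
      (fun σ => by positivity) (fun t ht x hx => by
        obtain ⟨σ, hσ⟩ : ∃ σ, σ = t + R - ‖x‖ := ⟨_, rfl⟩
        have hσ0 : 0 ≤ σ := by linarith
        rw [← hσ, abs_of_nonneg hσ0]
        calc bs t x ≤ ∑ j ∈ Finset.range (k + 1), K * τ ^ (-μ) *
              (((1 / 2 : ℝ) ^ j) ^ (1 / q') * Real.exp (-(1 / 2) ^ j * σ / 2)) := by
              refine Finset.sum_le_sum fun j _ => ?_
              have h2 := hbup j τ t x hτ0 ht.1.le hx
              rw [← hσ] at h2
              have h3 : ((1 / 2 : ℝ) ^ j) ^ (a + 1) * ((1 / 2 : ℝ) ^ j) ^ (-μ)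
                  = ((1 / 2 : ℝ) ^ j) ^ (1 / q') := by
                rw [← Real.rpow_add (hl j)]
                congr 1
                rw [ha, hκ]; ring
              calc _ ≤ ((1 / 2 : ℝ) ^ j) ^ (a + 1) * _ :=
                    mul_le_mul_of_nonneg_left h2 (by positivity)
                _ = _ := by
                    rw [← h3, Real.mul_rpow (hl j).le hτ0.le]; ring
          _ = K * τ ^ (-μ) * ∑ j ∈ Finset.range (k + 1),
              (((1 / 2 : ℝ) ^ j) ^ (1 / q') * Real.exp (-(1 / 2) ^ j * σ / 2)) := by
              rw [Finset.mul_sum]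
          _ ≤ K * τ ^ (-μ) * (CS * (1 + σ) ^ (-(1 / q'))) := by
              gcongr
              exact hCS (k + 1) σ hσ0
          _ = _ := by ring)
      (fun ρ hρ hρ' => integral_inv_le hk hρ (hτ ▸ hρ') hq0')
    have h2 : ∑ j ∈ Finset.range (k + 1), ENNReal.ofReal (((1 / 2 : ℝ) ^ j) ^ (a + 1)) * M (b j)
        ≤ M bs := by
      rw [hM]
      simp only [← lintegral_const_mul' _ _ ENNReal.ofReal_ne_top]
      refine (sum_lintegral_le _ _ _).trans (lintegral_mono fun t => ?_)
      refine (sum_lintegral_le _ _ _).trans (lintegral_mono fun x => ?_)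
      simp only [bs, Finset.mul_sum]
      rw [ENNReal.ofReal_sum_of_nonneg, Finset.mul_sum]
      · refine Finset.sum_le_sum fun j _ => le_of_eq ?_
        rw [mul_left_comm, ← ENNReal.ofReal_mul (by positivity)]
        congr 2
        ring
      · exact fun j _ => mul_nonneg (Real.rpow_nonneg (hZ.nonneg _) _)
          (mul_nonneg (by positivity) ((Real.exp_nonneg _).trans (hblow _ _ _)))
    calc _ ≤ ∑ j ∈ Finset.range (k + 1), ENNReal.ofReal (Real.exp 1 * K / τ) *
          (ENNReal.ofReal (((1 / 2 : ℝ) ^ j) ^ (a + 1)) * M (b j)) := by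
          refine Finset.sum_le_sum fun j hj => ?_
          refine (mul_le_mul_right (hwin j (by simpa [Nat.lt_succ_iff] using hj)) _).trans
            (le_of_eq ?_)
          rw [← mul_assoc, ← ENNReal.ofReal_mul (by positivity),
            ← mul_assoc (ENNReal.ofReal (Real.exp 1 * K / τ)),
            ← ENNReal.ofReal_mul (by positivity), Real.rpow_add (hl j), Real.rpow_one]
          congr 2
          ring
      _ ≤ ENNReal.ofReal (Real.exp 1 * K / τ) * M bs := by
          rw [← Finset.mul_sum]
          gcongr
      _ ≤ ENNReal.ofReal (Real.exp 1 * K / τ) * (ENNReal.ofReal _ * Y) := mul_le_mul_right h1 _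
      _ ≤ _ := by
          rw [← mul_assoc, ← ENNReal.ofReal_mul (by positivity)]
          refine mul_le_mul_left (ENNReal.ofReal_le_ofReal ?_) _
          calc Real.exp 1 * K / τ * (K * CS * τ ^ (-μ) *
                (B * (3 * k) ^ (1 / q') * τ ^ (n * (1 / q'))))
              = C₃ * (τ ^ (-1 : ℝ) * τ ^ (-μ) * τ ^ (n * (1 / q')) * (k : ℝ) ^ (1 / q')) := by
                rw [hC₃, Real.rpow_neg_one, Real.mul_rpow (by norm_num) (Nat.cast_nonneg k)]
                field_simp
            _ = C₃ * (τ ^ (-1 - μ + n * (1 / q')) * (k : ℝ) ^ (1 / q')) := by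
                rw [← Real.rpow_add hτ0, ← Real.rpow_add hτ0, sub_eq_add_neg]
            _ ≤ _ := by gcongr; linarith

/-! ### Dyadic bounds for a weak solution -/

/-- The profile of a radial coefficient. Decay of the potential faster than needed is given
away, so that the exponent falls in the range required by `IsProfilePair`. -/
theorem exists_isProfilePair {n : ℕ} (hn : 1 ≤ n) {D V : E n → ℝ} {α₁ α₂ β ω : ℝ} (hβ : 1 < β)
    (hω : 2 < ω) (hD : IsCoefficient D α₁ β) (hV : IsCoefficient V α₂ ω) :
    ∃ (Dp Vp : ℝ → ℝ) (α β' ω' : ℝ), IsProfilePair Dp Vp α β' ω' ∧ (∀ x, D x = Dp ‖x‖) ∧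
      ∀ x, V x = Vp ‖x‖ := by
  obtain ⟨e, he⟩ : ∃ e : E n, ‖e‖ = 1 := ⟨EuclideanSpace.single ⟨0, hn⟩ 1, by simp⟩
  have hα : ∀ {a : E n → ℝ} {α κ : ℝ}, IsCoefficient a α κ → 0 ≤ α := fun {a α κ} h => by
    have := (h.nonneg 0).trans (h.decay 0)
    simpa using this
  have hbd : ∀ {a : E n → ℝ} {α κ α' κ' : ℝ}, IsCoefficient a α κ → α ≤ α' → κ' ≤ κ →
      ∀ r : ℝ, a (r • e) ≤ α' * (1 + |r|) ^ (-κ') := fun {a α κ α' κ'} h hαα hκ r => by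
    have h1 := h.decay (r • e)
    rw [norm_smul, he, mul_one, Real.norm_eq_abs] at h1
    refine h1.trans (mul_le_mul hαα ?_ (by positivity) ((hα h).trans hαα))
    exact Real.rpow_le_rpow_of_exponent_le (by linarith [abs_nonneg r]) (by linarith)
  have hprof : ∀ {a : E n → ℝ} {α κ : ℝ}, IsCoefficient a α κ → ∀ x, a x = a (‖x‖ • e) :=
    fun h x => h.radial _ _ (by rw [norm_smul, he, mul_one, norm_norm])
  refine ⟨fun r => D (r • e), fun r => V (r • e), max α₁ α₂, β, min ω (5 / 2),
    { continuous_D := hD.continuous.comp (by fun_prop)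
      continuous_V := hV.continuous.comp (by fun_prop)
      D_nonneg := fun r => hD.nonneg _
      V_nonneg := fun r => hV.nonneg _
      D_le := hbd hD (le_max_left _ _) le_rfl
      V_le := hbd hV (le_max_right _ _) (min_le_left _ _)
      one_lt := hβ
      two_lt := lt_min hω (by norm_num)
      le_five_halves := min_le_right _ _ }, hprof hD, hprof hV⟩

/-- The estimates for one component on the windows `(2^k/2, 2^k]`, `k₀ ≤ k ≤ N`, where `x k` and
`y k` are the masses of the two components; `q` is the power of the component with masses `y`. -/
structure DyadicBounds (n : ℕ) (q C ε : ℝ) (k₀ N : ℕ) (x y : ℕ → ℝ) : Prop where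
  nonneg : ∀ k, 0 ≤ x k
  nonneg' : ∀ k, 0 ≤ y k
  data_le : ∀ k, k₀ ≤ k → k ≤ N →
    ε ≤ C * (2 ^ k) ^ (-1 - ((n : ℝ) - 1) / 2 + n * (1 - 1 / q)) * y k ^ (1 / q)
  window_le : ∀ k, k₀ ≤ k → k ≤ N →
    x k ≤ C * (2 ^ k) ^ (-2 + ((n : ℝ) + 1) * (1 - 1 / q)) * y k ^ (1 / q)
  sum_le : ∀ k, k₀ ≤ k → k ≤ N →
    ∑ j ∈ Finset.Icc k₀ k, ((1 / 2) ^ j) ^ (((n : ℝ) - 1) / 2 - 1 / q) * x j ≤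
      C * ((2 ^ k) ^ (-1 - ((n : ℝ) - 1) / 2 + n * (1 - 1 / q)) * (k : ℝ) ^ (1 - 1 / q)) *
        y k ^ (1 / q)

theorem DyadicBounds.mono {n : ℕ} {q C C' ε : ℝ} {k₀ N : ℕ} {x y : ℕ → ℝ}
    (h : DyadicBounds n q C ε k₀ N x y) (hC : C ≤ C') : DyadicBounds n q C' ε k₀ N x y where
  nonneg := h.nonneg
  nonneg' := h.nonneg'
  data_le k h1 h2 := (h.data_le k h1 h2).trans <| mul_le_mul_of_nonneg_right
    (mul_le_mul_of_nonneg_right hC (by positivity)) (Real.rpow_nonneg (h.nonneg' k) _)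
  window_le k h1 h2 := (h.window_le k h1 h2).trans <| mul_le_mul_of_nonneg_right
    (mul_le_mul_of_nonneg_right hC (by positivity)) (Real.rpow_nonneg (h.nonneg' k) _)
  sum_le k h1 h2 := (h.sum_le k h1 h2).trans <| mul_le_mul_of_nonneg_right
    (mul_le_mul_of_nonneg_right hC (by positivity)) (Real.rpow_nonneg (h.nonneg' k) _)

theorem toReal_le_mul_rpow {a Y : ℝ≥0∞} {c r : ℝ} (hc : 0 ≤ c) (hr : 0 ≤ r) (hY : Y ≠ ∞)
    (h : a ≤ ENNReal.ofReal c * Y ^ r) : a.toReal ≤ c * Y.toReal ^ r := by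
  have h1 : ENNReal.ofReal c * Y ^ r ≠ ∞ :=
    ENNReal.mul_ne_top ENNReal.ofReal_ne_top (ENNReal.rpow_ne_top_of_nonneg hr hY)
  have := ENNReal.toReal_mono h1 h
  rwa [ENNReal.toReal_mul, ENNReal.toReal_ofReal hc, ← ENNReal.toReal_rpow] at this

theorem exists_dyadicBounds_component {n : ℕ} (hn : 3 ≤ n) {p q : ℝ} (hp : 1 < p) (hq : 1 < q)
    {α₁ α₂ β ω : ℝ} (hβ : 1 < β) (hω : 2 < ω) {D V : E n → ℝ} (hD : IsCoefficient D α₁ β)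
    (hV : IsCoefficient V α₂ ω) {R : ℝ} (hR : 0 < R) {f₀ g₀ : E n → ℝ} (hdata : IsData f₀ g₀ R)
    {s CZ : ℝ} {Z Z₁ Z₂ Z₃ : ℝ → ℝ} (hZ : IsTimeCutoff s CZ Z Z₁ Z₂ Z₃) (hs : 1 / q ≤ s) {k₀ : ℕ}
    (hk₀ : 1 ≤ k₀) (hRk₀ : R ≤ 2 ^ k₀) :
    ∃ C : ℝ, 0 < C ∧ ∀ (ε : ℝ) (T : ℝ≥0∞) (u w : ℝ → L2 n), 0 ≤ ε →
      IsComponent T D V p ε R f₀ g₀ u w → ContinuousOn u (timeInterval T) → IsLocLp T q u →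
      ∀ N : ℕ, ENNReal.ofReal (2 ^ N) < T →
        DyadicBounds n q C ε k₀ N (fun k => (windowIntegral Z p w (2 ^ k)).toReal)
          (fun k => (windowIntegral Z q u (2 ^ k)).toReal) := by
  obtain ⟨Dp, Vp, α, β', ω', hP, hDp, hVp⟩ := exists_isProfilePair (by omega) hβ hω hD hV
  have hqq := Real.HolderConjugate.conjExponent hq
  obtain ⟨C, hC, hest⟩ := exists_window_estimates hn (zero_lt_one.trans hp) hqq hDp hVp hP hR hdata hZ hs
    rfl
  have hκ : 1 / q.conjExponent = 1 - 1 / q := by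
    have := hqq.inv_add_inv_eq_one
    rw [one_div, one_div]; linarith
  rw [hκ] at hest
  have hq1 : 0 ≤ 1 / q := by positivity
  refine ⟨C, hC, fun ε T u w hε hcomp hu hL N hN => ?_⟩
  have hT : ∀ k : ℕ, k ≤ N → ENNReal.ofReal (2 ^ k) < T := fun k hk =>
    (ENNReal.ofReal_le_ofReal (pow_le_pow_right₀ (by norm_num) hk)).trans_lt hN
  have hRk : ∀ k : ℕ, k₀ ≤ k → R ≤ 2 ^ k := fun k hk =>
    hRk₀.trans (pow_le_pow_right₀ (by norm_num) hk)
  have hfin : ∀ k : ℕ, k ≤ N → windowIntegral Z q u (2 ^ k) ≠ ∞ := fun k hk =>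
    (windowIntegral_lt_top hZ.le_one (by linarith) hcomp.2.1 hL (by positivity) (hT k hk)).ne
  have hfin' : ∀ k : ℕ, k ≤ N → windowIntegral Z p w (2 ^ k) ≠ ∞ := fun k hk =>
    (windowIntegral_lt_top hZ.le_one (by linarith) hcomp.2.2.1 hcomp.2.2.2.1 (by positivity)
      (hT k hk)).ne
  have hest' := fun k (h1 : k₀ ≤ k) (h2 : k ≤ N) =>
    hest ε T u w hε hcomp hu k (hk₀.trans h1) (hRk k h1) (hT k h2)
  constructor
  · exact fun k => ENNReal.toReal_nonneg
  · exact fun k => ENNReal.toReal_nonneg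
  · intro k h1 h2
    have := toReal_le_mul_rpow (by positivity) hq1 (hfin k h2) (hest' k h1 h2).1
    rwa [ENNReal.toReal_ofReal hε] at this
  · intro k h1 h2
    exact toReal_le_mul_rpow (by positivity) hq1 (hfin k h2) (hest' k h1 h2).2.1
  · intro k h1 h2
    refine le_trans ?_ (toReal_le_mul_rpow (by positivity) hq1 (hfin k h2) (hest' k h1 h2).2.2)
    rw [ENNReal.toReal_sum fun j hj => ENNReal.mul_ne_top ENNReal.ofReal_ne_top
      (hfin' j ((Nat.lt_succ_iff.1 (Finset.mem_range.1 hj)).trans h2))]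
    have hofReal : ∀ j : ℕ, (ENNReal.ofReal (((1 / 2) ^ j) ^ (((n : ℝ) - 1) / 2 - 1 / q))).toReal
        = ((1 / 2) ^ j) ^ (((n : ℝ) - 1) / 2 - 1 / q) := fun j =>
      ENNReal.toReal_ofReal (by positivity)
    simp only [ENNReal.toReal_mul, hofReal]
    refine Finset.sum_le_sum_of_subset_of_nonneg (fun j hj => ?_) fun j _ _ =>
      mul_nonneg (by positivity) ENNReal.toReal_nonneg
    rw [Finset.mem_Icc] at hj
    exact Finset.mem_range.2 (by omega)

/-- The bounds hold for both components, with common constants and a common first window `k₀`. -/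
theorem exists_dyadicBounds {n : ℕ} (hn : 3 ≤ n) {p q : ℝ} (hp : 1 < p) (hq : 1 < q)
    {α₁ α₂ β ω : ℝ} (hβ : 1 < β) (hω : 2 < ω) {D₁ D₂ V₁ V₂ : E n → ℝ}
    (hD₁ : IsCoefficient D₁ α₁ β) (hD₂ : IsCoefficient D₂ α₁ β) (hV₁ : IsCoefficient V₁ α₂ ω)
    (hV₂ : IsCoefficient V₂ α₂ ω) {R : ℝ} (hR : 0 < R) {u₀ u₁ v₀ v₁ : E n → ℝ}
    (hu : IsData u₀ u₁ R) (hv : IsData v₀ v₁ R) :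
    ∃ C : ℝ, 0 < C ∧ ∃ k₀ : ℕ, 1 ≤ k₀ ∧ ∀ (ε : ℝ) (T : ℝ≥0∞) (u v : ℝ → L2 n), 0 ≤ ε →
      IsWeakSolution p q D₁ D₂ V₁ V₂ R u₀ u₁ v₀ v₁ ε T u v →
      ∀ N : ℕ, ENNReal.ofReal (2 ^ N) < T →
        ∃ x y : ℕ → ℝ, DyadicBounds n q C ε k₀ N x y ∧ DyadicBounds n p C ε k₀ N y x := by
  obtain ⟨k, hk⟩ := pow_unbounded_of_one_lt R (by norm_num : (1 : ℝ) < 2)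
  have hRk : R ≤ 2 ^ (k + 1) := hk.le.trans (pow_le_pow_right₀ (by norm_num) (Nat.le_succ k))
  have hp1 : 1 / p < 1 := by rw [div_lt_one (by linarith)]; exact hp
  have hq1 : 1 / q < 1 := by rw [div_lt_one (by linarith)]; exact hq
  obtain ⟨CZ, Z, Z₁, Z₂, Z₃, -, hZ⟩ := exists_timeCutoff (s := max (1 / p) (1 / q))
    (le_max_of_le_left (by positivity)) (max_lt hp1 hq1)
  obtain ⟨A, hA, hA'⟩ := exists_dyadicBounds_component hn hp hq hβ hω hD₁ hV₁ hR hu hZ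
    (le_max_right _ _) (Nat.le_add_left 1 k) hRk
  obtain ⟨B, hB, hB'⟩ := exists_dyadicBounds_component hn hq hp hβ hω hD₂ hV₂ hR hv hZ
    (le_max_left _ _) (Nat.le_add_left 1 k) hRk
  refine ⟨A + B, by positivity, k + 1, Nat.le_add_left 1 k, fun ε T u v hε hsol N hN => ?_⟩
  obtain ⟨ut, vt, gu, gv, hEu, hEv, hLu, hLv, hAu, hAv, hFu, hFv, hWu, hWv⟩ := hsol
  exact ⟨_, _, (hA' ε T u v hε ⟨hEv.continuousOn, hFu, hFv, hLv, ut, gu, hEu, hAu, hWu⟩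
      hEu.continuousOn hLu N hN).mono (by linarith),
    (hB' ε T v u hε ⟨hEu.continuousOn, hFv, hFu, hLu, vt, gv, hEv, hAv, hWv⟩
      hEv.continuousOn hLv N hN).mono (by linarith)⟩

/-! ### From dyadic bounds to an upper bound for the existence time -/

theorem pos_and_log_le {X C τ a y r : ℝ} (hX : 0 < X) (hC : 0 < C) (hτ : 0 < τ) (hy : 0 ≤ y)
    (hr : 0 < r) (h : X ≤ C * τ ^ a * y ^ r) :
    0 < y ∧ Real.log X ≤ Real.log C + a * Real.log τ + r * Real.log y := by
  have hy0 : 0 < y := by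
    refine hy.lt_of_ne fun h0 => ?_
    rw [← h0, Real.zero_rpow hr.ne', mul_zero] at h
    linarith
  refine ⟨hy0, ?_⟩
  have := Real.log_le_log hX h
  rwa [Real.log_mul (by positivity) (by positivity), Real.log_mul (by positivity) (by positivity),
    Real.log_rpow hτ, Real.log_rpow hy0] at this

/-- Eliminating the masses `x`, `y` from the lower bound and the two one-window bounds leaves a
power of the time, whose exponent is one of the two branches of `Γ_SS`. -/
theorem DyadicBounds.data_le_rpow {n : ℕ} {p q C ε : ℝ} {k₀ N : ℕ} {x y : ℕ → ℝ}
    (h : DyadicBounds n q C ε k₀ N x y) (h' : DyadicBounds n p C ε k₀ N y x) (hp : 1 < p)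
    (hq : 1 < q) (hC : 0 < C) (hε : 0 < ε) {k : ℕ} (h1 : k₀ ≤ k) (h2 : k ≤ N) :
    ε ≤ C ^ (1 + (p + 1) / (p * q - 1)) *
      (2 ^ k) ^ (-((p + 2 + q⁻¹) / (p * q - 1) - ((n : ℝ) - 1) / 2)) := by
  have hτ : (0 : ℝ) < 2 ^ k := by positivity
  have hpq : 0 < p * q - 1 := by nlinarith
  obtain ⟨hy, e1⟩ := pos_and_log_le hε hC hτ (h.nonneg' k) (by positivity) (h.data_le k h1 h2)
  obtain ⟨hx, e2⟩ := pos_and_log_le hy hC hτ (h'.nonneg' k) (by positivity) (h'.window_le k h1 h2)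
  obtain ⟨-, e3⟩ := pos_and_log_le hx hC hτ (h.nonneg' k) (by positivity) (h.window_le k h1 h2)
  rw [← Real.log_le_log_iff hε (by positivity), Real.log_mul (by positivity) (by positivity),
    Real.log_rpow hC, Real.log_rpow hτ]
  generalize Real.log ε = E at *
  generalize Real.log C = L at *
  generalize Real.log (2 ^ k) = l at *
  generalize Real.log (y k) = η at *
  generalize Real.log (x k) = ξ at *
  obtain ⟨a, ha⟩ : ∃ a, a = -1 - ((n : ℝ) - 1) / 2 + n * (1 - 1 / q) := ⟨_, rfl⟩
  obtain ⟨b₁, hb₁⟩ : ∃ b₁, b₁ = -2 + ((n : ℝ) + 1) * (1 - 1 / p) := ⟨_, rfl⟩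
  obtain ⟨b₂, hb₂⟩ : ∃ b₂, b₂ = -2 + ((n : ℝ) + 1) * (1 - 1 / q) := ⟨_, rfl⟩
  rw [← ha] at e1
  rw [← hb₁] at e2
  rw [← hb₂] at e3
  have f1 : (p * q - 1) * η ≤ (p * q + q) * L + (p * q * b₁ + q * b₂) * l := by
    have g1 := mul_le_mul_of_nonneg_left e2 (by positivity : 0 ≤ p * q)
    have g2 := mul_le_mul_of_nonneg_left e3 (by positivity : 0 ≤ q)
    have g3 : p * q * (1 / p * ξ) = q * ξ := by field_simp
    have g4 : q * (1 / q * η) = η := by field_simp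
    linarith
  have f2 : 1 / q * ((p * q - 1) * η) ≤ (p + 1) * L + (p * b₁ + b₂) * l := by
    refine (mul_le_mul_of_nonneg_left f1 (by positivity)).trans (le_of_eq ?_)
    field_simp
  have f3 : (p * q - 1) * E ≤ (p * q - 1) * (L + a * l) + ((p + 1) * L + (p * b₁ + b₂) * l) := by
    have g1 := mul_le_mul_of_nonneg_left e1 hpq.le
    linarith
  have f4 : E ≤ (L + a * l) + ((p + 1) * L + (p * b₁ + b₂) * l) / (p * q - 1) := by
    rw [← mul_le_mul_iff_right₀ hpq]
    refine f3.trans (le_of_eq ?_)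
    field_simp
  refine f4.trans (le_of_eq ?_)
  rw [ha, hb₁, hb₂]
  obtain ⟨P, hP⟩ : ∃ P, P = p * q - 1 := ⟨_, rfl⟩
  rw [← hP] at hpq ⊢
  field_simp
  rw [hP]
  ring

/-- Convexity of `x ↦ x^(1-m)`: its graph lies above the tangent line at `y`. -/
theorem sub_le_rpow_sub_rpow {x y m : ℝ} (hx : 0 < x) (hy : 0 < y) (hm : 1 ≤ m) :
    (m - 1) * (y - x) / y ^ m ≤ x ^ (1 - m) - y ^ (1 - m) := by
  have h1 : 1 + (1 - m) * (x / y - 1) ≤ (x / y) ^ (1 - m) := by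
    rw [Real.rpow_def_of_pos (by positivity)]
    have h2 := Real.add_one_le_exp (Real.log (x / y) * (1 - m))
    have h3 := Real.log_le_sub_one_of_pos (by positivity : 0 < x / y)
    nlinarith
  have h4 : x ^ (1 - m) = (x / y) ^ (1 - m) * y ^ (1 - m) := by
    rw [← Real.mul_rpow (by positivity) hy.le, div_mul_cancel₀ _ hy.ne']
  have h5 : y ^ (1 - m) = y / y ^ m := by rw [Real.rpow_sub hy, Real.rpow_one]
  rw [h4]
  have h6 := mul_le_mul_of_nonneg_right h1 (Real.rpow_nonneg hy.le (1 - m))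
  refine le_trans (le_of_eq ?_) (sub_le_sub_right h6 _)
  rw [h5]
  field_simp
  ring

/-- A discrete differential inequality: if the partial sums `S_k` of a sequence `a_k ≥ δ` satisfy
`S_k^m ≤ c k^ν a_k`, that is `S' ≥ c⁻¹ k^(-ν) S^m`, then the sequence cannot be long. -/
theorem rpow_le_of_partial_sums {m ν c δ : ℝ} (hm : 1 < m) (hν : 0 ≤ ν) (hc : 0 < c) (hδ : 0 < δ)
    {k₀ K : ℕ} (hk₀ : 1 ≤ k₀) (hK : 2 * k₀ ≤ K) {a : ℕ → ℝ}
    (ha : ∀ k, k₀ ≤ k → k ≤ 2 * K → δ ≤ a k)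
    (hS : ∀ k, k₀ ≤ k → k ≤ 2 * K →
      (∑ j ∈ Finset.Icc k₀ k, a j) ^ m ≤ c * (k : ℝ) ^ ν * a k) :
    (K : ℝ) ^ (m - ν) ≤ 2 ^ (m - 1 + ν) * c / (m - 1) * δ ^ (1 - m) := by
  obtain ⟨S, hSdef⟩ : ∃ S : ℕ → ℝ, S = fun k => ∑ j ∈ Finset.Icc k₀ k, a j := ⟨_, rfl⟩
  have hK0 : (0 : ℝ) < K := by exact_mod_cast (by omega : 0 < K)
  have hSlow : ∀ k, k₀ ≤ k → k ≤ 2 * K → ((k : ℝ) + 1 - k₀) * δ ≤ S k := by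
    intro k h1 h2
    have h3 : (Finset.Icc k₀ k).card • δ ≤ ∑ j ∈ Finset.Icc k₀ k, a j := by
      refine Finset.card_nsmul_le_sum _ _ _ fun j hj => ?_
      rw [Finset.mem_Icc] at hj
      exact ha j hj.1 (hj.2.trans h2)
    rw [Nat.card_Icc, nsmul_eq_mul, Nat.cast_sub (by omega)] at h3
    push_cast at h3
    rwa [hSdef]
  have hSpos : ∀ k, k₀ ≤ k → k ≤ 2 * K → 0 < S k := fun k h1 h2 =>
    lt_of_lt_of_le (mul_pos (by have : (k₀ : ℝ) ≤ k := by exact_mod_cast h1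
                                linarith) hδ) (hSlow k h1 h2)
  have hstep : ∀ k, k₀ ≤ k → k + 1 ≤ 2 * K →
      (m - 1) / (c * (2 * K) ^ ν) ≤ S k ^ (1 - m) - S (k + 1) ^ (1 - m) := by
    intro k h1 h2
    have hp1 := hSpos k h1 (by omega)
    have hp2 := hSpos (k + 1) (by omega) h2
    have hdiff : S (k + 1) - S k = a (k + 1) := by
      rw [hSdef]
      simp only
      rw [← Finset.insert_Icc_right_eq_Icc_add_one (by omega), Finset.sum_insert (by simp)]
      ring
    have h3 := hS (k + 1) (by omega) h2
    have h4 : a (k + 1) > 0 := lt_of_lt_of_le hδ (ha _ (by omega) h2)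
    refine le_trans ?_ (sub_le_rpow_sub_rpow hp1 hp2 hm.le)
    rw [hdiff, div_le_div_iff₀ (by positivity) (by positivity), mul_assoc]
    refine mul_le_mul_of_nonneg_left ?_ (by linarith)
    have h5 : (∑ j ∈ Finset.Icc k₀ (k + 1), a j) = S (k + 1) := by rw [hSdef]
    rw [h5] at h3
    refine h3.trans ?_
    rw [mul_comm (a (k + 1))]
    refine mul_le_mul_of_nonneg_right (mul_le_mul_of_nonneg_left ?_ hc.le) h4.le
    refine Real.rpow_le_rpow (by positivity) ?_ hν
    exact_mod_cast h2
  -- Summing from `K` to `2 K` instead of from `k₀` starts with `S_K ≥ δ K / 2`, which improves the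
  -- final power of `K` from `1 - ν` to `m - ν`; in the critical case `ν ≥ 1` is possible.
  have hsum : ∀ i : ℕ, i ≤ K →
      i * ((m - 1) / (c * (2 * K) ^ ν)) ≤ S K ^ (1 - m) - S (K + i) ^ (1 - m) := by
    intro i
    induction i with
    | zero => intro _; simp
    | succ i ih =>
      intro hi
      have h1 := ih (by omega)
      have h2 := hstep (K + i) (by omega) (by omega)
      push_cast
      rw [← add_assoc]
      linarith
  have h1 := hsum K le_rfl
  have h2 : 0 < S (K + K) := hSpos _ (by omega) (by omega)
  have h3 : (K : ℝ) / 2 * δ ≤ S K := by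
    refine le_trans (mul_le_mul_of_nonneg_right ?_ hδ.le) (hSlow K (by omega) (by omega))
    have : (2 * k₀ : ℝ) ≤ K := by exact_mod_cast hK
    linarith
  have h4 : S K ^ (1 - m) ≤ ((K : ℝ) / 2 * δ) ^ (1 - m) :=
    Real.rpow_le_rpow_of_nonpos (by positivity) h3 (by linarith)
  have h5 : K * ((m - 1) / (c * (2 * K) ^ ν)) ≤ ((K : ℝ) / 2 * δ) ^ (1 - m) := by
    have := Real.rpow_nonneg h2.le (1 - m)
    linarith
  have hm' : 0 < m - 1 := by linarith
  rw [Real.mul_rpow (by positivity) hδ.le, Real.div_rpow hK0.le (by norm_num),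
    Real.mul_rpow (by norm_num) hK0.le] at h5
  have e1 : (K : ℝ) ^ (m - ν) = K * ((m - 1) / (c * (2 ^ ν * K ^ ν))) *
      (c * 2 ^ ν * K ^ (m - 1) / (m - 1)) := by
    rw [show m - ν = 1 + (m - 1) - ν by ring, Real.rpow_sub hK0, Real.rpow_add hK0, Real.rpow_one]
    field_simp
  rw [e1]
  refine (mul_le_mul_of_nonneg_right h5 (by positivity)).trans (le_of_eq ?_)
  have e2 : (K : ℝ) ^ (1 - m) * K ^ (m - 1) = 1 := by
    rw [← Real.rpow_add hK0]; simp
  have e3 : ((2 : ℝ) ^ (1 - m))⁻¹ = 2 ^ (m - 1) := by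
    rw [← Real.rpow_neg (by norm_num)]; congr 1; ring
  rw [Real.rpow_add (by norm_num), ← e3]
  field_simp
  linear_combination e2

/-- In the normalisation `z k = 2^(-k(n - μq)) y k`, `μ = (n-1)/2`, the lower bound and the sum
over the windows have no power of the time. -/
theorem DyadicBounds.normalized {n : ℕ} {q C ε : ℝ} {k₀ N : ℕ} {x y : ℕ → ℝ}
    (h : DyadicBounds n q C ε k₀ N x y) (hq : 1 < q) {z : ℕ → ℝ}
    (hz : ∀ k, z k = y k * (2 ^ k) ^ (-((n : ℝ) - ((n : ℝ) - 1) / 2 * q))) {k : ℕ} (h1 : k₀ ≤ k)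
    (h2 : k ≤ N) :
    ε ≤ C * z k ^ (1 / q) ∧
    ∑ j ∈ Finset.Icc k₀ k, ((1 / 2) ^ j) ^ (((n : ℝ) - 1) / 2 - 1 / q) * x j ≤
      C * (k : ℝ) ^ (1 - 1 / q) * z k ^ (1 / q) := by
  have hτ : (0 : ℝ) < 2 ^ k := by positivity
  have key : z k ^ (1 / q)
      = (2 ^ k) ^ (-1 - ((n : ℝ) - 1) / 2 + n * (1 - 1 / q)) * y k ^ (1 / q) := by
    rw [hz, Real.mul_rpow (h.nonneg' k) (by positivity), ← Real.rpow_mul hτ.le, mul_comm]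
    congr 2
    field_simp
    ring
  constructor
  · rw [key, ← mul_assoc]
    exact h.data_le k h1 h2
  · refine (h.sum_le k h1 h2).trans (le_of_eq ?_)
    rw [key]
    ring

/-- The critical case on the branch `p + 2 + 1/q` of `Γ_SS`: the partial sums of `z_k^p` satisfy
the discrete differential inequality with `m = pq` and `ν = p(q-1)`. -/
theorem exists_le_of_critical {n : ℕ} {p q C : ℝ} (hp : 1 < p) (hq : 1 < q) (hC : 0 < C)
    (hcrit : (p + 2 + q⁻¹) / (p * q - 1) = ((n : ℝ) - 1) / 2) :
    ∃ A : ℝ, 0 < A ∧ ∀ (ε : ℝ) (k₀ N : ℕ) (x y : ℕ → ℝ), 0 < ε →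
      DyadicBounds n q C ε k₀ N x y → DyadicBounds n p C ε k₀ N y x →
      ∀ K : ℕ, 1 ≤ k₀ → 2 * k₀ ≤ K → 2 * K ≤ N → (K : ℝ) ≤ A * ε ^ (-(q * (p * q - 1))) := by
  have hp0 : 0 < p := by linarith
  have hq0 : 0 < q := by linarith
  have hm : 1 < p * q := by nlinarith
  have hm' : 0 < p * q - 1 := by linarith
  obtain ⟨c, hc⟩ : ∃ c, c = (C ^ p * C) ^ (p * q) := ⟨_, rfl⟩
  have hc0 : 0 < c := by rw [hc]; positivity
  obtain ⟨B, hB⟩ : ∃ B, B = 2 ^ (p * q - 1 + p * (q - 1)) * c / (p * q - 1) := ⟨_, rfl⟩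
  have hB0 : 0 < B := by rw [hB]; positivity
  refine ⟨B ^ (1 / p) * C ^ (q * (p * q - 1)), by positivity,
    fun ε k₀ N x y hε h h' K hk₀ hK hKN => ?_⟩
  obtain ⟨z, hz⟩ : ∃ z : ℕ → ℝ, z = fun k =>
    y k * (2 ^ k) ^ (-((n : ℝ) - ((n : ℝ) - 1) / 2 * q)) := ⟨_, rfl⟩
  have hz' : ∀ k, z k = y k * (2 ^ k) ^ (-((n : ℝ) - ((n : ℝ) - 1) / 2 * q)) := fun k => by rw [hz]
  have hz0 : ∀ k, 0 ≤ z k := fun k => by rw [hz']; exact mul_nonneg (h.nonneg' k) (by positivity)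
  have hzp : ∀ k, (z k ^ (1 / q)) ^ (p * q) = z k ^ p := fun k => by
    rw [← Real.rpow_mul (hz0 k)]
    congr 1
    field_simp
  -- criticality makes the powers of `2^j` in `z j ^ p` and in the weighted sum agree
  have hterm : ∀ j, k₀ ≤ j → j ≤ N →
      z j ^ p ≤ C ^ p * (((1 / 2) ^ j) ^ (((n : ℝ) - 1) / 2 - 1 / q) * x j) := by
    intro j h1 h2
    have hτ : (0 : ℝ) < 2 ^ j := by positivity
    have e1 := mul_le_mul_of_nonneg_right (h'.window_le j h1 h2)
      (by positivity : (0 : ℝ) ≤ (2 ^ j) ^ (-((n : ℝ) - ((n : ℝ) - 1) / 2 * q)))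
    rw [← hz'] at e1
    refine (Real.rpow_le_rpow (hz0 j) e1 hp0.le).trans (le_of_eq ?_)
    have hx := h'.nonneg' j
    rw [Real.mul_rpow (by positivity) (by positivity), Real.mul_rpow (by positivity) (by positivity),
      Real.mul_rpow hC.le (by positivity), ← Real.rpow_mul hx, one_div_mul_cancel hp0.ne',
      Real.rpow_one, one_div (2 : ℝ), inv_pow, Real.inv_rpow hτ.le, ← Real.rpow_neg hτ.le,
      ← Real.rpow_mul hτ.le, ← Real.rpow_mul hτ.le]
    have e2 : (-2 + ((n : ℝ) + 1) * (1 - 1 / p)) * p + -((n : ℝ) - ((n : ℝ) - 1) / 2 * q) * p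
        = -(((n : ℝ) - 1) / 2 - 1 / q) := by
      have e3 : ((n : ℝ) - 1) / 2 * (p * q - 1) = p + 2 + 1 / q := by
        rw [← hcrit]; field_simp
      have e4 : (1 - 1 / p) * p = p - 1 := by field_simp
      linear_combination e3 + ((n : ℝ) + 1) * e4
    rw [← e2, Real.rpow_add hτ]
    ring
  have hgrow := rpow_le_of_partial_sums (m := p * q) (ν := p * (q - 1)) (c := c)
    (δ := (ε / C) ^ (p * q)) (a := fun k => z k ^ p) hm (mul_nonneg hp0.le (by linarith)) hc0
    (by positivity) hk₀ hK
    (fun k h1 h2 => by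
      have e1 := (h.normalized hq hz' h1 (h2.trans hKN)).1
      rw [← hzp]
      refine Real.rpow_le_rpow (by positivity) ?_ (by positivity)
      rw [div_le_iff₀ hC]
      linarith)
    (fun k h1 h2 => by
      have hsum : ∑ j ∈ Finset.Icc k₀ k, z j ^ p
          ≤ C ^ p * (C * (k : ℝ) ^ (1 - 1 / q) * z k ^ (1 / q)) := by
        refine (Finset.sum_le_sum fun j hj => hterm j (Finset.mem_Icc.1 hj).1
          ((Finset.mem_Icc.1 hj).2.trans (h2.trans hKN))).trans ?_
        rw [← Finset.mul_sum]
        exact mul_le_mul_of_nonneg_left (h.normalized hq hz' h1 (h2.trans hKN)).2 (by positivity)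
      have hzk := hz0 k
      refine (Real.rpow_le_rpow (Finset.sum_nonneg fun j _ => Real.rpow_nonneg (hz0 j) _) hsum
        (by positivity)).trans (le_of_eq ?_)
      rw [show C ^ p * (C * (k : ℝ) ^ (1 - 1 / q) * z k ^ (1 / q))
          = C ^ p * C * (k : ℝ) ^ (1 - 1 / q) * z k ^ (1 / q) by ring,
        Real.mul_rpow (by positivity) (by positivity), hzp,
        Real.mul_rpow (by positivity) (by positivity), ← hc, ← Real.rpow_mul (Nat.cast_nonneg k)]
      congr 3
      field_simp)
  rw [← hB, show p * q - p * (q - 1) = p by ring] at hgrow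
  have e1 : (K : ℝ) = ((K : ℝ) ^ p) ^ (1 / p) := by
    rw [← Real.rpow_mul (Nat.cast_nonneg K), mul_one_div_cancel hp0.ne', Real.rpow_one]
  rw [e1]
  refine (Real.rpow_le_rpow (by positivity) hgrow (by positivity)).trans (le_of_eq ?_)
  rw [Real.mul_rpow hB0.le (by positivity), ← Real.rpow_mul (by positivity),
    ← Real.rpow_mul (by positivity), mul_assoc (B ^ (1 / p))]
  congr 1
  rw [show p * q * ((1 - p * q) * (1 / p)) = -(q * (p * q - 1)) by field_simp; ring,
    Real.div_rpow hε.le hC.le, Real.rpow_neg hC.le, div_inv_eq_mul, mul_comm]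

/-- The critical case with equal powers: now the sum of the masses of both components is used, and
`m = p`, `ν = p - 1`. -/
theorem exists_le_of_critical_eq {n : ℕ} {p C : ℝ} (hp : 1 < p) (hC : 0 < C)
    (hcrit : (p + 2 + p⁻¹) / (p * p - 1) = ((n : ℝ) - 1) / 2) :
    ∃ A : ℝ, 0 < A ∧ ∀ (ε : ℝ) (k₀ N : ℕ) (x y : ℕ → ℝ), 0 < ε →
      DyadicBounds n p C ε k₀ N x y → DyadicBounds n p C ε k₀ N y x →
      ∀ K : ℕ, 1 ≤ k₀ → 2 * k₀ ≤ K → 2 * K ≤ N → (K : ℝ) ≤ A * ε ^ (-(p * (p - 1))) := by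
  have hp0 : 0 < p := by linarith
  have hm' : 0 < p - 1 := by linarith
  obtain ⟨c, hc⟩ : ∃ c, c = (2 * C) ^ p := ⟨_, rfl⟩
  have hc0 : 0 < c := by rw [hc]; positivity
  obtain ⟨B, hB⟩ : ∃ B, B = 2 ^ (p - 1 + (p - 1)) * c / (p - 1) := ⟨_, rfl⟩
  have hB0 : 0 < B := by rw [hB]; positivity
  refine ⟨B * C ^ (p * (p - 1)), by positivity, fun ε k₀ N x y hε h h' K hk₀ hK hKN => ?_⟩
  obtain ⟨σ, hσ⟩ : ∃ σ, σ = -((n : ℝ) - ((n : ℝ) - 1) / 2 * p) := ⟨_, rfl⟩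
  obtain ⟨X, hX⟩ : ∃ X : ℕ → ℝ, ∀ k, X k = x k * (2 ^ k) ^ σ := ⟨_, fun _ => rfl⟩
  obtain ⟨Y, hY⟩ : ∃ Y : ℕ → ℝ, ∀ k, Y k = y k * (2 ^ k) ^ σ := ⟨_, fun _ => rfl⟩
  have hX0 : ∀ k, 0 ≤ X k := fun k => by rw [hX]; exact mul_nonneg (h.nonneg k) (by positivity)
  have hY0 : ∀ k, 0 ≤ Y k := fun k => by rw [hY]; exact mul_nonneg (h.nonneg' k) (by positivity)
  -- for `p = q` and `Γ_SS = 0` the weights of the sum are those of the normalisation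
  have hweight : ∀ j : ℕ, (((1 : ℝ) / 2) ^ j) ^ (((n : ℝ) - 1) / 2 - 1 / p) = (2 ^ j) ^ σ := by
    intro j
    have hτ : (0 : ℝ) < 2 ^ j := by positivity
    rw [one_div, inv_pow, Real.inv_rpow hτ.le, ← Real.rpow_neg hτ.le, hσ]
    have hne : p * p - 1 ≠ 0 := by nlinarith
    have e3 : p * (((n : ℝ) - 1) / 2 * (p * p - 1)) = (p + 1) * (p + 1) := by
      rw [← hcrit, div_mul_cancel₀ _ hne]; field_simp; ring
    have e4 : p * (((n : ℝ) - 1) / 2) * (p - 1) = p + 1 := by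
      refine mul_left_cancel₀ (by linarith : p + 1 ≠ 0) ?_
      linear_combination e3
    congr 1
    field_simp
    linear_combination (-2) * e4
  have hbd : ∀ k, k₀ ≤ k → k ≤ N → (ε ≤ C * Y k ^ (1 / p) ∧ ∑ j ∈ Finset.Icc k₀ k, X j ≤
      C * (k : ℝ) ^ (1 - 1 / p) * Y k ^ (1 / p)) ∧ (ε ≤ C * X k ^ (1 / p) ∧
      ∑ j ∈ Finset.Icc k₀ k, Y j ≤ C * (k : ℝ) ^ (1 - 1 / p) * X k ^ (1 / p)) := by
    intro k h1 h2
    have e1 := h.normalized hp (z := Y) (fun k => by rw [hY, hσ]) h1 h2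
    have e2 := h'.normalized hp (z := X) (fun k => by rw [hX, hσ]) h1 h2
    simp only [hweight] at e1 e2
    simp only [mul_comm _ (x _), mul_comm _ (y _), ← hX, ← hY] at e1 e2
    exact ⟨e1, e2⟩
  have hgrow := rpow_le_of_partial_sums (m := p) (ν := p - 1) (c := c)
    (δ := (ε / C) ^ p) (a := fun k => X k + Y k) hp (by linarith) hc0
    (by positivity) hk₀ hK
    (fun k h1 h2 => by
      have e1 := (hbd k h1 (h2.trans hKN)).1.1
      have e2 : ε / C ≤ Y k ^ (1 / p) := by
        rw [div_le_iff₀ hC]; linarith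
      have e3 := Real.rpow_le_rpow (by positivity) e2 hp0.le
      rw [← Real.rpow_mul (hY0 k), one_div_mul_cancel hp0.ne', Real.rpow_one] at e3
      linarith [hX0 k])
    (fun k h1 h2 => by
      obtain ⟨⟨-, e1⟩, -, e2⟩ := hbd k h1 (h2.trans hKN)
      have hle : ∀ w, 0 ≤ w → w ≤ X k + Y k →
          C * (k : ℝ) ^ (1 - 1 / p) * w ^ (1 / p) ≤
            C * (k : ℝ) ^ (1 - 1 / p) * (X k + Y k) ^ (1 / p) := fun w hw hw' =>
        mul_le_mul_of_nonneg_left (Real.rpow_le_rpow hw hw' (by positivity)) (by positivity)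
      have hsum : ∑ j ∈ Finset.Icc k₀ k, (X j + Y j)
          ≤ 2 * C * (k : ℝ) ^ (1 - 1 / p) * (X k + Y k) ^ (1 / p) := by
        rw [Finset.sum_add_distrib]
        linarith [hle _ (hX0 k) (by linarith [hY0 k]), hle _ (hY0 k) (by linarith [hX0 k])]
      have hXY : 0 ≤ X k + Y k := add_nonneg (hX0 k) (hY0 k)
      refine (Real.rpow_le_rpow (Finset.sum_nonneg fun j _ => add_nonneg (hX0 j) (hY0 j)) hsum
        (by positivity)).trans (le_of_eq ?_)
      rw [Real.mul_rpow (by positivity) (by positivity),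
        Real.mul_rpow (by positivity) (by positivity), ← hc, ← Real.rpow_mul (Nat.cast_nonneg k),
        ← Real.rpow_mul hXY, one_div_mul_cancel hp0.ne', Real.rpow_one]
      congr 3
      field_simp)
  rw [← hB, show p - (p - 1) = 1 by ring, Real.rpow_one] at hgrow
  refine hgrow.trans (le_of_eq ?_)
  rw [← Real.rpow_mul (by positivity), mul_assoc]
  congr 1
  rw [show p * (1 - p) = -(p * (p - 1)) by ring,
    Real.div_rpow hε.le hC.le, Real.rpow_neg hC.le, div_inv_eq_mul, mul_comm]

section

/-! ### Bounds for the lifespan -/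

/-- Only dyadic times below `T` can be tested, at the cost of a factor `2` in the bound for `T`; the
term `2^k₀` covers solutions that end before the first admissible window. -/
theorem le_ofReal_of_pow_le {T : ℝ≥0∞} {A : ℝ} {k₀ : ℕ} (hA : 0 ≤ A)
    (h : ∀ N : ℕ, k₀ ≤ N → ENNReal.ofReal (2 ^ N) < T → (2 : ℝ) ^ N ≤ A) :
    T ≤ ENNReal.ofReal (2 ^ k₀ + 2 * A) := by
  by_contra hT
  rw [not_le] at hT
  have h1 : (1 : ℝ) ≤ 2 ^ k₀ := one_le_pow₀ (by norm_num)
  obtain ⟨N, hN1, hN2⟩ := exists_nat_pow_near (x := (2 : ℝ) ^ k₀ + 2 * A) (y := 2) (by linarith)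
    (by norm_num)
  have hN : k₀ ≤ N := by
    have : (2 : ℝ) ^ k₀ < 2 ^ (N + 1) := by linarith
    exact Nat.lt_succ_iff.1 ((pow_lt_pow_iff_right₀ (by norm_num)).1 this)
  have h2 := h N hN ((ENNReal.ofReal_le_ofReal hN1).trans_lt hT)
  rw [pow_succ] at hN2
  linarith

/-- The bound is stated with `1 + ε^(-1/Γ)`, so that it holds for all `ε > 0`; for `ε < 1` the `1` is
absorbed. -/
theorem le_ofReal_of_data_le {T : ℝ≥0∞} {Γ C ε : ℝ} {k₀ : ℕ} (hΓ : 0 < Γ) (hC : 0 < C) (hε : 0 < ε)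
    (h : ∀ N : ℕ, k₀ ≤ N → ENNReal.ofReal (2 ^ N) < T → ε ≤ C * (2 ^ N) ^ (-Γ)) :
    T ≤ ENNReal.ofReal ((2 ^ k₀ + 2 * C ^ Γ⁻¹) * (1 + ε ^ (-Γ⁻¹))) := by
  refine (le_ofReal_of_pow_le (A := C ^ Γ⁻¹ * ε ^ (-Γ⁻¹)) (k₀ := k₀) (by positivity)
    fun N hN hNT => ?_).trans (ENNReal.ofReal_le_ofReal ?_)
  · have h1 := h N hN hNT
    have hτ : (0 : ℝ) < 2 ^ N := by positivity
    have h2 : ((2 : ℝ) ^ N) ^ Γ ≤ C * ε⁻¹ := by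
      rw [Real.rpow_neg hτ.le] at h1
      rw [← div_eq_mul_inv, le_div_iff₀ hε]
      calc ((2 : ℝ) ^ N) ^ Γ * ε ≤ ((2 : ℝ) ^ N) ^ Γ * (C * (((2 : ℝ) ^ N) ^ Γ)⁻¹) := by gcongr
        _ = C := by field_simp
    have h3 := Real.rpow_le_rpow (by positivity) h2 (inv_nonneg.2 hΓ.le)
    rwa [← Real.rpow_mul hτ.le, mul_inv_cancel₀ hΓ.ne', Real.rpow_one,
      Real.mul_rpow hC.le (by positivity), Real.inv_rpow hε.le, ← Real.rpow_neg hε.le] at h3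
  · have h1 : (0 : ℝ) < 2 ^ k₀ := by positivity
    have h2 : 0 < C ^ Γ⁻¹ := by positivity
    have h3 : 0 < ε ^ (-Γ⁻¹) := by positivity
    nlinarith [mul_pos h1 h3]

theorem le_ofReal_exp_of_le {T : ℝ≥0∞} {A e ε : ℝ} {k₀ : ℕ} (hA : 0 < A) (hε : 0 < ε)
    (h : ∀ K : ℕ, 2 * k₀ ≤ K → ENNReal.ofReal (2 ^ (2 * K)) < T → (K : ℝ) ≤ A * ε ^ (-e)) :
    T ≤ ENNReal.ofReal (Real.exp ((4 * k₀ + 3 + 2 * A) * (1 + ε ^ (-e)))) := by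
  obtain ⟨X, hX⟩ : ∃ X, X = ε ^ (-e) := ⟨_, rfl⟩
  have hX0 : 0 < X := by rw [hX]; positivity
  rw [← hX] at h ⊢
  have h2e : (2 : ℝ) ≤ Real.exp 1 := by linarith [Real.add_one_le_exp (1 : ℝ)]
  have hpow : ∀ m : ℕ, (2 : ℝ) ^ m ≤ Real.exp m := fun m => by
    rw [← mul_one (m : ℝ), Real.exp_nat_mul]
    exact pow_le_pow_left₀ (by norm_num) h2e m
  refine (le_ofReal_of_pow_le (A := Real.exp (2 * A * X + 1)) (k₀ := 4 * k₀) (by positivity)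
    fun N hN hNT => ?_).trans (ENNReal.ofReal_le_ofReal ?_)
  · have h1 := h (N / 2) (by omega) ((ENNReal.ofReal_le_ofReal
      (pow_le_pow_right₀ (by norm_num) (by omega))).trans_lt hNT)
    refine (hpow N).trans (Real.exp_le_exp.2 ?_)
    have h3 : (N : ℝ) ≤ 2 * ((N / 2 : ℕ) : ℝ) + 1 := by exact_mod_cast (by omega)
    linarith
  · have e1 : (2 : ℝ) ^ (4 * k₀) ≤ Real.exp ((4 * k₀ + 2 * A) * (1 + X) + 2) := by
      refine (hpow _).trans (Real.exp_le_exp.2 ?_)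
      have : (0 : ℝ) ≤ k₀ := Nat.cast_nonneg _
      push_cast
      nlinarith [mul_nonneg this hX0.le, mul_pos hA hX0]
    have e2 : 2 * Real.exp (2 * A * X + 1) ≤ Real.exp ((4 * k₀ + 2 * A) * (1 + X) + 2) := by
      calc 2 * Real.exp (2 * A * X + 1) ≤ Real.exp 1 * Real.exp (2 * A * X + 1) := by gcongr
        _ = Real.exp (1 + (2 * A * X + 1)) := by rw [← Real.exp_add]
        _ ≤ _ := by
          refine Real.exp_le_exp.2 ?_
          have : (0 : ℝ) ≤ k₀ := Nat.cast_nonneg _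
          nlinarith [mul_nonneg this hX0.le, mul_pos hA hX0]
    calc _ ≤ 2 * Real.exp ((4 * k₀ + 2 * A) * (1 + X) + 2) := by linarith
      _ ≤ Real.exp 1 * Real.exp ((4 * k₀ + 2 * A) * (1 + X) + 2) := by gcongr
      _ = Real.exp (1 + ((4 * k₀ + 2 * A) * (1 + X) + 2)) := by rw [← Real.exp_add]
      _ ≤ _ := by
          refine Real.exp_le_exp.2 ?_
          linarith

section

variable {n : ℕ} {p q : ℝ} {α₁ α₂ β ω : ℝ} {D₁ D₂ V₁ V₂ : E n → ℝ} {R : ℝ}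
  {u₀ u₁ v₀ v₁ : E n → ℝ}

theorem exists_le_of_gammaSS_pos (hn : 3 ≤ n) (hp : 1 < p) (hq : 1 < q) (hβ : 1 < β) (hω : 2 < ω)
    (hD₁ : IsCoefficient D₁ α₁ β) (hD₂ : IsCoefficient D₂ α₁ β) (hV₁ : IsCoefficient V₁ α₂ ω)
    (hV₂ : IsCoefficient V₂ α₂ ω) (hR : 0 < R) (hu : IsData u₀ u₁ R) (hv : IsData v₀ v₁ R)
    (hΓ : 0 < gammaSS n p q) :
    ∃ A : ℝ, 0 < A ∧ ∀ (ε : ℝ) (T : ℝ≥0∞) (u v : ℝ → L2 n), 0 < ε →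
      IsWeakSolution p q D₁ D₂ V₁ V₂ R u₀ u₁ v₀ v₁ ε T u v →
      T ≤ ENNReal.ofReal (A * (1 + ε ^ (-(gammaSS n p q)⁻¹))) := by
  obtain ⟨C, hC, k₀, hk₀, hbd⟩ := exists_dyadicBounds hn hp hq hβ hω hD₁ hD₂ hV₁ hV₂ hR hu hv
  obtain ⟨c₁, hc₁⟩ : ∃ c₁, c₁ = C ^ (1 + (p + 1) / (p * q - 1)) := ⟨_, rfl⟩
  obtain ⟨c₂, hc₂⟩ : ∃ c₂, c₂ = C ^ (1 + (q + 1) / (q * p - 1)) := ⟨_, rfl⟩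
  have hc₁0 : 0 < c₁ := by rw [hc₁]; positivity
  have hc₂0 : 0 < c₂ := by rw [hc₂]; positivity
  refine ⟨_, by positivity, fun ε T u v hε hsol => le_ofReal_of_data_le (k₀ := k₀) hΓ
    (add_pos hc₁0 hc₂0) hε fun N hN hNT => ?_⟩
  obtain ⟨x, y, h, h'⟩ := hbd ε T u v hε.le hsol N hNT
  have e1 := h.data_le_rpow h' hp hq hC hε hN le_rfl
  have e2 := h'.data_le_rpow h hq hp hC hε hN le_rfl
  rw [← hc₁] at e1
  rw [← hc₂, mul_comm q p] at e2
  have hτ : (0 : ℝ) < 2 ^ N := by positivity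
  rw [gammaSS]
  rcases max_choice ((p + 2 + q⁻¹) / (p * q - 1)) ((q + 2 + p⁻¹) / (p * q - 1)) with hm | hm
  · rw [hm]
    exact e1.trans (mul_le_mul_of_nonneg_right (by linarith) (by positivity))
  · rw [hm]
    exact e2.trans (mul_le_mul_of_nonneg_right (by linarith) (by positivity))

theorem exists_le_of_gammaSS_eq_zero (hn : 3 ≤ n) (hp : 1 < p) (hq : 1 < q) (hβ : 1 < β)
    (hω : 2 < ω) (hD₁ : IsCoefficient D₁ α₁ β) (hD₂ : IsCoefficient D₂ α₁ β)
    (hV₁ : IsCoefficient V₁ α₂ ω) (hV₂ : IsCoefficient V₂ α₂ ω) (hR : 0 < R) (hu : IsData u₀ u₁ R)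
    (hv : IsData v₀ v₁ R) (hΓ : gammaSS n p q = 0) :
    ∃ A : ℝ, 0 < A ∧ ∀ (ε : ℝ) (T : ℝ≥0∞) (u v : ℝ → L2 n), 0 < ε →
      IsWeakSolution p q D₁ D₂ V₁ V₂ R u₀ u₁ v₀ v₁ ε T u v →
      T ≤ ENNReal.ofReal (Real.exp
        (A * (1 + ε ^ (-(min (p * (p * q - 1)) (q * (p * q - 1))))))) := by
  obtain ⟨C, hC, k₀, hk₀, hbd⟩ := exists_dyadicBounds hn hp hq hβ hω hD₁ hD₂ hV₁ hV₂ hR hu hv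
  have hpq : 0 < p * q - 1 := by nlinarith
  rw [gammaSS, sub_eq_zero] at hΓ
  -- the maximum in `Γ_SS` is attained on the branch with the larger power in the numerator
  rcases le_total q p with hqp | hqp
  · have hinv : p⁻¹ ≤ q⁻¹ := inv_anti₀ (by linarith) hqp
    have hle : (q + 2 + p⁻¹) / (p * q - 1) ≤ (p + 2 + q⁻¹) / (p * q - 1) :=
      div_le_div_of_nonneg_right (by linarith) hpq.le
    rw [max_eq_left hle] at hΓ
    obtain ⟨A, hA, hA'⟩ := exists_le_of_critical hp hq hC hΓ
    rw [min_eq_right (mul_le_mul_of_nonneg_right hqp hpq.le)]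
    refine ⟨_, by positivity, fun ε T u v hε hsol => le_ofReal_exp_of_le (k₀ := k₀) hA hε
      fun K hK hKT => ?_⟩
    obtain ⟨x, y, h, h'⟩ := hbd ε T u v hε.le hsol _ hKT
    exact hA' ε k₀ _ x y hε h h' K hk₀ hK le_rfl
  · have hinv : q⁻¹ ≤ p⁻¹ := inv_anti₀ (by linarith) hqp
    have hle : (p + 2 + q⁻¹) / (p * q - 1) ≤ (q + 2 + p⁻¹) / (p * q - 1) :=
      div_le_div_of_nonneg_right (by linarith) hpq.le
    rw [max_eq_right hle, mul_comm p q] at hΓ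
    obtain ⟨A, hA, hA'⟩ := exists_le_of_critical hq hp hC hΓ
    rw [min_eq_left (mul_le_mul_of_nonneg_right hqp hpq.le), mul_comm p q]
    refine ⟨_, by positivity, fun ε T u v hε hsol => le_ofReal_exp_of_le (k₀ := k₀) hA hε
      fun K hK hKT => ?_⟩
    obtain ⟨x, y, h, h'⟩ := hbd ε T u v hε.le hsol _ hKT
    exact hA' ε k₀ _ y x hε h' h K hk₀ hK le_rfl

theorem exists_le_of_gammaSS_eq_zero_of_eq (hn : 3 ≤ n) (hp : 1 < p) (hβ : 1 < β)
    (hω : 2 < ω) (hD₁ : IsCoefficient D₁ α₁ β) (hD₂ : IsCoefficient D₂ α₁ β)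
    (hV₁ : IsCoefficient V₁ α₂ ω) (hV₂ : IsCoefficient V₂ α₂ ω) (hR : 0 < R) (hu : IsData u₀ u₁ R)
    (hv : IsData v₀ v₁ R) (hΓ : gammaSS n p p = 0) :
    ∃ A : ℝ, 0 < A ∧ ∀ (ε : ℝ) (T : ℝ≥0∞) (u v : ℝ → L2 n), 0 < ε →
      IsWeakSolution p p D₁ D₂ V₁ V₂ R u₀ u₁ v₀ v₁ ε T u v →
      T ≤ ENNReal.ofReal (Real.exp (A * (1 + ε ^ (-(p * (p - 1)))))) := by
  obtain ⟨C, hC, k₀, hk₀, hbd⟩ := exists_dyadicBounds hn hp hp hβ hω hD₁ hD₂ hV₁ hV₂ hR hu hv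
  rw [gammaSS, sub_eq_zero, max_self] at hΓ
  obtain ⟨A, hA, hA'⟩ := exists_le_of_critical_eq hp hC hΓ
  refine ⟨_, by positivity, fun ε T u v hε hsol => le_ofReal_exp_of_le (k₀ := k₀) hA hε
    fun K hK hKT => ?_⟩
  obtain ⟨x, y, h, h'⟩ := hbd ε T u v hε.le hsol _ hKT
  exact hA' ε k₀ _ x y hε h h' K hk₀ hK le_rfl

theorem lifespan_le {ε : ℝ} {B : ℝ≥0∞}
    (h : ∀ (T : ℝ≥0∞) (u v : ℝ → L2 n),
      IsWeakSolution p q D₁ D₂ V₁ V₂ R u₀ u₁ v₀ v₁ ε T u v → T ≤ B) :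
    lifespan p q D₁ D₂ V₁ V₂ R u₀ u₁ v₀ v₁ ε ≤ B :=
  sSup_le fun T ⟨_, u, v, hsol⟩ => h T u v hsol

end

theorem one_le_rpow_neg {ε e : ℝ} (hε : 0 < ε) (hε1 : ε < 1) (he : 0 ≤ e) : 1 ≤ ε ^ (-e) :=
  Real.one_le_rpow_of_pos_of_le_one_of_nonpos hε hε1.le (by linarith)

end

end WaveSystem

theorem theorem1p1 (n : ℕ) (hn : 3 ≤ n) (p q : ℝ) (hp : 1 < p) (hq : 1 < q)
    (α₁ α₂ β ω : ℝ) (hβ : 1 < β) (hω : 2 < ω)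
    (D₁ D₂ V₁ V₂ : WaveSystem.E n → ℝ)
    (hD₁ : WaveSystem.IsCoefficient D₁ α₁ β) (hD₂ : WaveSystem.IsCoefficient D₂ α₁ β)
    (hV₁ : WaveSystem.IsCoefficient V₁ α₂ ω) (hV₂ : WaveSystem.IsCoefficient V₂ α₂ ω)
    (R : ℝ) (hR : 0 < R) (u₀ u₁ v₀ v₁ : WaveSystem.E n → ℝ)
    (hu : WaveSystem.IsData u₀ u₁ R) (hv : WaveSystem.IsData v₀ v₁ R)
    (hΓ : 0 ≤ WaveSystem.gammaSS n p q) :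
    (∀ ε : ℝ, 0 < ε →
      (∀ (T : ℝ≥0∞) (u v : ℝ → WaveSystem.L2 n),
        WaveSystem.IsWeakSolution p q D₁ D₂ V₁ V₂ R u₀ u₁ v₀ v₁ ε T u v → T < ∞) ∧
      WaveSystem.lifespan p q D₁ D₂ V₁ V₂ R u₀ u₁ v₀ v₁ ε < ∞) ∧
    ∃ ε₀ : ℝ, 0 < ε₀ ∧ ∃ C : ℝ, 0 < C ∧ ∀ ε : ℝ, 0 < ε → ε < ε₀ →
      (0 < WaveSystem.gammaSS n p q →
        WaveSystem.lifespan p q D₁ D₂ V₁ V₂ R u₀ u₁ v₀ v₁ ε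
          ≤ ENNReal.ofReal (C * ε ^ (-(WaveSystem.gammaSS n p q)⁻¹))) ∧
      (WaveSystem.gammaSS n p q = 0 → p ≠ q →
        WaveSystem.lifespan p q D₁ D₂ V₁ V₂ R u₀ u₁ v₀ v₁ ε
          ≤ ENNReal.ofReal
              (Real.exp (C * ε ^ (-(min (p * (p * q - 1)) (q * (p * q - 1))))))) ∧
      (WaveSystem.gammaSS n p q = 0 → p = q → WaveSystem.IsStraussExponent n p →
        WaveSystem.lifespan p q D₁ D₂ V₁ V₂ R u₀ u₁ v₀ v₁ ε
          ≤ ENNReal.ofReal (Real.exp (C * ε ^ (-(p * (p - 1)))))) := by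
  open WaveSystem in
  have hpq : 0 ≤ p * q - 1 := by nlinarith
  rcases hΓ.lt_or_eq with hpos | hzero
  · obtain ⟨A, hA, hbd⟩ := exists_le_of_gammaSS_pos hn hp hq hβ hω hD₁ hD₂ hV₁ hV₂ hR hu hv hpos
    refine ⟨fun ε hε => ⟨fun T u v hsol => (hbd ε T u v hε hsol).trans_lt ENNReal.ofReal_lt_top,
      (lifespan_le fun T u v hsol => hbd ε T u v hε hsol).trans_lt ENNReal.ofReal_lt_top⟩,
      1, one_pos, 2 * A, by positivity, fun ε hε hε1 => ⟨fun _ => ?_, fun h => absurd h hpos.ne',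
      fun h => absurd h hpos.ne'⟩⟩
    refine (lifespan_le fun T u v hsol => hbd ε T u v hε hsol).trans (ENNReal.ofReal_le_ofReal ?_)
    have h1 := one_le_rpow_neg hε hε1 (inv_nonneg.2 hΓ)
    nlinarith
  · obtain ⟨A, hA, hbd⟩ := exists_le_of_gammaSS_eq_zero hn hp hq hβ hω hD₁ hD₂ hV₁ hV₂ hR hu hv
      hzero.symm
    obtain ⟨B, hB, hbd'⟩ : ∃ B : ℝ, 0 < B ∧ (p = q → ∀ (ε : ℝ) (T : ℝ≥0∞) (u v : ℝ → L2 n), 0 < ε →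
        IsWeakSolution p q D₁ D₂ V₁ V₂ R u₀ u₁ v₀ v₁ ε T u v →
        T ≤ ENNReal.ofReal (Real.exp (B * (1 + ε ^ (-(p * (p - 1))))))) := by
      by_cases h : p = q
      · subst h
        obtain ⟨B, hB, hbd'⟩ := exists_le_of_gammaSS_eq_zero_of_eq hn hp hβ hω hD₁ hD₂ hV₁ hV₂ hR
          hu hv hzero.symm
        exact ⟨B, hB, fun _ => hbd'⟩
      · exact ⟨1, one_pos, fun h' => absurd h' h⟩
    have hmin : 0 ≤ min (p * (p * q - 1)) (q * (p * q - 1)) :=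
      le_min (mul_nonneg (by linarith) hpq) (mul_nonneg (by linarith) hpq)
    refine ⟨fun ε hε => ⟨fun T u v hsol => (hbd ε T u v hε hsol).trans_lt ENNReal.ofReal_lt_top,
      (lifespan_le fun T u v hsol => hbd ε T u v hε hsol).trans_lt ENNReal.ofReal_lt_top⟩,
      1, one_pos, 2 * A + 2 * B, by positivity, fun ε hε hε1 => ⟨fun h => absurd h hzero.ge.not_gt,
      fun _ _ => ?_, fun _ hpq' _ => ?_⟩⟩
    · refine (lifespan_le fun T u v hsol => hbd ε T u v hε hsol).trans
        (ENNReal.ofReal_le_ofReal (Real.exp_le_exp.2 ?_))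
      have h1 := one_le_rpow_neg hε hε1 hmin
      nlinarith
    · refine (lifespan_le fun T u v hsol => hbd' hpq' ε T u v hε hsol).trans
        (ENNReal.ofReal_le_ofReal (Real.exp_le_exp.2 ?_))
      have h1 := one_le_rpow_neg hε hε1 (mul_nonneg (by linarith : 0 ≤ p)
        (by linarith : 0 ≤ p - 1))
      nlinarith
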